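/- **Setting.** Let $m\in\mathbb N$, $D=(0,1)$ with periodic boundary conditions, $0<T<\infty$, $\mathcal U\subset\mathbb R^m$ open and convex (the state space), and $\mathcal C\subset\mathcal U$ compact and convex. Let $f\in C^2(\mathcal U;\mathbb R^m)$ and let $(\eta,q)$ be an entropy/entropy flux pair for $\partial_t u+\partial_x f(u)=0$: $\eta,q\in C^2(\mathcal U;\mathbb R)$, $\eta$ strictly convex with positive definite Hessian on $\mathcal C$, and $Dq=D\eta\,Df$ on $\mathcal U$. Put $\mathcal F=L^2(D;\mathcal U)$ and $L^2(D;\mathcal C)=\{u\in\mathcal F:\ u(x)\in\mathcal C\text{ for a.e. }x\}$. **$\mathcal C$-valued statistical solutions.** Let $\bar\mu$ be a Borel probability measure on $\mathcal F$ supported on $L^2(D;\mathcal C)$. A $\mathcal C$-valued statistical solution with initial data $\bar\mu$ is a map $t\mapsto\mu_t$ from $[0,T)$ to the probability measures on $\mathcal F$ supported on $L^2(D;\mathcal C)$, such that $t\mapsto\int_{\mathcal F}\int_{D^k}g(x,u(x_1),\dots,u(x_k))\,dx\,d\mu_t(u)$ is measurable for all $k\ge1$ and $g\in L^1(D^k;C_0(\mathcal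 U^k))$, and such that the correlation measures $\nu^k_{t,x}$ corresponding to $\mu$ (the time-dependent $2$-summable correlation measure dual to $\mu$, i.e. $\int_{D^k}\langle\nu^k_{t,x},g(x)\rangle dx=\int_{\mathcal F}\int_{D^k}g(x,u(x_1),\dots,u(x_k))\,dx\,d\mu_t(u)$ for a.e. $t$ and all such $g$) satisfy, for every $k\ge 1$, $$\partial_t\langle\nu^k_{t,x},\xi_1\otimes\dots\otimes\xi_k\rangle+\sum_{i=1}^k\partial_{x_i}\langle\nu^k_{t,x},\xi_1\otimes\dots\otimes f(\xi_i)\otimes\dots\otimes\xi_k\rangle=0$$ in the sense of distributions on $[0,T)\times D^k$ with initial value $\int u(x_1)\otimes\dots\otimes u(x_k)\,d\bar\mu(u)$. It is *dissipative* if 1. for all $K\in\mathbb N$, all $\alpha_1,\dots,\alpha_K>0$ with $\sum_i\alpha_i=1$ and all probability measures $\bar\mu_1,\dots,\bar\mu_K$ with $\sum_i\alpha_i\bar\mu_i=\bar\mu$, there are $\mathcal C$-valued statistical solutions $\mu_{i,t}$ with initial data $\bar\mu_i$ such that $\sum_i\alpha_i\mu_{i,t}=\mu_t$ for all $t\in[0,T)$;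 2. for all $\phi\in C_c^\infty([0,T)\times D;\mathbb R_+)$, $$\int_0^T\!\!\int_{\mathcal F}\int_D\big(\eta(u)\,\partial_t\phi+q(u)\,\partial_x\phi\big)\,dx\,d\mu_t(u)\,dt+\int_{\mathcal F}\int_D\eta(\bar u(x))\,\phi(0,x)\,dx\,d\bar\mu(\bar u)\ge0 .$$ **Regularized empirical measure.** Let $w_1,\dots,w_K\ge0$ with $\sum_k w_k=1$, and let $u_1^{st},\dots,u_K^{st}:[0,T)\times\mathbb R\to\mathbb R^m$ be Lipschitz continuous in space and time and $1$-periodic in $x$ (the space-time reconstructions of the numerical solutions). Put $$\hat\mu_t=\sum_k w_k\,\delta_{u_k^{st}(t,\cdot)},\qquad \hat{\bar\mu}=\hat\mu_0,\qquad \mathcal R_k^{st}=\partial_t u_k^{st}+\partial_x f(u_k^{st}),\qquad L=L(s)=\max_k\|\partial_x u_k^{st}\|_{L^\infty((0,s)\times D)},$$ and let $W_2$ be the $2$-Wasserstein distance on $\mathcal F$ with respect to the $L^2$ norm. **Theorem.** Let $\mu_t$ be a dissipative $\mathcal C$-valued statistical solution with initial data $\bar\mu$, and let $\hat\mu_t$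 be supported on $L^2(D;\mathcal C)$ for all $t\in[0,T)$. Then there are constants $\overline C_f\ge0$ and $0<\underline C_\eta\le\overline C_\eta$ with $$|z^\top H_vf\,z|\le\overline C_f|z|^2,\qquad \underline C_\eta|z|^2\le|z^\top H_v\eta\,z|\le\overline C_\eta|z|^2\qquad\text{for all } z\in\mathbb R^m,\ v\in\mathcal C,$$ where $H_v$ denotes the second derivative at $v$. For any such constants, with $$A=\max\{(1+\overline C_f)\,\underline C_\eta^{-1},\ \overline C_\eta\},\qquad B=\overline C_\eta ,$$ one has for a.e. $s\in(0,T)$ $$W_2(\mu_s,\hat\mu_s)^2\le A\Big(\sum_{k}w_k\int_0^s\!\!\int_D|\mathcal R_k^{st}|^2\,dx\,dt+A\,W_2(\bar\mu,\hat{\bar\mu})^2\Big)\exp\big(s\,A^3B\,(L+1)\big).$$ -/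

import Mathlib

open MeasureTheory ProbabilityTheory Set Filter Topology
open scoped ENNReal NNReal ZeroAtInfty

noncomputable section

/-- The ambient space `ℝ^m` of states, with the Euclidean norm. -/
abbrev Vec (m : ℕ) : Type := EuclideanSpace ℝ (Fin m)

/-- The spatial domain `D = (0,1)`. Periodicity is imposed on test functions and on
reconstructions. -/
abbrev unitDomain : Set ℝ := Ioo 0 1

/-- The product domain `D^k`. -/
def cube (k : ℕ) : Set (Fin k → ℝ) := Set.univ.pi fun _ => unitDomain

/-- The space `L²(D; ℝ^m)`. -/
abbrev L2Fun (m : ℕ) : Type :=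
  Lp (Vec m) 2 ((volume : Measure ℝ).restrict unitDomain)

/-- `L²(D; ℝ^m)` carries its Borel `σ`-algebra. -/
instance instMeasurableSpaceL2Fun (m : ℕ) : MeasurableSpace (L2Fun m) := borel _

instance instBorelSpaceL2Fun (m : ℕ) : BorelSpace (L2Fun m) := ⟨rfl⟩

open Classical in
/-- The class in `L²(D; ℝ^m)` of a function (which is `0` if the function is not in `L²`). -/
def toL2 {m : ℕ} (g : ℝ → Vec m) : L2Fun m :=
  if h : MemLp g 2 ((volume : Measure ℝ).restrict unitDomain) then h.toLp g else 0

/-! ### The system, its entropy, and the Hessian bounds -/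

/-- `(η, q)` is an entropy / entropy flux pair for the flux `f` on the state space `U`:
`η` is strictly convex, `η` and `q` are `C²`, and `Dq = Dη Df`. The flux is `C²` as well. -/
structure IsEntropyPair {m : ℕ} (U : Set (Vec m)) (f : Vec m → Vec m) (η q : Vec m → ℝ) :
    Prop where
  flux_contDiffOn : ContDiffOn ℝ 2 f U
  entropy_contDiffOn : ContDiffOn ℝ 2 η U
  entropyFlux_contDiffOn : ContDiffOn ℝ 2 q U
  strictConvexOn : StrictConvexOn ℝ U η
  compatible : ∀ u ∈ U, fderiv ℝ q u = (fderiv ℝ η u).comp (fderiv ℝ f u)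

/-- The second derivatives of `f` and `η` satisfy, for all `v ∈ C` and all `w`,
`|wᵀ H_v f w| ≤ cf |w|²` and `cl |w|² ≤ |wᵀ H_v η w| ≤ cu |w|²`. -/
structure HessianBounds {m : ℕ} (C : Set (Vec m)) (f : Vec m → Vec m) (η : Vec m → ℝ)
    (cf cl cu : ℝ) : Prop where
  cf_nonneg : 0 ≤ cf
  cl_pos : 0 < cl
  cl_le_cu : cl ≤ cu
  flux_le : ∀ v ∈ C, ∀ w, ‖fderiv ℝ (fderiv ℝ f) v w w‖ ≤ cf * ‖w‖ ^ 2
  le_entropy : ∀ v ∈ C, ∀ w, cl * ‖w‖ ^ 2 ≤ |fderiv ℝ (fderiv ℝ η) v w w|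
  entropy_le : ∀ v ∈ C, ∀ w, |fderiv ℝ (fderiv ℝ η) v w w| ≤ cu * ‖w‖ ^ 2

/-! ### Correlation measures -/

/-- `g` is (a representative of) an element of `L¹(D^k; C₀(U^k))`, where `C₀(U^k)` is the space
of elements of `C₀((ℝ^m)^k)` that vanish outside `U^k`. -/
def IsCorrTest {m : ℕ} (U : Set (Vec m)) {k : ℕ} (g : (Fin k → ℝ) → C₀(Fin k → Vec m, ℝ)) :
    Prop :=
  Integrable g (volume.restrict (cube k)) ∧ ∀ x, ∀ ξ : Fin k → Vec m, (∃ i, ξ i ∉ U) → g x ξ = 0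

/-- A square-summable correlation measure `ν = (ν¹, ν², …)`, where `ν^k` is a Young measure from
`D^k` to `U^k`: a measurable family of probability measures on `(ℝ^m)^k`, concentrated on `U^k`
for almost every point of `D^k`. The entry with index `0` plays no role. -/
structure IsCorrelationMeasure {m : ℕ} (U : Set (Vec m))
    (ν : (k : ℕ) → Kernel (Fin k → ℝ) (Fin k → Vec m)) : Prop where
  young : ∀ k, 1 ≤ k → IsMarkovKernel (ν k) ∧
    ∀ᵐ x ∂(volume.restrict (cube k)), ν k x {ξ | ∃ i, ξ i ∉ U} = 0
  symmetric : ∀ k, 1 ≤ k → ∀ (σ : Equiv.Perm (Fin k)) (h : C₀(Fin k → Vec m, ℝ)),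
    (∀ ξ, (∃ i, ξ i ∉ U) → h ξ = 0) →
    ∀ᵐ x ∂(volume.restrict (cube k)),
      ∫ ξ, h ξ ∂(ν k (x ∘ σ)) = ∫ ξ, h (ξ ∘ σ) ∂(ν k x)
  consistent : ∀ k, 1 ≤ k → ∀ h : C₀(Fin k → Vec m, ℝ),
    (∀ ξ, (∃ i, ξ i ∉ U) → h ξ = 0) →
    ∀ᵐ x ∂(volume.restrict (cube (k + 1))),
      ∫ ξ, h (fun i => ξ i.castSucc) ∂(ν (k + 1) x) = ∫ ξ, h ξ ∂(ν k fun i => x i.castSucc)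
  integrable : ∫⁻ x in unitDomain, ∫⁻ ξ, ‖ξ 0‖ₑ ^ 2 ∂(ν 1 fun _ => x) < ∞
  diagonal : Tendsto (fun r : ℝ => ∫⁻ x₁ in unitDomain, (volume (Metric.ball x₁ r))⁻¹ *
      ∫⁻ x₂ in Metric.ball x₁ r ∩ unitDomain, ∫⁻ ξ, ‖ξ 0 - ξ 1‖ₑ ^ 2 ∂(ν 2 ![x₁, x₂]))
    (𝓝[>] 0) (𝓝 0)

/-- The time slice at time `t` of a time-dependent family of Young measures. -/
def timeSlice {m : ℕ} (ν : (k : ℕ) → Kernel (ℝ × (Fin k → ℝ)) (Fin k → Vec m)) (t : ℝ) (k : ℕ) :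
    Kernel (Fin k → ℝ) (Fin k → Vec m) :=
  (ν k).comap (fun x => (t, x)) measurable_prodMk_left

/-- A time-dependent square-summable correlation measure on `[0,T)`. -/
structure IsTimeCorrelationMeasure {m : ℕ} (U : Set (Vec m)) (T : ℝ)
    (ν : (k : ℕ) → Kernel (ℝ × (Fin k → ℝ)) (Fin k → Vec m)) : Prop where
  slice : ∀ᵐ t ∂(volume.restrict (Ico 0 T)), IsCorrelationMeasure U (timeSlice ν t)
  integrable : ∃ M : ℝ≥0, ∀ᵐ t ∂(volume.restrict (Ico 0 T)),
    ∫⁻ x in unitDomain, ∫⁻ ξ, ‖ξ 0‖ₑ ^ 2 ∂(ν 1 (t, fun _ => x)) ≤ M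
  diagonal : ∀ T' ∈ Ioo 0 T,
    Tendsto (fun r : ℝ => ∫⁻ t in Ioo 0 T', ∫⁻ x₁ in unitDomain, (volume (Metric.ball x₁ r))⁻¹ *
      ∫⁻ x₂ in Metric.ball x₁ r ∩ unitDomain, ∫⁻ ξ, ‖ξ 0 - ξ 1‖ₑ ^ 2 ∂(ν 2 (t, ![x₁, x₂])))
    (𝓝[>] 0) (𝓝 0)

/-- `∫_{L²} ∫_{D^k} g(x, u(x₁), …, u(x_k)) dx dμ(u)`. -/
def corrPairing {m k : ℕ} (μ : Measure (L2Fun m)) (g : (Fin k → ℝ) → C₀(Fin k → Vec m, ℝ)) : ℝ :=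
  ∫ u, (∫ x in cube k, g x (fun i => u (x i))) ∂μ

/-- The family `μ_t` is dual to the time-dependent correlation measure `ν`. -/
def IsDualTo {m : ℕ} (U : Set (Vec m)) (T : ℝ) (μ : ℝ → Measure (L2Fun m))
    (ν : (k : ℕ) → Kernel (ℝ × (Fin k → ℝ)) (Fin k → Vec m)) : Prop :=
  ∀ k, 1 ≤ k → ∀ g : (Fin k → ℝ) → C₀(Fin k → Vec m, ℝ), IsCorrTest U g →
    ∀ᵐ t ∂(volume.restrict (Ico 0 T)),
      ∫ x in cube k, (∫ ξ, g x ξ ∂(ν k (t, x))) = corrPairing (μ t) g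

/-! ### Statistical solutions -/

/-- `μ` is supported on `L²(D; C)`, the functions with values in `C` almost everywhere. -/
def IsValuedIn {m : ℕ} (C : Set (Vec m)) (μ : Measure (L2Fun m)) : Prop :=
  ∀ᵐ u ∂μ, ∀ᵐ x ∂((volume : Measure ℝ).restrict unitDomain), u x ∈ C

/-- `φ ∈ C_c^∞([0,T) × D^k)`, for `D` with periodic boundary conditions: `φ` is smooth up to time
`0`, one-periodic in every space variable and vanishes for times close to `T`. -/
structure IsTestFunction (T : ℝ) {k : ℕ} (φ : ℝ × (Fin k → ℝ) → ℝ) : Prop where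
  smooth : ContDiff ℝ ((⊤ : ℕ∞) : WithTop ℕ∞) φ
  periodic : ∀ t x i, φ (t, Function.update x i (x i + 1)) = φ (t, x)
  support : ∃ T' < T, ∀ t, T' ≤ t → ∀ x, φ (t, x) = 0

/-- The equation
`∂_t ⟨ν^k, ξ₁ ⊗ … ⊗ ξ_k⟩ + ∑_l ∂_{x_l} ⟨ν^k, ξ₁ ⊗ … ⊗ f(ξ_l) ⊗ … ⊗ ξ_k⟩ = 0`
in the sense of distributions on `[0,T) × D^k`, with the initial value given by `μbar`, written
for each component `j = (j₁, …, j_k)` of the tensors. -/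
def SatisfiesMarginalEquation {m : ℕ} (f : Vec m → Vec m) (T : ℝ) (μbar : Measure (L2Fun m))
    (k : ℕ) (ν : Kernel (ℝ × (Fin k → ℝ)) (Fin k → Vec m)) : Prop :=
  ∀ (j : Fin k → Fin m) (φ : ℝ × (Fin k → ℝ) → ℝ), IsTestFunction T φ →
    (∫ t in Ioo 0 T, ∫ x in cube k,
      (deriv (fun τ => φ (τ, x)) t * (∫ ξ, ∏ i, ξ i (j i) ∂(ν (t, x))) +
        ∑ l, deriv (fun y => φ (t, Function.update x l y)) (x l) *
          ∫ ξ, ∏ i, (if i = l then f (ξ i) else ξ i) (j i) ∂(ν (t, x)))) +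
    (∫ u, (∫ x in cube k, (∏ i, u (x i) (j i)) * φ (0, x)) ∂μbar) = 0

/-- `μ : [0,T) → P(L²(D; U))` is a `C`-valued statistical solution with initial data `μbar`. -/
structure IsCStatSol {m : ℕ} (U C : Set (Vec m)) (f : Vec m → Vec m) (T : ℝ)
    (μbar : Measure (L2Fun m)) (μ : ℝ → Measure (L2Fun m)) : Prop where
  initial_prob : IsProbabilityMeasure μbar
  initial_valued : IsValuedIn C μbar
  prob : ∀ t ∈ Ico 0 T, IsProbabilityMeasure (μ t)
  valued : ∀ t ∈ Ico 0 T, IsValuedIn C (μ t)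
  measurable : ∀ k, 1 ≤ k → ∀ g : (Fin k → ℝ) → C₀(Fin k → Vec m, ℝ), IsCorrTest U g →
    AEMeasurable (fun t => corrPairing (μ t) g) (volume.restrict (Ico 0 T))
  evolution : ∃ ν : (k : ℕ) → Kernel (ℝ × (Fin k → ℝ)) (Fin k → Vec m),
    IsTimeCorrelationMeasure U T ν ∧ IsDualTo U T μ ν ∧
      ∀ k, 1 ≤ k → SatisfiesMarginalEquation f T μbar k (ν k)

/-- The set `Λ(α, μ)` of `K`-tuples of probability measures with `∑ αᵢ μᵢ = μ`. -/
def decompositions {X : Type*} [MeasurableSpace X] {K : ℕ} (α : Fin K → ℝ) (μ : Measure X) :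
    Set (Fin K → Measure X) :=
  {μs | (∀ i, IsProbabilityMeasure (μs i)) ∧ ∑ i, ENNReal.ofReal (α i) • μs i = μ}

/-- `φ ∈ C_c^∞([0,T) × D; ℝ₊)`, for `D` with periodic boundary conditions. -/
structure IsNonnegTestFunction (T : ℝ) (φ : ℝ × ℝ → ℝ) : Prop where
  smooth : ContDiff ℝ ((⊤ : ℕ∞) : WithTop ℕ∞) φ
  periodic : ∀ t x, φ (t, x + 1) = φ (t, x)
  support : ∃ T' < T, ∀ t, T' ≤ t → ∀ x, φ (t, x) = 0
  nonneg : ∀ t, 0 ≤ t → ∀ x, 0 ≤ φ (t, x)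

/-- `μ` is a dissipative `C`-valued statistical solution with initial data `μbar`.

In `stable` the coefficients are positive. For a vanishing coefficient the corresponding initial
measure would be unconstrained, in particular not supported on `L²(D; C)`. -/
structure IsDissipativeCStatSol {m : ℕ} (U C : Set (Vec m)) (f : Vec m → Vec m)
    (η q : Vec m → ℝ) (T : ℝ) (μbar : Measure (L2Fun m)) (μ : ℝ → Measure (L2Fun m)) : Prop where
  statSol : IsCStatSol U C f T μbar μ
  stable : ∀ (K : ℕ) (α : Fin K → ℝ), (∀ i, 0 < α i) → ∑ i, α i = 1 →
    ∀ μsbar ∈ decompositions α μbar, ∃ μs : Fin K → ℝ → Measure (L2Fun m),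
      (∀ t ∈ Ico 0 T, (fun i => μs i t) ∈ decompositions α (μ t)) ∧
      ∀ i, IsCStatSol U C f T (μsbar i) (μs i)
  entropy : ∀ φ : ℝ × ℝ → ℝ, IsNonnegTestFunction T φ →
    0 ≤ (∫ t in Ioo 0 T, ∫ u, (∫ x in unitDomain,
        (η (u x) * deriv (fun τ => φ (τ, x)) t + q (u x) * deriv (fun y => φ (t, y)) x)) ∂(μ t)) +
      ∫ u, (∫ x in unitDomain, η (u x) * φ (0, x)) ∂μbar

/-! ### Wasserstein distance, reconstructions, residuals -/

/-- The set `Π(μ, ρ)` of transport plans from `μ` to `ρ`. -/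
def transportPlans {X : Type*} [MeasurableSpace X] (μ ρ : Measure X) : Set (Measure (X × X)) :=
  {π | π.map Prod.fst = μ ∧ π.map Prod.snd = ρ}

/-- The `r`-Wasserstein distance, as an extended nonnegative real number. -/
def wassersteinDist {X : Type*} [NormedAddCommGroup X] [MeasurableSpace X] (r : ℝ)
    (μ ρ : Measure X) : ℝ≥0∞ :=
  (⨅ π ∈ transportPlans μ ρ, ∫⁻ p, ‖p.1 - p.2‖ₑ ^ r ∂π) ^ (1 / r)

/-- A space-time reconstruction on `[0,T)`: Lipschitz continuous in space and time, and periodic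
in space. -/
structure IsReconstruction {m : ℕ} (T : ℝ) (v : ℝ → ℝ → Vec m) : Prop where
  lipschitz : ∃ c : ℝ≥0, LipschitzOnWith c (fun p : ℝ × ℝ => v p.1 p.2) (Ico 0 T ×ˢ univ)
  periodic : ∀ t ∈ Ico 0 T, Function.Periodic (v t) 1

/-- The space-time residual `∂_t v + ∂_x f(v)`. -/
def spaceTimeResidual {m : ℕ} (f : Vec m → Vec m) (v : ℝ → ℝ → Vec m) (t x : ℝ) : Vec m :=
  deriv (fun τ => v τ x) t + deriv (fun y => f (v t y)) x

/-- The regularized empirical measure `∑ w_k δ_{v_k(t)}` at time `t`. -/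
def regularizedEmpiricalMeasure {m K : ℕ} (w : Fin K → ℝ) (v : Fin K → ℝ → ℝ → Vec m) (t : ℝ) :
    Measure (L2Fun m) :=
  ∑ k, ENNReal.ofReal (w k) • Measure.dirac (toL2 (v k t))

/-- `max_k ‖∂_x v_k‖_{L^∞((0,s) × D)}`. -/
def maxSpatialSlope {m K : ℕ} (v : Fin K → ℝ → ℝ → Vec m) (s : ℝ) : ℝ :=
  ⨆ k, (eLpNorm (fun p : ℝ × ℝ => deriv (v k p.1) p.2) ∞
    (volume.restrict (Ioo 0 s ×ˢ unitDomain))).toReal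

/-- `∑_k w_k ∫_0^s ∫_D |R_k|² dx dt`, with `R_k` the space-time residual of `v_k`. -/
def weightedResidual {m K : ℕ} (f : Vec m → Vec m) (w : Fin K → ℝ) (v : Fin K → ℝ → ℝ → Vec m)
    (s : ℝ) : ℝ :=
  ∑ k, w k * ∫ t in Ioo 0 s, ∫ x in unitDomain, ‖spaceTimeResidual f (v k) t x‖ ^ 2

end

/-! ### Taylor estimates on convex sets -/

/-! This is weak–strong stability by the relative entropy method, with a transport plan deciding
which part of the solution is compared with which reconstruction. A plan from `μbar` to a finitely
supported measure disintegrates over the atoms (`exists_decomposition_of_mem_transportPlans`): `μbar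
= ∑ w_k ρ_k`, where `ρ_k` is the conditional law of the first coordinate given that the second is
`v_k(0)`, and the cost is the weighted sum of the mean square distances of `ρ_k` to `v_k(0)`. The
stability clause of dissipativity propagates this to `μ_t = ∑ w_k μ_{k,t}`. At later times each part
is still compared with its own reconstruction, and the plan that sends `μ_{k,t}` to `v_k(t)` bounds
`W_2²` by the weighted mean square distance.

That distance is controlled by the relative entropy, the weighted mean of `η(u) - η(v_k) - Dη(v_k)(u
- v_k)`. The entropy inequality is available only for the mixture `μ`, not for each `μ_k`. This
suffices: the weighted sum of the means of `η(u)` is the mean under `μ`, and a test function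
constant in space removes the entropy flux. The other terms are affine in `u`, so they involve `μ_k`
only through the first correlation marginal, and the equation for `k = 1`, tested with `θ(t)
Dη(v_k)`, computes them (`IsYoungMeasureOf.entropy_balance`). Higher correlations play no role
beyond this. Two preparations are needed: the first marginal becomes a Markov kernel with values in
`C` (`IsCStatSol.exists_youngMeasure`), and mollification extends the equation from smooth to
Lipschitz tests (`IsYoungMeasureOf.equation_lipschitz`), since `v_k` is only Lipschitz.

Compatibility of `η` and `q` makes `D²η Df` symmetric. Hence the part of the production that is
linear in `u - v` is exactly the pairing with the residual, and the rest is a quadratic Taylor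
remainder of `f` (`HessianBounds.abs_production_le`). Localizing in time at Lebesgue points
(`ae_le_of_forall_smooth_cutoff`), comparing the relative entropy with the square distance from both
sides and applying `gronwall_of_ae_le` give the bound `ae_totalSqDist_le`, with factor `1/cl` and
rate `(cu² + cu cf L)/cl`; `stability_constants_le` absorbs these into `A` and `B`. The null set of
exceptional times depends on the plan, so the final step passes to the limit along a minimizing
sequence of plans; no optimal plan is needed. -/

lemma taylor_lower_unitInterval {g g' g'' : ℝ → ℝ} {c : ℝ}
    (hg : ∀ τ ∈ Icc (0 : ℝ) 1, HasDerivAt g (g' τ) τ)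
    (hg' : ∀ τ ∈ Icc (0 : ℝ) 1, HasDerivAt g' (g'' τ) τ)
    (hc : ∀ τ ∈ Icc (0 : ℝ) 1, c ≤ g'' τ) : g 0 + g' 0 + c / 2 ≤ g 1 := by
  have h1 : MonotoneOn (fun τ => g' τ - c * τ) (Icc 0 1) := by
    refine monotoneOn_of_hasDerivWithinAt_nonneg (convex_Icc 0 1)
      (fun τ hτ => ((hg' τ hτ).continuousAt.sub (by fun_prop)).continuousWithinAt)
      (f' := fun τ => g'' τ - c) (fun τ hτ => ?_) (fun τ hτ => ?_)
    · have := (hg' τ (interior_subset hτ)).sub ((hasDerivAt_id τ).const_mul c)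
      exact (this.congr_deriv (by simp)).hasDerivWithinAt
    · have := hc τ (interior_subset hτ); linarith
  -- The derivative of this function is `g' τ - g' 0 - c τ`, nonnegative by the monotonicity just
  -- shown, so no continuity of `g''` is needed.
  have h2 : MonotoneOn (fun τ => g τ - g' 0 * τ - c / 2 * τ ^ 2) (Icc 0 1) := by
    refine monotoneOn_of_hasDerivWithinAt_nonneg (convex_Icc 0 1)
      (fun τ hτ => (((hg τ hτ).continuousAt.sub (by fun_prop)).sub
        (by fun_prop)).continuousWithinAt)
      (f' := fun τ => g' τ - g' 0 - c * τ) (fun τ hτ => ?_) (fun τ hτ => ?_)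
    · have := ((hg τ (interior_subset hτ)).sub ((hasDerivAt_id τ).const_mul (g' 0))).sub
        ((hasDerivAt_pow 2 τ).const_mul (c / 2))
      exact (this.congr_deriv (by norm_num; ring)).hasDerivWithinAt
    · have hτ' := interior_subset hτ
      have := h1 (left_mem_Icc.2 zero_le_one) hτ' hτ'.1
      simp only at this; linarith
  have := h2 (left_mem_Icc.2 zero_le_one) (right_mem_Icc.2 zero_le_one) zero_le_one
  simp only at this; linarith

section Taylor

variable {E F : Type*} [NormedAddCommGroup E] [NormedSpace ℝ E] [NormedAddCommGroup F]
  [NormedSpace ℝ F] {U C : Set E}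

lemma ContDiffOn.hasFDerivAt_of_mem {f : E → F} (hU : IsOpen U) (hf : ContDiffOn ℝ 2 f U) {x : E}
    (hx : x ∈ U) : HasFDerivAt f (fderiv ℝ f x) x :=
  ((hf.contDiffAt (hU.mem_nhds hx)).differentiableAt (by norm_num)).hasFDerivAt

lemma ContDiffOn.contDiffOn_one_fderiv {f : E → F} (hU : IsOpen U) (hf : ContDiffOn ℝ 2 f U) :
    ContDiffOn ℝ 1 (fderiv ℝ f) U :=
  hf.fderiv_of_isOpen hU (by norm_num)

lemma ContDiffOn.hasFDerivAt_fderiv_of_mem {f : E → F} (hU : IsOpen U) (hf : ContDiffOn ℝ 2 f U)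
    {x : E} (hx : x ∈ U) : HasFDerivAt (fderiv ℝ f) (fderiv ℝ (fderiv ℝ f) x) x :=
  (((hf.contDiffOn_one_fderiv hU).contDiffAt (hU.mem_nhds hx)).differentiableAt
    (by norm_num)).hasFDerivAt

lemma ContDiffOn.continuousOn_fderiv_fderiv {f : E → F} (hU : IsOpen U)
    (hf : ContDiffOn ℝ 2 f U) : ContinuousOn (fderiv ℝ (fderiv ℝ f)) U :=
  (hf.contDiffOn_one_fderiv hU).continuousOn_fderiv_of_isOpen hU (by norm_num)

lemma Convex.taylor_lower {h : E → ℝ} (hU : IsOpen U) (hC : Convex ℝ C) (hCU : C ⊆ U)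
    (hh : ContDiffOn ℝ 2 h U) {a b : E} (ha : a ∈ C) (hb : b ∈ C) {c : ℝ}
    (hc : ∀ p ∈ C, c ≤ fderiv ℝ (fderiv ℝ h) p (b - a) (b - a)) :
    h a + fderiv ℝ h a (b - a) + c / 2 ≤ h b := by
  have hmem : ∀ τ ∈ Icc (0 : ℝ) 1, a + τ • (b - a) ∈ C := fun τ hτ =>
    hC.add_smul_sub_mem ha hb hτ
  have hline : ∀ τ : ℝ, HasDerivAt (fun τ : ℝ => a + τ • (b - a)) (b - a) τ := fun τ => by
    simpa using ((hasDerivAt_id τ).smul_const (b - a)).const_add a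
  have := taylor_lower_unitInterval (g := fun τ => h (a + τ • (b - a)))
    (g' := fun τ => fderiv ℝ h (a + τ • (b - a)) (b - a))
    (g'' := fun τ => fderiv ℝ (fderiv ℝ h) (a + τ • (b - a)) (b - a) (b - a)) (c := c)
    (fun τ hτ => (hh.hasFDerivAt_of_mem hU (hCU (hmem τ hτ))).comp_hasDerivAt τ (hline τ))
    (fun τ hτ => by
      have := ((hh.hasFDerivAt_fderiv_of_mem hU (hCU (hmem τ hτ))).comp_hasDerivAt τ (hline τ))
      exact this.clm_apply (hasDerivAt_const τ (b - a)) |>.congr_deriv (by simp))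
    (fun τ hτ => hc _ (hmem τ hτ))
  simpa using this

lemma Convex.taylor_upper {h : E → ℝ} (hU : IsOpen U) (hC : Convex ℝ C) (hCU : C ⊆ U)
    (hh : ContDiffOn ℝ 2 h U) {a b : E} (ha : a ∈ C) (hb : b ∈ C) {c : ℝ}
    (hc : ∀ p ∈ C, fderiv ℝ (fderiv ℝ h) p (b - a) (b - a) ≤ c) :
    h b ≤ h a + fderiv ℝ h a (b - a) + c / 2 := by
  have h1 : fderiv ℝ (fun x => -h x) = fun x => -fderiv ℝ h x := by
    ext1 x; exact fderiv_neg
  have h2 : fderiv ℝ (fun x => -fderiv ℝ h x) = fun x => -fderiv ℝ (fderiv ℝ h) x := by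
    ext1 x; exact fderiv_neg
  have := hC.taylor_lower hU hCU hh.neg ha hb (c := -c) (fun p hp => by
    rw [h1, h2]; exact neg_le_neg (hc p hp))
  rw [h1] at this
  simp only [neg_apply] at this
  linarith

lemma ContDiffOn.exists_lipschitzOnWith_of_convex_isCompact {f : E → F} (hU : IsOpen U)
    (hf : ContDiffOn ℝ 1 f U) (hC : Convex ℝ C) (hCc : IsCompact C) (hCU : C ⊆ U) :
    ∃ c : ℝ≥0, LipschitzOnWith c f C := by
  have hcont : ContinuousOn (fun x => ‖fderiv ℝ f x‖) C :=
    ((hf.continuousOn_fderiv_of_isOpen hU (by norm_num)).mono hCU).norm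
  obtain ⟨M, hM⟩ := hCc.bddAbove_image hcont
  refine ⟨M.toNNReal, hC.lipschitzOnWith_of_nnnorm_hasFDerivWithin_le (f' := fderiv ℝ f)
    (fun x hx => ?_) (fun x hx => ?_)⟩
  · exact ((hf.contDiffAt (hU.mem_nhds (hCU hx))).differentiableAt
      (by norm_num)).hasFDerivAt.hasFDerivWithinAt
  · rw [← NNReal.coe_le_coe, coe_nnnorm]
    exact (hM (mem_image_of_mem _ hx)).trans (Real.le_coe_toNNReal _)

end Taylor

/-- The scalar estimate is applied to the pairing of `f` with its own Taylor remainder `y`. This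
gives `‖y‖² ≤ ‖y‖ c / 2`, so the vector-valued bound has the scalar constant, without a factor
depending on the dimension. -/
lemma Convex.norm_taylor_le {E F : Type*} [NormedAddCommGroup E] [NormedSpace ℝ E]
    [NormedAddCommGroup F] [InnerProductSpace ℝ F] {U C : Set E} {f : E → F} (hU : IsOpen U)
    (hC : Convex ℝ C) (hCU : C ⊆ U) (hf : ContDiffOn ℝ 2 f U) {a b : E} (ha : a ∈ C) (hb : b ∈ C)
    {c : ℝ} (hc : ∀ p ∈ C, ‖fderiv ℝ (fderiv ℝ f) p (b - a) (b - a)‖ ≤ c) :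
    ‖f b - f a - fderiv ℝ f a (b - a)‖ ≤ c / 2 := by
  set y := f b - f a - fderiv ℝ f a (b - a) with hy
  let l : F →L[ℝ] ℝ := innerSL ℝ y
  have h1 : ∀ x ∈ U, fderiv ℝ (fun x => l (f x)) x = l.comp (fderiv ℝ f x) := fun x hx =>
    (l.hasFDerivAt.comp x (hf.hasFDerivAt_of_mem hU hx)).fderiv
  have h2 : ∀ x ∈ U, ∀ u w, fderiv ℝ (fderiv ℝ (fun x => l (f x))) x u w =
      l (fderiv ℝ (fderiv ℝ f) x u w) := fun x hx u w => by
    have heq : fderiv ℝ (fun x => l (f x)) =ᶠ[𝓝 x] fun x => l.comp (fderiv ℝ f x) := by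
      filter_upwards [hU.mem_nhds hx] with z hz using h1 z hz
    rw [heq.fderiv_eq]
    have := ((ContinuousLinearMap.compL ℝ E F ℝ l).hasFDerivAt.comp x
      (hf.hasFDerivAt_fderiv_of_mem hU hx)).fderiv
    have h3 : (fun x => l.comp (fderiv ℝ f x)) =
      (ContinuousLinearMap.compL ℝ E F ℝ l) ∘ (fderiv ℝ f) := rfl
    rw [h3, this]; rfl
  have := hC.taylor_upper hU hCU (l.contDiff.comp_contDiffOn hf) ha hb (c := ‖y‖ * c)
    (fun p hp => by
      refine (h2 p (hCU hp) _ _).le.trans ((le_abs_self _).trans ?_)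
      exact (abs_real_inner_le_norm _ _).trans (by gcongr; exact hc p hp))
  have h3 := h1 a (hCU ha)
  change l (f b) ≤ l (f a) + fderiv ℝ (fun x => l (f x)) a (b - a) + _ at this
  rw [h3] at this
  have h4 : l y ≤ ‖y‖ * c / 2 := by
    have : l y = l (f b) - l (f a) - l (fderiv ℝ f a (b - a)) := by
      conv_lhs => rw [hy]
      simp [map_sub]
    rw [this]; simp only [ContinuousLinearMap.comp_apply] at *; linarith
  have h5 : l y = ‖y‖ * ‖y‖ := real_inner_self_eq_norm_mul_norm y
  -- Dividing by `‖y‖` requires it to be positive; if it vanishes, the claim is only that `c` is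
  -- nonnegative.
  rcases (norm_nonneg y).eq_or_lt with h0 | h0
  · rw [← h0]
    have := (norm_nonneg _).trans (hc a ha); linarith
  · rw [h5] at h4
    refine le_of_mul_le_mul_left ?_ h0
    linarith

/-! ### Consequences of the Hessian bounds -/

section Hessian

variable {m : ℕ} {U C : Set (Vec m)} {f : Vec m → Vec m} {η q : Vec m → ℝ} {cf cl cu : ℝ}

/-- The upper bounds are maxima of operator norms over the compact set `C`. The lower bound is the
minimum of the Hessian form over `C` times the unit sphere, extended to all vectors by homogeneity.
-/
lemma exists_hessianBounds (hU : IsOpen U) (hC : IsCompact C) (hCU : C ⊆ U)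
    (hpair : IsEntropyPair U f η q)
    (hpos : ∀ v ∈ C, ∀ w, w ≠ 0 → 0 < fderiv ℝ (fderiv ℝ η) v w w) :
    ∃ cf cl cu : ℝ, HessianBounds C f η cf cl cu := by
  have hη := (hpair.entropy_contDiffOn.continuousOn_fderiv_fderiv hU).mono hCU
  have hf := (hpair.flux_contDiffOn.continuousOn_fderiv_fderiv hU).mono hCU
  have hηn : ContinuousOn (fun v => ‖fderiv ℝ (fderiv ℝ η) v‖) C :=
    ContinuousOn.norm (E := Vec m →L[ℝ] Vec m →L[ℝ] ℝ) hη
  obtain ⟨M, hM⟩ := hC.bddAbove_image hηn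
  obtain ⟨N, hN⟩ := hC.bddAbove_image (continuous_norm.comp_continuousOn hf)
  have hS : IsCompact (C ×ˢ Metric.sphere (0 : Vec m) 1) := hC.prod (isCompact_sphere _ _)
  have hcont : ContinuousOn (fun p : Vec m × Vec m => fderiv ℝ (fderiv ℝ η) p.1 p.2 p.2)
      (C ×ˢ Metric.sphere (0 : Vec m) 1) := by
    have : ContinuousOn (fun p : Vec m × Vec m => fderiv ℝ (fderiv ℝ η) p.1)
      (C ×ˢ Metric.sphere (0 : Vec m) 1) := hη.comp continuousOn_fst fun p hp => hp.1
    exact (this.clm_apply continuousOn_snd).clm_apply continuousOn_snd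
  obtain ⟨c, hc0, hc⟩ : ∃ c > 0, ∀ p ∈ C ×ˢ Metric.sphere (0 : Vec m) 1,
      c ≤ fderiv ℝ (fderiv ℝ η) p.1 p.2 p.2 := by
    -- The product is empty if `C` is empty or `m = 0`; then any positive constant serves.
    rcases (C ×ˢ Metric.sphere (0 : Vec m) 1).eq_empty_or_nonempty with h | h
    · exact ⟨1, one_pos, by simp [h]⟩
    · obtain ⟨p, hp, hmin⟩ := hS.exists_isMinOn h hcont
      refine ⟨_, hpos p.1 hp.1 p.2 ?_, fun z hz => hmin hz⟩
      rintro h0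
      have := hp.2
      simp [h0] at this
  -- The maxima enforce `0 ≤ cf` and `cl ≤ cu`, which could fail for the raw suprema when `C` is
  -- empty or `m = 0`.
  refine ⟨max N 0, c, max M c, le_max_right _ _, hc0, le_max_right _ _, fun v hv w => ?_,
    fun v hv w => ?_, fun v hv w => ?_⟩
  · have h1 : ‖fderiv ℝ (fderiv ℝ f) v‖ ≤ N := hN (mem_image_of_mem _ hv)
    refine ((fderiv ℝ (fderiv ℝ f) v).le_opNorm₂ w w).trans ?_
    rw [mul_assoc, ← sq]
    gcongr
    exact h1.trans (le_max_left _ _)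
  · rcases eq_or_ne w 0 with rfl | hw
    · simp
    · refine le_trans ?_ (le_abs_self _)
      have h1 := hc (v, ‖w‖⁻¹ • w) ⟨hv, by simp [norm_smul, hw]⟩
      simp only [map_smul, smul_apply, smul_eq_mul] at h1
      have h2 : 0 < ‖w‖ := norm_pos_iff.2 hw
      have h3 : ‖w‖ ^ 2 * (‖w‖⁻¹ * (‖w‖⁻¹ * fderiv ℝ (fderiv ℝ η) v w w)) =
        fderiv ℝ (fderiv ℝ η) v w w := by field_simp
      rw [← h3, mul_comm]
      gcongr
  · have h1 : ‖fderiv ℝ (fderiv ℝ η) v‖ ≤ M := hM (mem_image_of_mem _ hv)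
    rw [← Real.norm_eq_abs]
    refine ((fderiv ℝ (fderiv ℝ η) v).le_opNorm₂ w w).trans ?_
    rw [mul_assoc, ← sq]
    gcongr
    exact h1.trans (le_max_left _ _)

lemma entropyHessian_symm (hU : IsOpen U) {h : Vec m → ℝ} (hh : ContDiffOn ℝ 2 h U) {v : Vec m}
    (hv : v ∈ U) (a b : Vec m) : fderiv ℝ (fderiv ℝ h) v a b = fderiv ℝ (fderiv ℝ h) v b a :=
  ((hh.contDiffAt (hU.mem_nhds hv)).isSymmSndFDerivAt (by simp)).eq a b

/-- Differentiating `Dq = Dη Df` gives `D²q(a,b) = D²η(a, Df b) + Dη(D²f(a,b))`. The left side and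
the last term are symmetric in `a` and `b`, so the middle term is symmetric too. -/
lemma IsEntropyPair.hessian_flux_symm (hU : IsOpen U) (hpair : IsEntropyPair U f η q) {v : Vec m}
    (hv : v ∈ U) (a b : Vec m) :
    fderiv ℝ (fderiv ℝ η) v (fderiv ℝ f v a) b = fderiv ℝ (fderiv ℝ η) v a (fderiv ℝ f v b) := by
  have hη := hpair.entropy_contDiffOn
  have hf := hpair.flux_contDiffOn
  have hkey : ∀ a b, fderiv ℝ (fderiv ℝ q) v a b = fderiv ℝ (fderiv ℝ η) v a (fderiv ℝ f v b) +
      fderiv ℝ η v (fderiv ℝ (fderiv ℝ f) v a b) := fun a b => by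
    have heq : fderiv ℝ q =ᶠ[𝓝 v] fun u => (fderiv ℝ η u).comp (fderiv ℝ f u) := by
      filter_upwards [hU.mem_nhds hv] with z hz using hpair.compatible z hz
    rw [heq.fderiv_eq, ((hη.hasFDerivAt_fderiv_of_mem hU hv).clm_comp
      (hf.hasFDerivAt_fderiv_of_mem hU hv)).fderiv]
    simp [add_comm]
  have h1 := hkey a b
  have h2 := hkey b a
  have h3 := entropyHessian_symm hU hpair.entropyFlux_contDiffOn hv a b
  have h4 : fderiv ℝ (fderiv ℝ f) v a b = fderiv ℝ (fderiv ℝ f) v b a :=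
    ((hf.contDiffAt (hU.mem_nhds hv)).isSymmSndFDerivAt (by simp)).eq a b
  have h5 := entropyHessian_symm hU hη hv b (fderiv ℝ f v a)
  rw [h4] at h1
  linarith

/-- Cauchy–Schwarz for a positive form, with the sharp constant: on unit vectors, positivity at `a -
b` gives `2 B(a,b) ≤ B(a,a) + B(b,b) ≤ 2c`. Homogeneity and the replacement of `a` by `-a` do the
rest. -/
lemma abs_bilin_le {E : Type*} [NormedAddCommGroup E] [InnerProductSpace ℝ E]
    {B : E →L[ℝ] E →L[ℝ] ℝ} {c : ℝ} (hsymm : ∀ a b, B a b = B b a) (h0 : ∀ a, 0 ≤ B a a)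
    (hc : ∀ a, B a a ≤ c * ‖a‖ ^ 2) (a b : E) : |B a b| ≤ c * ‖a‖ * ‖b‖ := by
  have key : ∀ a b : E, ‖a‖ = 1 → ‖b‖ = 1 → B a b ≤ c := fun a b ha hb => by
    have h1 := hc (a + b)
    have h2 := h0 (a - b)
    have h3 := parallelogram_law_with_norm ℝ a b
    simp only [map_add, map_sub, add_apply, sub_apply]
      at h1 h2
    have h4 := hsymm a b
    have h5 := hc (a - b)
    have h6 := h0 (a + b)
    simp only [map_add, map_sub, add_apply, sub_apply]
      at h5 h6
    have h7 := hc a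
    have h8 := hc b
    rw [ha] at h7; rw [hb] at h8
    nlinarith [h0 a, h0 b]
  have key2 : ∀ a b : E, B a b ≤ c * ‖a‖ * ‖b‖ := fun a b => by
    rcases eq_or_ne a 0 with rfl | ha
    · simp
    rcases eq_or_ne b 0 with rfl | hb
    · simp
    have ha' : 0 < ‖a‖ := norm_pos_iff.2 ha
    have hb' : 0 < ‖b‖ := norm_pos_iff.2 hb
    have := key (‖a‖⁻¹ • a) (‖b‖⁻¹ • b) (by simp [norm_smul, ha]) (by simp [norm_smul, hb])
    simp only [map_smul, smul_apply, smul_eq_mul] at this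
    have h3 : B a b = ‖a‖ * ‖b‖ * (‖b‖⁻¹ * (‖a‖⁻¹ * B a b)) := by field_simp
    rw [h3]
    calc ‖a‖ * ‖b‖ * (‖b‖⁻¹ * (‖a‖⁻¹ * B a b)) ≤ ‖a‖ * ‖b‖ * c := by
          gcongr
      _ = _ := by ring
  refine abs_le.2 ⟨?_, key2 a b⟩
  have := key2 (-a) b
  simp only [map_neg, neg_apply, norm_neg] at this
  linarith

/-- The relative entropy `η(u|v)`. -/
noncomputable def relEntropy (η : Vec m → ℝ) (u v : Vec m) : ℝ :=
  η u - η v - fderiv ℝ η v (u - v)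

lemma HessianBounds.hessian_nonneg_le (hb : HessianBounds C f η cf cl cu)
    (hpos : ∀ v ∈ C, ∀ w, w ≠ 0 → 0 < fderiv ℝ (fderiv ℝ η) v w w) {v : Vec m} (hv : v ∈ C)
    (w : Vec m) : cl * ‖w‖ ^ 2 ≤ fderiv ℝ (fderiv ℝ η) v w w ∧
      fderiv ℝ (fderiv ℝ η) v w w ≤ cu * ‖w‖ ^ 2 := by
  have h0 : 0 ≤ fderiv ℝ (fderiv ℝ η) v w w := by
    rcases eq_or_ne w 0 with rfl | hw
    · simp
    · exact (hpos v hv w hw).le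
  have h1 := hb.le_entropy v hv w
  have h2 := hb.entropy_le v hv w
  rw [abs_of_nonneg h0] at h1 h2
  exact ⟨h1, h2⟩

lemma HessianBounds.le_relEntropy (hU : IsOpen U) (hC : Convex ℝ C) (hCU : C ⊆ U)
    (hpair : IsEntropyPair U f η q) (hb : HessianBounds C f η cf cl cu)
    (hpos : ∀ v ∈ C, ∀ w, w ≠ 0 → 0 < fderiv ℝ (fderiv ℝ η) v w w)
    {u v : Vec m} (hu : u ∈ C) (hv : v ∈ C) : cl / 2 * ‖u - v‖ ^ 2 ≤ relEntropy η u v := by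
  have := hC.taylor_lower hU hCU hpair.entropy_contDiffOn hv hu (c := cl * ‖u - v‖ ^ 2)
    (fun p hp => (hb.hessian_nonneg_le hpos hp _).1)
  rw [relEntropy]; linarith

lemma HessianBounds.relEntropy_le (hU : IsOpen U) (hC : Convex ℝ C) (hCU : C ⊆ U)
    (hpair : IsEntropyPair U f η q) (hb : HessianBounds C f η cf cl cu)
    (hpos : ∀ v ∈ C, ∀ w, w ≠ 0 → 0 < fderiv ℝ (fderiv ℝ η) v w w)
    {u v : Vec m} (hu : u ∈ C) (hv : v ∈ C) : relEntropy η u v ≤ cu / 2 * ‖u - v‖ ^ 2 := by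
  have := hC.taylor_upper hU hCU hpair.entropy_contDiffOn hv hu (c := cu * ‖u - v‖ ^ 2)
    (fun p hp => (hb.hessian_nonneg_le hpos hp _).2)
  rw [relEntropy]; linarith

/-- The quadratic bound on the production of relative entropy: `a`, `b` play the roles of the time
and space derivatives of the comparison function at a point where its value is `v`. -/
lemma HessianBounds.abs_production_le (hU : IsOpen U) (hC : Convex ℝ C) (hCU : C ⊆ U)
    (hpair : IsEntropyPair U f η q) (hb : HessianBounds C f η cf cl cu)
    (hpos : ∀ v ∈ C, ∀ w, w ≠ 0 → 0 < fderiv ℝ (fderiv ℝ η) v w w)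
    {u v : Vec m} (hu : u ∈ C) (hv : v ∈ C) (a b : Vec m) :
    |fderiv ℝ (fderiv ℝ η) v a (u - v) + fderiv ℝ (fderiv ℝ η) v b (f u - f v)| ≤
      1 / 2 * ‖a + fderiv ℝ f v b‖ ^ 2 + 1 / 2 * (cu ^ 2 + cu * cf * ‖b‖) * ‖u - v‖ ^ 2 := by
  have hcu : 0 ≤ cu := hb.cl_pos.le.trans hb.cl_le_cu
  have hB := abs_bilin_le (B := fderiv ℝ (fderiv ℝ η) v) (c := cu)
    (entropyHessian_symm hU hpair.entropy_contDiffOn (hCU hv))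
    (fun w => (mul_nonneg hb.cl_pos.le (sq_nonneg _)).trans (hb.hessian_nonneg_le hpos hv w).1)
    (fun w => (hb.hessian_nonneg_le hpos hv w).2)
  have hf := hC.norm_taylor_le hU hCU hpair.flux_contDiffOn hv hu (c := cf * ‖u - v‖ ^ 2)
    (fun p hp => hb.flux_le p hp _)
  -- Add and subtract `Df(v)(u - v)` in the flux difference. By `IsEntropyPair.hessian_flux_symm`,
  -- `Df(v)` moves onto `b`, where it completes `a` to the residual `a + Df(v) b`.
  have hsplit : fderiv ℝ (fderiv ℝ η) v a (u - v) + fderiv ℝ (fderiv ℝ η) v b (f u - f v) =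
      fderiv ℝ (fderiv ℝ η) v (a + fderiv ℝ f v b) (u - v) +
      fderiv ℝ (fderiv ℝ η) v b (f u - f v - fderiv ℝ f v (u - v)) := by
    rw [map_add, add_apply, hpair.hessian_flux_symm hU (hCU hv), map_sub _ _
      (fderiv ℝ f v (u - v))]
    ring
  rw [hsplit]
  refine (abs_add_le _ _).trans ?_
  have h1 := hB (a + fderiv ℝ f v b) (u - v)
  have h2 := hB b (f u - f v - fderiv ℝ f v (u - v))
  have h3 : cu * ‖b‖ * ‖f u - f v - fderiv ℝ f v (u - v)‖ ≤
    cu * ‖b‖ * (cf * ‖u - v‖ ^ 2 / 2) := by gcongr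
  -- The residual term `cu ‖R‖ ‖u - v‖` is split by `2xy ≤ x² + y²`, which is the source of the
  -- summand `cu²` in the growth rate.
  nlinarith [sq_nonneg (‖a + fderiv ℝ f v b‖ - cu * ‖u - v‖)]

end Hessian

/-! ### The first correlation marginal as a Young measure with values in `C` -/

instance isProbabilityMeasure_unitDomain :
    IsProbabilityMeasure ((volume : Measure ℝ).restrict unitDomain) :=
  ⟨by simp [unitDomain]⟩

lemma cube_one : cube 1 = MeasurableEquiv.funUnique (Fin 1) ℝ ⁻¹' unitDomain := by
  ext x
  simp only [cube, Set.mem_pi, mem_preimage, MeasurableEquiv.funUnique_apply]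
  exact ⟨fun h => h _ (mem_univ _), fun h i _ => by rwa [Subsingleton.elim i default]⟩

lemma measurePreserving_cube_one :
    MeasurePreserving (MeasurableEquiv.funUnique (Fin 1) ℝ) (volume.restrict (cube 1))
      (volume.restrict unitDomain) := by
  rw [cube_one]
  exact (volume_preserving_funUnique (Fin 1) ℝ).restrict_preimage measurableSet_Ioo

lemma setIntegral_cube_one {E : Type*} [NormedAddCommGroup E] [NormedSpace ℝ E]
    (g : (Fin 1 → ℝ) → E) : ∫ x in cube 1, g x = ∫ x in unitDomain, g fun _ => x := by
  rw [← measurePreserving_cube_one.integral_comp' (g := fun x => g fun _ => x)]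
  refine integral_congr_ae (Eventually.of_forall fun x => ?_)
  simp only [MeasurableEquiv.funUnique_apply]
  congr 1
  ext i; rw [Subsingleton.elim i default]

lemma ae_cube_one_iff {p : (Fin 1 → ℝ) → Prop} :
    (∀ᵐ x ∂(volume.restrict (cube 1)), p x) ↔
      ∀ᵐ x ∂((volume : Measure ℝ).restrict unitDomain), p fun _ => x := by
  have h := measurePreserving_cube_one.map_eq
  rw [← h, (MeasurableEquiv.funUnique (Fin 1) ℝ).measurableEmbedding.ae_map_iff]
  refine eventually_congr (Eventually.of_forall fun x => ?_)
  simp only [MeasurableEquiv.funUnique_apply]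
  have : (fun _ => x default) = x := by ext i; rw [Subsingleton.elim i default]
  rw [this]

lemma exists_zeroAtInfty_eval {m : ℕ} {h : Vec m → ℝ} (hc : Continuous h)
    (h0 : Tendsto h (cocompact (Vec m)) (𝓝 0)) :
    ∃ H : C₀(Fin 1 → Vec m, ℝ), ∀ ξ, H ξ = h (ξ 0) :=
  ⟨⟨⟨fun ξ => h (ξ 0), by fun_prop⟩,
    h0.comp (Homeomorph.funUnique (Fin 1) (Vec m)).isClosedEmbedding.tendsto_cocompact⟩,
    fun _ => rfl⟩

/-- A function which is continuous on `U` agrees on `C` with a compactly supported function. -/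
lemma exists_zeroAtInfty_eqOn {m : ℕ} {U C : Set (Vec m)} (hU : IsOpen U) (hC : IsCompact C)
    (hCU : C ⊆ U) {h : Vec m → ℝ} (hh : ContinuousOn h U) :
    ∃ H : C₀(Fin 1 → Vec m, ℝ), (∀ ξ, (∃ i, ξ i ∉ U) → H ξ = 0) ∧
      ∀ ξ, ξ 0 ∈ C → H ξ = h (ξ 0) := by
  -- A cutoff equal to `1` on `C` and supported in a compact `K ⊆ U` makes `χ h` continuous
  -- everywhere, whatever `h` is outside `U`.
  obtain ⟨K, hK, hCK, hKU⟩ := exists_compact_between hC hU hCU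
  obtain ⟨χ, h1, h0, hχ, -⟩ := exists_continuous_one_zero_of_isCompact hC
    isOpen_interior.isClosed_compl (disjoint_compl_right_iff_subset.2 hCK)
  have hsub : tsupport χ ⊆ K := closure_minimal (fun x hx => by
    by_contra hxK
    exact hx (h0 fun h => hxK (interior_subset h))) hK.isClosed
  have hcont : Continuous fun ξ => χ ξ * h ξ := by
    refine continuous_iff_continuousAt.2 fun x => ?_
    by_cases hx : x ∈ U
    · exact χ.continuous.continuousAt.mul (hh.continuousAt (hU.mem_nhds hx))
    · have : x ∈ (tsupport χ)ᶜ := fun h => hx (hKU (hsub h))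
      have h2 : (fun ξ => χ ξ * h ξ) =ᶠ[𝓝 x] fun _ => 0 := by
        filter_upwards [(isClosed_tsupport χ).isOpen_compl.mem_nhds this] with z hz
        rw [image_eq_zero_of_notMem_tsupport hz, zero_mul]
      exact continuousAt_const.congr h2.symm
  have hcs : HasCompactSupport fun ξ => χ ξ * h ξ := hχ.mul_right
  obtain ⟨H, hH⟩ := exists_zeroAtInfty_eval hcont hcs.is_zero_at_infty
  refine ⟨H, fun ξ ⟨i, hi⟩ => ?_, fun ξ hξ => ?_⟩
  · rw [Subsingleton.elim i 0] at hi
    rw [hH, h0 (fun h => hi (hKU (interior_subset h)))]; simp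
  · rw [hH, h1 hξ]; simp

/-- A nonnegative element of `C₀` which is positive exactly on `U \ C`. -/
lemma exists_zeroAtInfty_support_eq {m : ℕ} {U C : Set (Vec m)} (hU : IsOpen U)
    (hC : IsCompact C) :
    ∃ H : C₀(Fin 1 → Vec m, ℝ), (∀ ξ, 0 ≤ H ξ) ∧ ∀ ξ, H ξ ≠ 0 ↔ ξ 0 ∈ U \ C := by
  obtain ⟨g, hg, hgc, hg01⟩ := (hU.sdiff hC.isClosed).exists_contDiff_support_eq (n := 0)
  have hpos : ∀ ξ : Vec m, 0 < 1 + ‖ξ‖ := fun ξ => by positivity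
  -- `g` is bounded but need not decay when `U` is unbounded; the factor `(1 + ‖ξ‖)⁻¹` forces decay
  -- without changing the support.
  have h0 : Tendsto (fun ξ : Vec m => g ξ * (1 + ‖ξ‖)⁻¹) (cocompact (Vec m)) (𝓝 0) := by
    have h1 : Tendsto (fun ξ : Vec m => (1 + ‖ξ‖)⁻¹) (cocompact (Vec m)) (𝓝 0) :=
      (tendsto_atTop_add_const_left _ 1 (tendsto_norm_cocompact_atTop (E := Vec m))).inv_tendsto_atTop
    refine squeeze_zero (fun ξ => mul_nonneg (hg01 (mem_range_self ξ)).1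
      (inv_nonneg.2 (hpos ξ).le)) (fun ξ => ?_) h1
    exact mul_le_of_le_one_left (inv_nonneg.2 (hpos ξ).le) (hg01 (mem_range_self ξ)).2
  have hc : Continuous fun ξ : Vec m => g ξ * (1 + ‖ξ‖)⁻¹ :=
    hgc.continuous.mul ((by fun_prop : Continuous fun ξ : Vec m => 1 + ‖ξ‖).inv₀
      fun ξ => (hpos ξ).ne')
  obtain ⟨H, hH⟩ := exists_zeroAtInfty_eval hc h0
  refine ⟨H, fun ξ => ?_, fun ξ => ?_⟩
  · rw [hH]; exact mul_nonneg (hg01 (mem_range_self _)).1 (inv_nonneg.2 (hpos _).le)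
  · rw [hH, mul_ne_zero_iff, and_iff_left (inv_ne_zero (hpos _).ne'), ← hg, Function.mem_support]

lemma isCorrTest_smul {m : ℕ} {U : Set (Vec m)} {a : ℝ → ℝ}
    (ha : Integrable a (volume.restrict unitDomain)) {H : C₀(Fin 1 → Vec m, ℝ)}
    (hH : ∀ ξ, (∃ i, ξ i ∉ U) → H ξ = 0) : IsCorrTest U fun x : Fin 1 → ℝ => a (x 0) • H := by
  refine ⟨Integrable.smul_const ?_ H, fun x ξ hξ => by simp [hH ξ hξ]⟩
  have := (measurePreserving_cube_one.integrable_comp_emb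
    (MeasurableEquiv.funUnique (Fin 1) ℝ).measurableEmbedding (g := a)).2 ha
  exact this

/-- The linear map sending `a` to `∑ⱼ aⱼ Hⱼ`. -/
noncomputable def combZeroAtInfty {m : ℕ} (H : Fin m → C₀(Fin 1 → Vec m, ℝ)) :
    Vec m →L[ℝ] C₀(Fin 1 → Vec m, ℝ) :=
  ∑ j, (EuclideanSpace.proj j : Vec m →L[ℝ] ℝ).smulRight (H j)

lemma combZeroAtInfty_apply {m : ℕ} (H : Fin m → C₀(Fin 1 → Vec m, ℝ)) (a : Vec m)
    (ξ : Fin 1 → Vec m) : combZeroAtInfty H a ξ = ∑ j, a j * H j ξ := by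
  let e : C₀(Fin 1 → Vec m, ℝ) →+ ℝ := ⟨⟨fun H => H ξ, rfl⟩, fun _ _ => rfl⟩
  have : combZeroAtInfty H a = ∑ j, a j • H j := by
    simp [combZeroAtInfty]
  rw [this]
  change e _ = _
  rw [map_sum]
  rfl

lemma isCorrTest_combZeroAtInfty {m : ℕ} {U : Set (Vec m)} {a : ℝ → Vec m}
    (ha : Integrable a (volume.restrict unitDomain)) {H : Fin m → C₀(Fin 1 → Vec m, ℝ)}
    (hH : ∀ j ξ, (∃ i, ξ i ∉ U) → H j ξ = 0) :
    IsCorrTest U fun x : Fin 1 → ℝ => combZeroAtInfty H (a (x 0)) := by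
  refine ⟨(combZeroAtInfty H).integrable_comp ?_, fun x ξ hξ => ?_⟩
  · exact (measurePreserving_cube_one.integrable_comp_emb
      (MeasurableEquiv.funUnique (Fin 1) ℝ).measurableEmbedding (g := a)).2 ha
  · rw [combZeroAtInfty_apply]
    exact Finset.sum_eq_zero fun j _ => by rw [hH j ξ hξ, mul_zero]

/-- The first marginal of `ν` as a kernel on `ℝ × ℝ`. -/
noncomputable def firstMarginal {m : ℕ}
    (ν : (k : ℕ) → Kernel (ℝ × (Fin k → ℝ)) (Fin k → Vec m)) : Kernel (ℝ × ℝ) (Vec m) :=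
  ((ν 1).comap (fun p : ℝ × ℝ => (p.1, fun _ => p.2)) (by fun_prop)).map fun ξ => ξ 0

lemma firstMarginal_apply {m : ℕ} (ν : (k : ℕ) → Kernel (ℝ × (Fin k → ℝ)) (Fin k → Vec m))
    (p : ℝ × ℝ) : firstMarginal ν p =
      (ν 1 (p.1, fun _ => p.2)).map (MeasurableEquiv.funUnique (Fin 1) (Vec m)) := by
  rw [firstMarginal, Kernel.map_apply _ (by fun_prop), Kernel.comap_apply]
  rfl

/-- Pair with a nonnegative function that is positive exactly on `U \ C`. The pairing with `μ t`
vanishes because `μ t` lives on `C`-valued functions, so by duality the marginal does not charge `U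
\ C`. It does not charge the complement of `U` by definition of a Young measure. -/
lemma ae_firstMarginal_compl_eq_zero {m : ℕ} {U C : Set (Vec m)} {T : ℝ}
    {μ : ℝ → Measure (L2Fun m)} {ν : (k : ℕ) → Kernel (ℝ × (Fin k → ℝ)) (Fin k → Vec m)}
    (hU : IsOpen U) (hC : IsCompact C)
    (hval : ∀ t ∈ Ico 0 T, IsValuedIn C (μ t)) (hν : IsTimeCorrelationMeasure U T ν)
    (hdual : IsDualTo U T μ ν) :
    ∀ᵐ t ∂(volume.restrict (Ico 0 T)), ∀ᵐ x ∂((volume : Measure ℝ).restrict unitDomain),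
      firstMarginal ν (t, x) univ = 1 ∧ firstMarginal ν (t, x) Cᶜ = 0 := by
  obtain ⟨H, hH0, hH⟩ := exists_zeroAtInfty_support_eq hU hC
  have hHU : ∀ ξ, (∃ i, ξ i ∉ U) → H ξ = 0 := fun ξ ⟨i, hi⟩ => by
    rw [Subsingleton.elim i 0] at hi
    by_contra h
    exact hi ((hH ξ).1 h).1
  have htest := isCorrTest_smul (U := U) (integrable_const (1 : ℝ)) hHU
  filter_upwards [hdual 1 le_rfl _ htest, hν.slice, ae_restrict_mem measurableSet_Ico]
    with t ht hslice htmem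
  obtain ⟨hmk, hconc⟩ := hslice.young 1 le_rfl
  have hprob : ∀ x, IsProbabilityMeasure (ν 1 (t, x)) := fun x => hmk.isProbabilityMeasure x
  have hzero : corrPairing (μ t) (fun _ : Fin 1 → ℝ => (1 : ℝ) • H) = 0 := by
    rw [corrPairing]
    refine integral_eq_zero_of_ae ?_
    filter_upwards [hval t htmem] with u hu
    rw [setIntegral_cube_one]
    refine integral_eq_zero_of_ae ?_
    filter_upwards [hu] with x hx
    simp only [one_smul, Pi.zero_apply]
    by_contra h
    exact ((hH _).1 h).2 hx
  rw [hzero] at ht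
  simp only [one_smul] at ht
  have hmeas : StronglyMeasurable fun x => ∫ ξ, H ξ ∂(ν 1 (t, x)) := by
    have : StronglyMeasurable fun x => ∫ ξ, H ξ ∂(timeSlice ν t 1 x) :=
      H.continuous.stronglyMeasurable.integral_kernel
    exact this
  have hint : Integrable (fun x => ∫ ξ, H ξ ∂(ν 1 (t, x))) (volume.restrict (cube 1)) := by
    have hfin : IsFiniteMeasure ((volume : Measure (Fin 1 → ℝ)).restrict (cube 1)) :=
      ⟨by rw [← preimage_univ (f := MeasurableEquiv.funUnique (Fin 1) ℝ),
        measurePreserving_cube_one.measure_preimage_equiv]; simp⟩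
    refine Integrable.of_bound hmeas.aestronglyMeasurable ‖H‖ (Eventually.of_forall fun x => ?_)
    refine (norm_integral_le_of_norm_le_const (C := ‖H‖) (Eventually.of_forall fun ξ =>
      H.toBCF.norm_coe_le_norm ξ)).trans ?_
    simp
  rw [integral_eq_zero_iff_of_nonneg (fun x => integral_nonneg hH0) hint] at ht
  have h3 := ae_cube_one_iff.1 (ht.and hconc)
  filter_upwards [h3] with x ⟨hx1, hx2⟩
  rw [firstMarginal_apply]
  constructor
  · rw [MeasurableEquiv.map_apply]; simp
  · rw [MeasurableEquiv.map_apply]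
    have hHint : Integrable (fun ξ => H ξ) (ν 1 (t, fun _ => x)) :=
      Integrable.of_bound H.continuous.aestronglyMeasurable ‖H‖
        (Eventually.of_forall fun ξ => H.toBCF.norm_coe_le_norm ξ)
    have h4 := (integral_eq_zero_iff_of_nonneg hH0 hHint).1 hx1
    have h5 : ∀ᵐ ξ ∂(ν 1 (t, fun _ => x)), ¬ ∃ i, ξ i ∉ U := by
      rw [ae_iff]; simpa [timeSlice] using hx2
    change (ν 1 (t, fun _ => x)) _ = 0
    rw [← compl_compl (_ ⁻¹' Cᶜ), ← mem_ae_iff]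
    filter_upwards [h4, h5] with ξ hξ hξU
    push Not at hξU
    by_contra h
    refine (hH ξ).2 ⟨hξU 0, fun hC => h ?_⟩ hξ
    simpa using hC

/-- Restriction of a kernel to a nonempty closed set of values, modified on the set of points whose
measure is not a probability measure on `C`. -/
lemma Kernel.exists_restriction {α β : Type*} [MeasurableSpace α] [MeasurableSpace β]
    (κ : Kernel α β) {C : Set β} (hC : MeasurableSet C) (hne : C.Nonempty) :
    ∃ κ' : Kernel α C, IsMarkovKernel κ' ∧
      ∀ a, κ a univ = 1 → κ a Cᶜ = 0 → (κ' a).map Subtype.val = κ a := by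
  classical
  obtain ⟨c₀, hc₀⟩ := hne
  let S : Set α := {a | κ a univ = 1} ∩ {a | κ a Cᶜ = 0}
  have hS : MeasurableSet S :=
    (κ.measurable_coe MeasurableSet.univ (measurableSet_singleton _)).inter
      (κ.measurable_coe hC.compl (measurableSet_singleton _))
  -- The set of good points is measurable, so a fixed Dirac measure on `C` can be inserted at the
  -- bad points without losing measurability.
  let κ₁ : Kernel α β := Kernel.piecewise hS κ (Kernel.const α (Measure.dirac c₀))
  have hemb : MeasurableEmbedding (Subtype.val : C → β) := MeasurableEmbedding.subtype_coe hC
  refine ⟨κ₁.comapRight hemb, Kernel.IsMarkovKernel.comapRight _ _ fun a => ?_,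
    fun a ha1 ha0 => ?_⟩
  · rw [Subtype.range_coe, Kernel.piecewise_apply]
    split_ifs with h
    · rw [← h.1, ← measure_add_measure_compl hC, h.2, add_zero]
    · simp [hc₀]
  · rw [Kernel.comapRight_apply, hemb.map_comap, Subtype.range_coe, Kernel.piecewise_apply,
      if_pos ⟨ha1, ha0⟩]
    exact Measure.restrict_eq_self_of_ae_mem (by rw [← mem_ae_iff] at ha0; exact ha0)

lemma IsCompact.integrable_subtype {m : ℕ} {C : Set (Vec m)} (hC : IsCompact C)
    {E : Type*} [NormedAddCommGroup E]
    {h : Vec m → E} (hh : ContinuousOn h C) (ρ : Measure C) [IsFiniteMeasure ρ] :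
    Integrable (fun ξ : C => h ξ) ρ := by
  have : CompactSpace C := isCompact_iff_compactSpace.1 hC
  have hc : Continuous fun ξ : C => h ξ := continuousOn_iff_continuous_domRestrict.1 hh
  rw [← integrableOn_univ]
  exact hc.continuousOn.integrableOn_compact isCompact_univ

instance secondCountableTopology_l2Fun (m : ℕ) : SecondCountableTopology (L2Fun m) :=
  have : Fact ((2 : ℝ≥0∞) ≠ ∞) := ⟨by norm_num⟩
  inferInstance

lemma l2Fun_norm_le {m : ℕ} {u : L2Fun m} {M : ℝ} (hM : 0 ≤ M)
    (h : ∀ᵐ x ∂((volume : Measure ℝ).restrict unitDomain), ‖u x‖ ≤ M) : ‖u‖ ≤ M := by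
  refine (Lp.norm_le_of_ae_bound hM h).trans (le_of_eq ?_)
  simp [measureUnivNNReal]

lemma IsValuedIn.integrable_id {m : ℕ} {C : Set (Vec m)} (hC : IsCompact C)
    {μ : Measure (L2Fun m)} [IsFiniteMeasure μ] (h : IsValuedIn C μ) :
    Integrable (fun u : L2Fun m => u) μ := by
  obtain ⟨M, hM⟩ := hC.isBounded.exists_norm_le
  refine Integrable.of_bound (C := max M 0) ?_ ?_
  · exact aestronglyMeasurable_id
  · filter_upwards [h] with u hu
    exact l2Fun_norm_le (le_max_right _ _) (hu.mono fun x hx => (hM _ hx).trans (le_max_left _ _))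

/-- The barycenter `∫ ξ dκ`. -/
noncomputable def barycenter {m : ℕ} {C : Set (Vec m)} (κ : Kernel (ℝ × ℝ) C) (p : ℝ × ℝ) :
    Vec m := ∫ ξ : C, (ξ : Vec m) ∂κ p

/-- `κ` is the Young measure of `μ`: it satisfies the first marginal equation and is dual to `μ`
for the test functions that are needed below. -/
structure IsYoungMeasureOf {m : ℕ} (U C : Set (Vec m)) (f : Vec m → Vec m) (T : ℝ)
    (μbar : Measure (L2Fun m)) (μ : ℝ → Measure (L2Fun m)) (κ : Kernel (ℝ × ℝ) C) : Prop where
  markov : IsMarkovKernel κ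
  dual : ∀ h : Vec m → ℝ, ContinuousOn h U → ∀ᵐ t ∂(volume.restrict (Ioo 0 T)),
    ∫ u, (∫ x in unitDomain, h (u x)) ∂(μ t) = ∫ x in unitDomain, ∫ ξ : C, h ξ ∂κ (t, x)
  dual_inner : ∀ᵐ t ∂(volume.restrict (Ioo 0 T)), ∀ a : L2Fun m,
    ∫ u, inner ℝ u a ∂(μ t) = ∫ x in unitDomain, inner ℝ (barycenter κ (t, x)) (a x)
  equation : ∀ (j : Fin m) (φ : ℝ × ℝ → ℝ), ContDiff ℝ ((⊤ : ℕ∞) : WithTop ℕ∞) φ →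
    (∀ t x, φ (t, x + 1) = φ (t, x)) → (∃ T' < T, ∀ t, T' ≤ t → ∀ x, φ (t, x) = 0) →
    (∫ t in Ioo 0 T, ∫ x in unitDomain,
      (deriv (fun τ => φ (τ, x)) t * (∫ ξ : C, (ξ : Vec m) j ∂κ (t, x)) +
        deriv (fun y => φ (t, y)) x * ∫ ξ : C, f ξ j ∂κ (t, x))) +
    ∫ u, (∫ x in unitDomain, u x j * φ (0, x)) ∂μbar = 0

lemma memLp_barycenter {m : ℕ} {C : Set (Vec m)} (hC : IsCompact C) (κ : Kernel (ℝ × ℝ) C)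
    [IsMarkovKernel κ] (t : ℝ) (p : ℝ≥0∞) :
    MemLp (fun x => barycenter κ (t, x)) p (volume.restrict unitDomain) := by
  obtain ⟨M, hM⟩ := hC.isBounded.exists_norm_le
  have h1 : StronglyMeasurable (barycenter κ) :=
    (measurable_subtype_coe.stronglyMeasurable).integral_kernel
  refine MemLp.of_bound (h1.comp_measurable measurable_prodMk_left).aestronglyMeasurable M
    (Eventually.of_forall fun x => ?_)
  refine (norm_integral_le_of_norm_le_const (C := M)
    (Eventually.of_forall fun ξ => hM _ ξ.2)).trans ?_
  simp

/-- Duality is given only for tests vanishing outside `U` and at infinity. Since everything lives on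
the compact set `C`, any function continuous on `U` may be replaced by such a test with the same
values on `C`; the coordinate functions give the barycenter. -/
lemma IsCStatSol.exists_youngMeasure {m : ℕ} {U C : Set (Vec m)} {f : Vec m → Vec m} {T : ℝ}
    {μbar : Measure (L2Fun m)} {μ : ℝ → Measure (L2Fun m)} (hU : IsOpen U) (hC : IsCompact C)
    (hCU : C ⊆ U) (hne : C.Nonempty) (h : IsCStatSol U C f T μbar μ) :
    ∃ κ : Kernel (ℝ × ℝ) C, IsYoungMeasureOf U C f T μbar μ κ := by
  obtain ⟨ν, hν, hdual, heq⟩ := h.evolution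
  obtain ⟨κ, hκm, hκ⟩ := Kernel.exists_restriction (firstMarginal ν) hC.measurableSet hne
  have hemb : MeasurableEmbedding (Subtype.val : C → Vec m) :=
    MeasurableEmbedding.subtype_coe hC.measurableSet
  have hkey : ∀ᵐ t ∂(volume.restrict (Ico 0 T)),
      ∀ᵐ x ∂((volume : Measure ℝ).restrict unitDomain), ∀ g : Vec m → ℝ,
        ∫ ξ, g (ξ 0) ∂(ν 1 (t, fun _ => x)) = ∫ ξ : C, g ξ ∂κ (t, x) := by
    filter_upwards [ae_firstMarginal_compl_eq_zero hU hC h.valued hν hdual] with t ht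
    filter_upwards [ht] with x hx g
    have h1 := hκ (t, x) hx.1 hx.2
    rw [← hemb.integral_map, h1, firstMarginal_apply, integral_map_equiv]
    rfl
  have hsub : volume.restrict (Ioo 0 T) ≤ volume.restrict (Ico 0 T) :=
    Measure.restrict_mono Ioo_subset_Ico_self le_rfl
  refine ⟨κ, hκm, fun g hg => ?_, ?_, fun j φ hφ hper hsupp => ?_⟩
  · obtain ⟨H, hHU, hHC⟩ := exists_zeroAtInfty_eqOn hU hC hCU hg
    refine hsub.absolutelyContinuous.ae_le ?_
    filter_upwards [hdual 1 le_rfl _ (isCorrTest_smul (integrable_const (1 : ℝ)) hHU), hkey,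
      ae_restrict_mem measurableSet_Ico] with t ht hk htm
    have h1 : ∫ u, (∫ x in unitDomain, g (u x)) ∂(μ t) =
        corrPairing (μ t) fun _ : Fin 1 → ℝ => (1 : ℝ) • H := by
      refine integral_congr_ae ?_
      filter_upwards [h.valued t htm] with u hu
      rw [setIntegral_cube_one]
      refine integral_congr_ae ?_
      filter_upwards [hu] with x hx
      rw [one_smul, hHC _ hx]
    rw [h1, ← ht, setIntegral_cube_one]
    refine integral_congr_ae ?_
    filter_upwards [hk] with x hx
    have h2 := hx fun ξ => H fun _ => ξ
    simp only [one_smul]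
    have h3 : (fun ξ => H ξ) = fun ξ : Fin 1 → Vec m => H fun _ => ξ 0 := by
      ext ξ; congr 1; ext i : 1; rw [Subsingleton.elim i 0]
    rw [h3, h2]
    exact integral_congr_ae (Eventually.of_forall fun ξ => hHC _ ξ.2)
  · have hj : ∀ j : Fin m, ∃ H : C₀(Fin 1 → Vec m, ℝ), (∀ ξ, (∃ i, ξ i ∉ U) → H ξ = 0) ∧
        ∀ ξ, ξ 0 ∈ C → H ξ = ξ 0 j := fun j =>
      exists_zeroAtInfty_eqOn hU hC hCU (h := fun ξ => ξ j) (by fun_prop)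
    choose H hHU hHC using hj
    -- The null set of times must not depend on `a`, because `a` will later be the reconstruction at
    -- time `t` itself. Duality is therefore taken on a countable dense sequence; both sides are
    -- continuous in `a`.
    have hdense : ∀ᵐ t ∂(volume.restrict (Ico 0 T)), ∀ n : ℕ,
        ∫ u, inner ℝ u (TopologicalSpace.denseSeq (L2Fun m) n) ∂(μ t) = ∫ x in unitDomain,
          inner ℝ (barycenter κ (t, x)) (TopologicalSpace.denseSeq (L2Fun m) n x) := by
      rw [ae_all_iff]
      intro n
      set a := TopologicalSpace.denseSeq (L2Fun m) n
      have ha : Integrable (fun x => a x) (volume.restrict unitDomain) :=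
        (Lp.memLp a).integrable (by norm_num)
      filter_upwards [hdual 1 le_rfl _ (isCorrTest_combZeroAtInfty ha hHU), hkey,
        ae_restrict_mem measurableSet_Ico] with t ht hk htm
      have h1 : ∫ u, inner ℝ u a ∂(μ t) =
          corrPairing (μ t) fun x : Fin 1 → ℝ => combZeroAtInfty H (a (x 0)) := by
        refine integral_congr_ae ?_
        filter_upwards [h.valued t htm] with u hu
        rw [setIntegral_cube_one, L2.inner_def]
        refine integral_congr_ae ?_
        filter_upwards [hu] with x hx
        rw [combZeroAtInfty_apply, PiLp.inner_apply]
        refine Finset.sum_congr rfl fun j _ => ?_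
        rw [hHC _ _ hx]
        simp
      rw [h1, ← ht, setIntegral_cube_one]
      refine integral_congr_ae ?_
      filter_upwards [hk] with x hx
      have h3 : (fun ξ => combZeroAtInfty H (a x) ξ) =
          fun ξ : Fin 1 → Vec m => combZeroAtInfty H (a x) fun _ => ξ 0 := by
        ext ξ; congr 1; ext i : 1; rw [Subsingleton.elim i 0]
      rw [h3, hx fun ξ => combZeroAtInfty H (a x) fun _ => ξ, barycenter, real_inner_comm,
        ← integral_inner (hC.integrable_subtype (h := fun ξ => ξ) continuousOn_id _)]
      refine integral_congr_ae (Eventually.of_forall fun ξ => ?_)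
      simp only
      rw [combZeroAtInfty_apply, PiLp.inner_apply]
      refine Finset.sum_congr rfl fun j _ => ?_
      rw [hHC _ _ ξ.2]
      simp [mul_comm]
    refine hsub.absolutelyContinuous.ae_le ?_
    filter_upwards [hdense, ae_restrict_mem measurableSet_Ico] with t ht htm a
    have := h.prob t htm
    have hint : Integrable (fun u : L2Fun m => u) (μ t) := (h.valued t htm).integrable_id hC
    have h1 : ∀ a : L2Fun m, ∫ u, inner ℝ u a ∂(μ t) = inner ℝ (∫ u, u ∂(μ t)) a := fun a => by
      rw [real_inner_comm, ← integral_inner hint]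
      exact integral_congr_ae (Eventually.of_forall fun u => real_inner_comm _ _)
    have h2 : ∀ a : L2Fun m, ∫ x in unitDomain, inner ℝ (barycenter κ (t, x)) (a x) =
        inner ℝ (memLp_barycenter hC κ t 2).toLp a := fun a => by
      rw [L2.inner_def]
      refine integral_congr_ae ?_
      filter_upwards [(memLp_barycenter hC κ t 2).coeFn_toLp] with x hx
      rw [hx]
    simp_rw [h1, h2] at ht ⊢
    have : (fun a : L2Fun m => inner ℝ (∫ u, u ∂(μ t)) a) =
        fun a => inner ℝ (memLp_barycenter hC κ t 2).toLp a :=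
      (TopologicalSpace.denseRange_denseSeq (L2Fun m)).equalizer (by fun_prop) (by fun_prop)
        (funext ht)
    exact congrFun this a
  · have htest : IsTestFunction T fun p : ℝ × (Fin 1 → ℝ) => φ (p.1, p.2 0) := by
      refine ⟨by fun_prop, fun t x i => ?_, ?_⟩
      · rw [Subsingleton.elim i 0]; simp [hper]
      · obtain ⟨T', hT', h0⟩ := hsupp
        exact ⟨T', hT', fun t ht x => h0 t ht _⟩
    refine Eq.trans (congrArg₂ (· + ·) ?_ ?_) (heq 1 le_rfl (fun _ => j) _ htest)
    · refine integral_congr_ae (hsub.absolutelyContinuous.ae_le ?_)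
      filter_upwards [hkey] with t hk
      rw [setIntegral_cube_one]
      refine integral_congr_ae ?_
      filter_upwards [hk] with x hx
      simp only [Finset.univ_unique, Fin.default_eq_zero, Finset.prod_singleton,
        Finset.sum_singleton, if_true, Function.update_self]
      rw [hx fun ξ => ξ j, hx fun ξ => f ξ j]
    · refine integral_congr_ae (Eventually.of_forall fun u => ?_)
      simp only
      rw [setIntegral_cube_one]
      simp

/-! ### Mollification of Lipschitz functions -/

section Mollify

variable {G : Type*} [NormedAddCommGroup G] [NormedSpace ℝ G] [FiniteDimensional ℝ G]
  [MeasurableSpace G] [BorelSpace G] {μ : Measure G} [μ.IsAddHaarMeasure]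

open scoped Convolution in
/-- The mollification of `g` by a smooth bump. -/
noncomputable def mollify (μ : Measure G) (ρ : ContDiffBump (0 : G)) (g : G → ℝ) : G → ℝ :=
  ρ.normed μ ⋆[ContinuousLinearMap.lsmul ℝ ℝ, μ] g

omit [BorelSpace G] [μ.IsAddHaarMeasure] in
lemma mollify_apply (ρ : ContDiffBump (0 : G)) (g : G → ℝ) (x : G) :
    mollify μ ρ g x = ∫ q, ρ.normed μ q * g (x - q) ∂μ := rfl

lemma contDiff_mollify (ρ : ContDiffBump (0 : G)) {g : G → ℝ} (hg : Continuous g) :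
    ContDiff ℝ ((⊤ : ℕ∞) : WithTop ℕ∞) (mollify μ ρ g) :=
  ρ.hasCompactSupport_normed.contDiff_convolution_left _ ρ.contDiff_normed hg.locallyIntegrable

lemma abs_mollify_le (ρ : ContDiffBump (0 : G)) {g : G → ℝ} {M : ℝ} (hg : ∀ x, |g x| ≤ M) (x : G) :
    |mollify μ ρ g x| ≤ M := by
  rw [mollify_apply, ← Real.norm_eq_abs]
  refine (norm_integral_le_of_norm_le (ρ.integrable_normed.mul_const M)
    (Eventually.of_forall fun q => ?_)).trans (le_of_eq ?_)
  · rw [norm_mul, Real.norm_of_nonneg (ρ.nonneg_normed q)]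
    exact mul_le_mul_of_nonneg_left (hg _) (ρ.nonneg_normed q)
  · rw [integral_mul_const, ρ.integral_normed, one_mul]

lemma abs_mollify_sub_le (ρ : ContDiffBump (0 : G)) {g : G → ℝ} {K : ℝ≥0} (hg : LipschitzWith K g)
    (x : G) : |mollify μ ρ g x - g x| ≤ K * ρ.rOut := by
  rw [← Real.dist_eq]
  refine ContDiffBump.dist_normed_convolution_le hg.continuous.aestronglyMeasurable
    fun y hy => (hg.dist_le_mul y x).trans ?_
  exact mul_le_mul_of_nonneg_left (Metric.mem_ball.1 hy).le K.2

lemma mollify_eq_zero (ρ : ContDiffBump (0 : G)) {g : G → ℝ} {x : G}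
    (h : ∀ y, ‖y - x‖ < ρ.rOut → g y = 0) : mollify μ ρ g x = 0 := by
  rw [mollify_apply]
  refine integral_eq_zero_of_ae (Eventually.of_forall fun q => ?_)
  by_cases hq : q ∈ Metric.ball (0 : G) ρ.rOut
  · simp only [Pi.zero_apply]
    rw [h (x - q) (by simpa using hq), mul_zero]
  · rw [← ρ.support_normed_eq (μ := μ), Function.notMem_support] at hq
    simp [hq]

/-- The derivative is put on `g` by differentiation under the integral: `g` has a derivative along
`e` almost everywhere, and its Lipschitz constant dominates the difference quotients. Thus mollified
derivatives keep the Lipschitz bound uniformly and converge almost everywhere. -/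
lemma hasLineDerivAt_mollify (ρ : ContDiffBump (0 : G)) {g : G → ℝ} {K : ℝ≥0}
    (hg : LipschitzWith K g) (x e : G) :
    HasLineDerivAt ℝ (mollify μ ρ g) (mollify μ ρ (fun y => lineDeriv ℝ g y e) x) x e := by
  have hmeas : ∀ y, AEStronglyMeasurable (fun q => ρ.normed μ q * g (y - q)) μ := fun y => by
    have := hg.continuous
    have h2 := ρ.continuous_normed (μ := μ)
    exact (by fun_prop : Continuous fun q => ρ.normed μ q * g (y - q)).aestronglyMeasurable
  refine (hasDerivAt_integral_of_dominated_loc_of_lip (μ := μ) (s := univ)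
    (bound := fun q => ρ.normed μ q * (K * ‖e‖)) univ_mem (Eventually.of_forall fun τ => hmeas _)
    ?_ ?_ ?_ (ρ.integrable_normed.mul_const _) ?_).2
  · have h2 := ρ.continuous_normed (μ := μ)
    have := hg.continuous
    exact Continuous.integrable_of_hasCompactSupport (by fun_prop)
      ρ.hasCompactSupport_normed.mul_right
  · have h2 := ρ.continuous_normed (μ := μ)
    have h3 : Measurable fun y => lineDeriv ℝ g y e := measurable_lineDeriv hg.continuous
    exact (h2.measurable.mul (h3.comp (measurable_const.sub measurable_id))).aestronglyMeasurable
  · refine Eventually.of_forall fun q => LipschitzOnWith.of_dist_le_mul fun τ _ σ _ => ?_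
    rw [Real.dist_eq, ← mul_sub, abs_mul, abs_of_nonneg (ρ.nonneg_normed q), Real.coe_nnabs,
      abs_of_nonneg (mul_nonneg (ρ.nonneg_normed q) (by positivity)), mul_assoc]
    refine mul_le_mul_of_nonneg_left ?_ (ρ.nonneg_normed q)
    have := hg.dist_le_mul (x + τ • e - q) (x + σ • e - q)
    rw [Real.dist_eq] at this
    refine this.trans (le_of_eq ?_)
    rw [dist_sub_right, dist_add_left, dist_eq_norm, ← sub_smul, norm_smul, Real.dist_eq,
      Real.norm_eq_abs]
    ring
  · have h1 : ∀ᵐ y ∂μ, LineDifferentiableAt ℝ g y e := hg.ae_lineDifferentiableAt e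
    have h2 : ∀ᵐ q ∂μ, LineDifferentiableAt ℝ g (x - q) e :=
      (quasiMeasurePreserving_sub_left_of_right_invariant μ x).ae h1
    filter_upwards [h2] with q hq
    have := (hq.hasLineDerivAt : HasDerivAt (fun t : ℝ => g (x - q + t • e)) _ 0).const_mul
      (ρ.normed μ q)
    simp only [sub_add_eq_add_sub] at this
    exact this

lemma lineDeriv_mollify (ρ : ContDiffBump (0 : G)) {g : G → ℝ} {K : ℝ≥0}
    (hg : LipschitzWith K g) (x e : G) :
    lineDeriv ℝ (mollify μ ρ g) x e = mollify μ ρ (fun y => lineDeriv ℝ g y e) x :=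
  (hasLineDerivAt_mollify ρ hg x e).lineDeriv

/-- A sequence of bumps whose supports shrink to the origin. -/
noncomputable def shrinkingBump (δ : ℝ) (hδ : 0 < δ) (n : ℕ) : ContDiffBump (0 : G) where
  rIn := δ / (n + 1) / 2
  rOut := δ / (n + 1)
  rIn_pos := by positivity
  rIn_lt_rOut := half_lt_self (by positivity)

omit [NormedSpace ℝ G] [FiniteDimensional ℝ G] [MeasurableSpace G] [BorelSpace G] in
lemma tendsto_shrinkingBump_rOut (δ : ℝ) (hδ : 0 < δ) :
    Tendsto (fun n => (shrinkingBump (G := G) δ hδ n).rOut) atTop (𝓝 0) :=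
  tendsto_const_div_atTop_nhds_zero_nat δ |>.comp (tendsto_add_atTop_nat 1) |>.congr
    fun n => by simp [shrinkingBump]

omit [NormedSpace ℝ G] [FiniteDimensional ℝ G] [MeasurableSpace G] [BorelSpace G] in
lemma shrinkingBump_rOut_le (δ : ℝ) (hδ : 0 < δ) (n : ℕ) :
    (shrinkingBump (G := G) δ hδ n).rOut ≤ δ :=
  div_le_self hδ.le (by simp)

lemma ae_tendsto_mollify (δ : ℝ) (hδ : 0 < δ) {g : G → ℝ} (hg : LocallyIntegrable g μ) :
    ∀ᵐ x ∂μ, Tendsto (fun n => mollify μ (shrinkingBump δ hδ n) g x) atTop (𝓝 (g x)) :=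
  -- The constant `2` is the ratio of outer to inner radius; its boundedness lets Lebesgue
  -- differentiation apply.
  ContDiffBump.ae_convolution_tendsto_right_of_locallyIntegrable (K := 2)
    (tendsto_shrinkingBump_rOut δ hδ)
    (Eventually.of_forall fun n => by simp only [shrinkingBump]; linarith) hg

end Mollify

/-! ### The first marginal equation for Lipschitz test functions -/

/-- The measure on the space-time cylinder `(0,T) × D`. -/
noncomputable abbrev cylMeasure (T : ℝ) : Measure (ℝ × ℝ) :=
  ((volume : Measure ℝ).restrict (Ioo 0 T)).prod ((volume : Measure ℝ).restrict unitDomain)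

lemma cylMeasure_absolutelyContinuous (T : ℝ) : cylMeasure T ≪ (volume : Measure (ℝ × ℝ)) := by
  rw [cylMeasure, Measure.prod_restrict]
  exact Measure.restrict_le_self.absolutelyContinuous

lemma lineDeriv_time {E : Type*} [NormedAddCommGroup E] [NormedSpace ℝ E] (φ : ℝ × ℝ → E)
    (t x : ℝ) : lineDeriv ℝ φ (t, x) (1, 0) = deriv (fun τ => φ (τ, x)) t := by
  have := deriv_comp_const_add (fun τ => φ (τ, x)) t 0
  rw [add_zero] at this
  rw [← this, lineDeriv]
  simp

lemma lineDeriv_space {E : Type*} [NormedAddCommGroup E] [NormedSpace ℝ E] (φ : ℝ × ℝ → E)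
    (t x : ℝ) : lineDeriv ℝ φ (t, x) (0, 1) = deriv (fun y => φ (t, y)) x := by
  have := deriv_comp_const_add (fun y => φ (t, y)) x 0
  rw [add_zero] at this
  rw [← this, lineDeriv]
  simp

/-- The functional `u ↦ ∫ c(x) u(x) dx` is an inner product with a fixed element of `L²`, so it
commutes with the Bochner mean of `μ`. Initial terms linear in `u` thus depend only on that mean. -/
lemma IsValuedIn.integral_dual {m : ℕ} {C : Set (Vec m)} (hC : IsCompact C)
    {μ : Measure (L2Fun m)} [IsFiniteMeasure μ] (h : IsValuedIn C μ) {c : ℝ → (Vec m →L[ℝ] ℝ)}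
    (hc : MemLp c 2 (volume.restrict unitDomain)) :
    ∫ u, (∫ x in unitDomain, c x (u x)) ∂μ = ∫ x in unitDomain, c x ((∫ u, u ∂μ : L2Fun m) x) := by
  let a : ℝ → Vec m := fun x => (InnerProductSpace.toDual ℝ (Vec m)).symm (c x)
  have ha : MemLp a 2 (volume.restrict unitDomain) := by
    refine MemLp.of_le hc ?_ (Eventually.of_forall fun x => ?_)
    · exact (InnerProductSpace.toDual ℝ (Vec m)).symm.continuous.comp_aestronglyMeasurable hc.1
    · simp [a]
  have key : ∀ u : L2Fun m, ∫ x in unitDomain, c x (u x) = inner ℝ ha.toLp u := fun u => by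
    rw [L2.inner_def]
    refine integral_congr_ae ?_
    filter_upwards [ha.coeFn_toLp] with x hx
    rw [hx]
    simp [a]
  simp_rw [key]
  exact integral_inner (h.integrable_id hC) _

section LipschitzTest

variable {m : ℕ} {U C : Set (Vec m)} {f : Vec m → Vec m} {T : ℝ} {μbar : Measure (L2Fun m)}
  {μ : ℝ → Measure (L2Fun m)} {κ : Kernel (ℝ × ℝ) C}

lemma stronglyMeasurable_integral_kernel_subtype {E : Type*} [NormedAddCommGroup E]
    [NormedSpace ℝ E] (hC : IsCompact C) {h : Vec m → E} (hh : ContinuousOn h C) :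
    StronglyMeasurable fun p => ∫ ξ : C, h ξ ∂κ p := by
  have : CompactSpace C := isCompact_iff_compactSpace.1 hC
  have hc : Continuous fun ξ : C => h ξ := continuousOn_iff_continuous_domRestrict.1 hh
  exact (hc.stronglyMeasurable_of_hasCompactSupport
    (HasCompactSupport.of_compactSpace _)).integral_kernel

lemma exists_norm_integral_kernel_subtype_le {E : Type*} [NormedAddCommGroup E]
    [NormedSpace ℝ E] [IsMarkovKernel κ] (hC : IsCompact C) {h : Vec m → E}
    (hh : ContinuousOn h C) : ∃ M, 0 ≤ M ∧ ∀ p, ‖∫ ξ : C, h ξ ∂κ p‖ ≤ M := by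
  obtain ⟨M, hM⟩ := hC.bddAbove_image hh.norm
  refine ⟨max M 0, le_max_right _ _, fun p => ?_⟩
  refine (norm_integral_le_of_norm_le_const (C := max M 0) (Eventually.of_forall fun ξ =>
    (hM (mem_image_of_mem _ ξ.2)).trans (le_max_left _ _))).trans ?_
  simp

/-- Mollifications of `φ` are admissible smooth tests. Their line derivatives are bounded by the
Lipschitz bound of `φ` and converge almost everywhere, so the space-time integral passes to the
limit by dominated convergence; the initial term converges because the mollifications do so
uniformly. -/
lemma IsYoungMeasureOf.equation_lipschitz (hκ : IsYoungMeasureOf U C f T μbar μ κ)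
    (hC : IsCompact C) (hf : ContinuousOn f C) [IsFiniteMeasure μbar] (hμbar : IsValuedIn C μbar)
    (j : Fin m) {φ : ℝ × ℝ → ℝ} {K : ℝ≥0} (hφ : LipschitzWith K φ)
    (hper : ∀ t x, φ (t, x + 1) = φ (t, x)) {T' : ℝ} (hT' : T' < T)
    (hsupp : ∀ t, T' ≤ t → ∀ x, φ (t, x) = 0) :
    (∫ p, (lineDeriv ℝ φ p (1, 0) * (∫ ξ : C, (ξ : Vec m) j ∂κ p) +
      lineDeriv ℝ φ p (0, 1) * ∫ ξ : C, f ξ j ∂κ p) ∂cylMeasure T) +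
    ∫ x in unitDomain, φ (0, x) * (∫ u, u ∂μbar : L2Fun m) x j = 0 := by
  have := hκ.markov
  have hid : ContinuousOn (fun ξ : Vec m => ξ j) C := by fun_prop
  have hfj : ContinuousOn (fun ξ : Vec m => f ξ j) C :=
    (by fun_prop : Continuous fun ξ : Vec m => ξ j).comp_continuousOn hf
  obtain ⟨M, hM0, hM⟩ := exists_norm_integral_kernel_subtype_le (κ := κ) hC hid
  obtain ⟨N, hN0, hN⟩ := exists_norm_integral_kernel_subtype_le (κ := κ) hC hfj
  have hUm := stronglyMeasurable_integral_kernel_subtype (κ := κ) hC hid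
  have hFm := stronglyMeasurable_integral_kernel_subtype (κ := κ) hC hfj
  -- Mollifying at a width of at most half the remaining time keeps the tests zero from `(T + T') /
  -- 2 < T` on.
  have hδ : 0 < (T - T') / 2 := by linarith
  let ρ : ℕ → ContDiffBump (0 : ℝ × ℝ) := shrinkingBump ((T - T') / 2) hδ
  let φ' : ℕ → ℝ × ℝ → ℝ := fun n => mollify volume (ρ n) φ
  have hd : ∀ n p e, |lineDeriv ℝ (φ' n) p e| ≤ K * ‖e‖ := fun n p e => by
    rw [lineDeriv_mollify (ρ n) hφ]
    exact abs_mollify_le _ (fun y => norm_lineDeriv_le_of_lipschitz ℝ hφ) p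
  have hφ'c : ∀ n, Continuous (φ' n) := fun n => (contDiff_mollify (ρ n) hφ.continuous).continuous
  have hmeasI : ∀ ψ : ℝ × ℝ → ℝ, Continuous ψ → AEStronglyMeasurable (fun p =>
      lineDeriv ℝ ψ p (1, 0) * (∫ ξ : C, (ξ : Vec m) j ∂κ p) +
      lineDeriv ℝ ψ p (0, 1) * ∫ ξ : C, f ξ j ∂κ p) (cylMeasure T) := fun ψ hψ =>
    ((aestronglyMeasurable_lineDeriv hψ _).mul hUm.aestronglyMeasurable).add
      ((aestronglyMeasurable_lineDeriv hψ _).mul hFm.aestronglyMeasurable)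
  have hbd : ∀ n p, ‖lineDeriv ℝ (φ' n) p (1, 0) * (∫ ξ : C, (ξ : Vec m) j ∂κ p) +
      lineDeriv ℝ (φ' n) p (0, 1) * ∫ ξ : C, f ξ j ∂κ p‖ ≤ K * M + K * N := fun n p => by
    refine (norm_add_le _ _).trans ?_
    rw [norm_mul, norm_mul]
    have h1 := hd n p (1, 0)
    have h2 := hd n p (0, 1)
    simp only [Prod.norm_mk, norm_one, norm_zero] at h1 h2
    norm_num at h1 h2
    gcongr
    · exact h1
    · exact hM p
    · exact h2
    · exact hN p
  have heq : ∀ n, (∫ p, (lineDeriv ℝ (φ' n) p (1, 0) * (∫ ξ : C, (ξ : Vec m) j ∂κ p) +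
      lineDeriv ℝ (φ' n) p (0, 1) * ∫ ξ : C, f ξ j ∂κ p) ∂cylMeasure T) +
      ∫ x in unitDomain, φ' n (0, x) * (∫ u, u ∂μbar : L2Fun m) x j = 0 := fun n => by
    have h1 := hκ.equation j (φ' n) (contDiff_mollify (ρ n) hφ.continuous) (fun t x => ?_)
      ⟨(T + T') / 2, by linarith, fun t ht x => ?_⟩
    · refine Eq.trans (congrArg₂ (· + ·) ?_ ?_) h1
      · rw [integral_prod]
        · simp only [lineDeriv_time, lineDeriv_space]
        · exact Integrable.of_bound (hmeasI _ (hφ'c n)) _ (Eventually.of_forall (hbd n))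
      · let c : ℝ → (Vec m →L[ℝ] ℝ) := fun x => φ' n (0, x) • EuclideanSpace.proj j
        have hcc : Continuous c := by
          have := hφ'c n
          exact (by fun_prop : Continuous fun x => φ' n (0, x)).smul continuous_const
        have hc : MemLp c 2 (volume.restrict unitDomain) := by
          obtain ⟨B, hB⟩ := (isCompact_Icc (a := (0 : ℝ)) (b := 1)).bddAbove_image
            hcc.norm.continuousOn
          refine MemLp.of_bound hcc.aestronglyMeasurable B ?_
          filter_upwards [ae_restrict_mem measurableSet_Ioo] with x hx
          exact hB (mem_image_of_mem _ (Ioo_subset_Icc_self hx))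
        have h2 := hμbar.integral_dual hC hc
        simp only [c, smul_apply, PiLp.proj_apply, smul_eq_mul] at h2
        rw [← h2]
        simp only [mul_comm]
    · simp only [φ', mollify_apply]
      refine integral_congr_ae (Eventually.of_forall fun q => ?_)
      have : ((t, x + 1) - q : ℝ × ℝ) = (t - q.1, x - q.2 + 1) := by
        ext <;> simp; ring
      simp only
      rw [this, hper]
      rfl
    · refine mollify_eq_zero (ρ n) fun y hy => ?_
      have h2 : |y.1 - t| < (ρ n).rOut := (norm_fst_le (y - (t, x))).trans_lt hy
      have h3 : (ρ n).rOut ≤ (T - T') / 2 := shrinkingBump_rOut_le _ hδ n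
      have h4 := (abs_lt.1 h2).1
      exact hsupp y.1 (by linarith) y.2
  have hlim1 : Tendsto (fun n => ∫ p, (lineDeriv ℝ (φ' n) p (1, 0) *
      (∫ ξ : C, (ξ : Vec m) j ∂κ p) + lineDeriv ℝ (φ' n) p (0, 1) * ∫ ξ : C, f ξ j ∂κ p)
      ∂cylMeasure T) atTop (𝓝 (∫ p, (lineDeriv ℝ φ p (1, 0) * (∫ ξ : C, (ξ : Vec m) j ∂κ p) +
      lineDeriv ℝ φ p (0, 1) * ∫ ξ : C, f ξ j ∂κ p) ∂cylMeasure T)) := by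
    refine tendsto_integral_of_dominated_convergence (fun _ => K * M + K * N)
      (fun n => hmeasI _ (hφ'c n)) (integrable_const _)
      (fun n => Eventually.of_forall (hbd n)) ?_
    have hconv : ∀ e : ℝ × ℝ, ∀ᵐ p ∂cylMeasure T,
        Tendsto (fun n => lineDeriv ℝ (φ' n) p e) atTop (𝓝 (lineDeriv ℝ φ p e)) := fun e => by
      have h1 := ae_tendsto_mollify ((T - T') / 2) hδ
        (hφ.locallyIntegrable_lineDeriv (μ := (volume : Measure (ℝ × ℝ))) e)
      filter_upwards [(cylMeasure_absolutelyContinuous T).ae_le h1] with p hp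
      exact hp.congr fun n => (lineDeriv_mollify (ρ n) hφ p e).symm
    filter_upwards [hconv (1, 0), hconv (0, 1)] with p h1 h2
    exact (h1.mul_const _).add (h2.mul_const _)
  have hlim2 : Tendsto (fun n => ∫ x in unitDomain, φ' n (0, x) * (∫ u, u ∂μbar : L2Fun m) x j)
      atTop (𝓝 (∫ x in unitDomain, φ (0, x) * (∫ u, u ∂μbar : L2Fun m) x j)) := by
    have hUint : Integrable (fun x => (∫ u, u ∂μbar : L2Fun m) x)
        (volume.restrict unitDomain) := (Lp.memLp _).integrable (by norm_num)
    have hUj : Integrable (fun x => (∫ u, u ∂μbar : L2Fun m) x j) (volume.restrict unitDomain) :=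
      (EuclideanSpace.proj j : Vec m →L[ℝ] ℝ).integrable_comp hUint
    obtain ⟨B, hB⟩ := (isCompact_Icc (a := (0 : ℝ)) (b := 1)).bddAbove_image
      (f := fun x => |φ (0, x)|) (by have := hφ.continuous; fun_prop)
    refine tendsto_integral_of_dominated_convergence
      (fun x => (B + K * ((T - T') / 2)) * ‖(∫ u, u ∂μbar : L2Fun m) x j‖) (fun n => ?_)
      (hUj.norm.const_mul _) (fun n => ?_) (Eventually.of_forall fun x => ?_)
    · have := hφ'c n
      exact (by fun_prop : Continuous fun x => φ' n (0, x)).aestronglyMeasurable.mul hUj.1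
    · filter_upwards [ae_restrict_mem measurableSet_Ioo] with x hx
      rw [norm_mul]
      gcongr
      have h1 := abs_mollify_sub_le (μ := volume) (ρ n) hφ (0, x)
      have h2 : |φ (0, x)| ≤ B := hB (mem_image_of_mem _ (Ioo_subset_Icc_self hx))
      have h3 : K * (ρ n).rOut ≤ K * ((T - T') / 2) :=
        mul_le_mul_of_nonneg_left (shrinkingBump_rOut_le _ hδ n) K.2
      rw [Real.norm_eq_abs]
      calc |φ' n (0, x)| = |φ (0, x) + (φ' n (0, x) - φ (0, x))| := by ring_nf
        _ ≤ |φ (0, x)| + |φ' n (0, x) - φ (0, x)| := abs_add_le _ _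
        _ ≤ _ := by linarith
    · refine Tendsto.mul_const _ ?_
      rw [tendsto_iff_dist_tendsto_zero]
      refine squeeze_zero (fun n => dist_nonneg)
        (fun n => abs_mollify_sub_le (μ := volume) (ρ n) hφ (0, x)) ?_
      simpa using (tendsto_shrinkingBump_rOut (G := ℝ × ℝ) ((T - T') / 2) hδ).const_mul (K : ℝ)
  have := hlim1.add hlim2
  simp_rw [heq] at this
  exact (tendsto_nhds_unique this tendsto_const_nhds)

end LipschitzTest

/-! ### The first marginal equation tested with dual vector fields -/

lemma clm_eq_sum_basis {m : ℕ} (L : Vec m →L[ℝ] ℝ) (ξ : Vec m) :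
    L ξ = ∑ j, L (EuclideanSpace.basisFun (Fin m) ℝ j) * ξ j := by
  conv_lhs => rw [← (EuclideanSpace.basisFun (Fin m) ℝ).sum_repr ξ]
  rw [map_sum]
  refine Finset.sum_congr rfl fun j _ => ?_
  rw [map_smul, smul_eq_mul, EuclideanSpace.basisFun_repr, mul_comm]

/-- The mean flux `∫ f(ξ) dκ`. -/
noncomputable def fluxMean {m : ℕ} {C : Set (Vec m)} (f : Vec m → Vec m)
    (κ : Kernel (ℝ × ℝ) C) (p : ℝ × ℝ) : Vec m := ∫ ξ : C, f ξ ∂κ p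

lemma barycenter_eq_fluxMean {m : ℕ} {C : Set (Vec m)} (κ : Kernel (ℝ × ℝ) C) :
    barycenter κ = fluxMean (fun ξ => ξ) κ := rfl

section

variable {m : ℕ} {U C : Set (Vec m)} {f : Vec m → Vec m} {T : ℝ} {μbar : Measure (L2Fun m)}
  {μ : ℝ → Measure (L2Fun m)} {κ : Kernel (ℝ × ℝ) C}

lemma fluxMean_coord [IsFiniteKernel κ] (hC : IsCompact C) (hf : ContinuousOn f C) (p : ℝ × ℝ)
    (j : Fin m) : fluxMean f κ p j = ∫ ξ : C, f ξ j ∂κ p :=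
  ((EuclideanSpace.proj j : Vec m →L[ℝ] ℝ).integral_comp_comm
    (hC.integrable_subtype hf (κ p))).symm

/-- The test `θ Dη(v)` takes values in the dual space, so the scalar equations for its coordinates
are summed. -/
lemma IsYoungMeasureOf.equation_dual (hκ : IsYoungMeasureOf U C f T μbar μ κ)
    (hC : IsCompact C) (hf : ContinuousOn f C) [IsFiniteMeasure μbar] (hμbar : IsValuedIn C μbar)
    {φ : ℝ × ℝ → (Vec m →L[ℝ] ℝ)} {K : ℝ≥0} (hφ : LipschitzWith K φ)
    (hper : ∀ t x, φ (t, x + 1) = φ (t, x)) {T' : ℝ} (hT' : T' < T)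
    (hsupp : ∀ t, T' ≤ t → ∀ x, φ (t, x) = 0) :
    (∫ p, (lineDeriv ℝ φ p (1, 0) (barycenter κ p) +
      lineDeriv ℝ φ p (0, 1) (fluxMean f κ p)) ∂cylMeasure T) +
    ∫ x in unitDomain, φ (0, x) ((∫ u, u ∂μbar : L2Fun m) x) = 0 := by
  have := hκ.markov
  let e : Fin m → Vec m := fun j => EuclideanSpace.basisFun (Fin m) ℝ j
  let ev : Fin m → ((Vec m →L[ℝ] ℝ) →L[ℝ] ℝ) := fun j => ContinuousLinearMap.apply ℝ ℝ (e j)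
  have hφj : ∀ j, LipschitzWith (‖ev j‖₊ * K) fun p => φ p (e j) := fun j =>
    (ev j).lipschitz.comp hφ
  have heq := fun j => hκ.equation_lipschitz hC hf hμbar j (hφj j)
    (fun t x => by rw [hper]) hT' (fun t ht x => by rw [hsupp t ht x]; simp)
  have hid : ContinuousOn (fun ξ : Vec m => ξ) C := continuousOn_id
  have hint : ∀ j, Integrable (fun p => lineDeriv ℝ (fun p => φ p (e j)) p (1, 0) *
      (∫ ξ : C, (ξ : Vec m) j ∂κ p) + lineDeriv ℝ (fun p => φ p (e j)) p (0, 1) *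
      ∫ ξ : C, f ξ j ∂κ p) (cylMeasure T) := fun j => by
    have hidj : ContinuousOn (fun ξ : Vec m => ξ j) C := by fun_prop
    have hfj : ContinuousOn (fun ξ : Vec m => f ξ j) C :=
      (by fun_prop : Continuous fun ξ : Vec m => ξ j).comp_continuousOn hf
    obtain ⟨M, hM0, hM⟩ := exists_norm_integral_kernel_subtype_le (κ := κ) hC hidj
    obtain ⟨N, hN0, hN⟩ := exists_norm_integral_kernel_subtype_le (κ := κ) hC hfj
    have h1 : ∀ v, Integrable (fun p => lineDeriv ℝ (fun p => φ p (e j)) p v) (cylMeasure T) :=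
      fun v => Integrable.of_bound
        (aestronglyMeasurable_lineDeriv (hφj j).continuous _) _
        (Eventually.of_forall fun p => norm_lineDeriv_le_of_lipschitz ℝ (hφj j))
    exact ((h1 _).mul_bdd (c := M)
      (stronglyMeasurable_integral_kernel_subtype hC hidj).aestronglyMeasurable
      (Eventually.of_forall hM)).add ((h1 _).mul_bdd (c := N)
      (stronglyMeasurable_integral_kernel_subtype hC hfj).aestronglyMeasurable
      (Eventually.of_forall hN))
  have hint2 : ∀ j, Integrable (fun x => φ (0, x) (e j) * (∫ u, u ∂μbar : L2Fun m) x j)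
      (volume.restrict unitDomain) := fun j => by
    have hUint : Integrable (fun x => (∫ u, u ∂μbar : L2Fun m) x)
        (volume.restrict unitDomain) := (Lp.memLp _).integrable (by norm_num)
    have hUj : Integrable (fun x => (∫ u, u ∂μbar : L2Fun m) x j) (volume.restrict unitDomain) :=
      (EuclideanSpace.proj j : Vec m →L[ℝ] ℝ).integrable_comp hUint
    have hc : Continuous fun x => φ ((0 : ℝ), x) (e j) := by
      have := (hφj j).continuous
      exact this.comp (by fun_prop : Continuous fun x : ℝ => ((0 : ℝ), x))
    obtain ⟨B, hB⟩ := (isCompact_Icc (a := (0 : ℝ)) (b := 1)).exists_bound_of_continuousOn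
      hc.continuousOn
    refine hUj.bdd_mul (c := B) hc.aestronglyMeasurable ?_
    filter_upwards [ae_restrict_mem measurableSet_Ioo] with x hx
    exact hB x (Ioo_subset_Icc_self hx)
  have hsum := Finset.sum_eq_zero fun j (_ : j ∈ Finset.univ) => heq j
  rw [Finset.sum_add_distrib, ← integral_finsetSum _ fun j _ => hint j,
    ← integral_finsetSum _ fun j _ => hint2 j] at hsum
  refine Eq.trans (congrArg₂ (· + ·) ?_ ?_) hsum
  · refine integral_congr_ae ?_
    -- A line derivative commutes with evaluation on a basis vector only where it exists;
    -- Rademacher's theorem provides this almost everywhere.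
    filter_upwards [(cylMeasure_absolutelyContinuous T).ae_le
      (hφ.ae_differentiableAt (μ := volume))] with p hp
    have h1 : ∀ j v, lineDeriv ℝ (fun p => φ p (e j)) p v = lineDeriv ℝ φ p v (e j) :=
      fun j v => by
        have h2 := (hp.lineDifferentiableAt (v := v)).hasLineDerivAt
        exact HasLineDerivAt.lineDeriv (((ev j).hasFDerivAt.comp_hasDerivAt _ h2 :))
    rw [clm_eq_sum_basis (lineDeriv ℝ φ p (1, 0)), clm_eq_sum_basis (lineDeriv ℝ φ p (0, 1)),
      ← Finset.sum_add_distrib]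
    refine Finset.sum_congr rfl fun j _ => ?_
    rw [h1, h1, ← fluxMean_coord hC hf, barycenter_eq_fluxMean, fluxMean_coord hC hid]
  · refine integral_congr_ae (Eventually.of_forall fun x => ?_)
    exact clm_eq_sum_basis _ _

end

/-! ### Total derivatives of Lipschitz functions on the cylinder -/

lemma lipschitz_slice_fst {E : Type*} [PseudoEMetricSpace E] {φ : ℝ × ℝ → E} {K : ℝ≥0}
    (hφ : LipschitzWith K φ) (x : ℝ) : LipschitzWith K fun τ => φ (τ, x) := fun a b => by
  simpa [Prod.edist_eq] using hφ (a, x) (b, x)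

lemma lipschitz_slice_snd {E : Type*} [PseudoEMetricSpace E] {φ : ℝ × ℝ → E} {K : ℝ≥0}
    (hφ : LipschitzWith K φ) (t : ℝ) : LipschitzWith K fun y => φ (t, y) := fun a b => by
  simpa [Prod.edist_eq] using hφ (t, a) (t, b)

lemma LipschitzWith.integral_Ioo_deriv {g : ℝ → ℝ} {K : ℝ≥0} (hg : LipschitzWith K g) {a b : ℝ}
    (hab : a ≤ b) : ∫ x in Ioo a b, deriv g x = g b - g a := by
  rw [← integral_Ioc_eq_integral_Ioo, ← intervalIntegral.integral_of_le hab]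
  exact hg.lipschitzOnWith.absolutelyContinuousOnInterval.integral_deriv_eq_sub

lemma LipschitzWith.integrable_lineDeriv_cylMeasure {φ : ℝ × ℝ → ℝ} {K : ℝ≥0}
    (hφ : LipschitzWith K φ) (T : ℝ) (v : ℝ × ℝ) :
    Integrable (fun p => lineDeriv ℝ φ p v) (cylMeasure T) :=
  Integrable.of_bound (aestronglyMeasurable_lineDeriv hφ.continuous _) _
    (Eventually.of_forall fun _ => norm_lineDeriv_le_of_lipschitz ℝ hφ)

lemma integral_cylMeasure_timeDeriv {φ : ℝ × ℝ → ℝ} {K : ℝ≥0} (hφ : LipschitzWith K φ) {T : ℝ}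
    (hT : 0 ≤ T) (h0 : ∀ x, φ (T, x) = 0) :
    ∫ p, lineDeriv ℝ φ p (1, 0) ∂cylMeasure T + ∫ x in unitDomain, φ (0, x) = 0 := by
  rw [integral_prod_symm _ (hφ.integrable_lineDeriv_cylMeasure T _)]
  simp_rw [lineDeriv_time, (lipschitz_slice_fst hφ _).integral_Ioo_deriv hT, h0, zero_sub]
  rw [integral_neg, neg_add_cancel]

lemma integral_cylMeasure_spaceDeriv {φ : ℝ × ℝ → ℝ} {K : ℝ≥0} (hφ : LipschitzWith K φ) {T : ℝ}
    (hper : ∀ t x, φ (t, x + 1) = φ (t, x)) :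
    ∫ p, lineDeriv ℝ φ p (0, 1) ∂cylMeasure T = 0 := by
  rw [integral_prod _ (hφ.integrable_lineDeriv_cylMeasure T _)]
  refine integral_eq_zero_of_ae (Eventually.of_forall fun t => ?_)
  simp only [lineDeriv_space, Pi.zero_apply]
  rw [(lipschitz_slice_snd hφ t).integral_Ioo_deriv zero_le_one]
  have := hper t 0
  rw [zero_add] at this
  rw [this, sub_self]

/-- The product of bounded Lipschitz functions is Lipschitz. -/
lemma LipschitzWith.smul_of_bounded {X E : Type*} [PseudoMetricSpace X] [NormedAddCommGroup E]
    [NormedSpace ℝ E] {θ : X → ℝ} {a : X → E} {K L : ℝ≥0} {A B : ℝ} (hθ : LipschitzWith K θ)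
    (ha : LipschitzWith L a) (hA : ∀ x, |θ x| ≤ A) (hB : ∀ x, ‖a x‖ ≤ B) :
    LipschitzWith (A.toNNReal * L + K * B.toNNReal) fun x => θ x • a x := by
  refine LipschitzWith.of_dist_le_mul fun x y => ?_
  have h1 : θ x • a x - θ y • a y = θ x • (a x - a y) + (θ x - θ y) • a y := by
    rw [smul_sub, sub_smul]; abel
  rw [dist_eq_norm, h1]
  refine (norm_add_le _ _).trans ?_
  rw [norm_smul, norm_smul, ← dist_eq_norm, ← dist_eq_norm]
  have hA0 : 0 ≤ A := (abs_nonneg _).trans (hA x)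
  have hB0 : 0 ≤ B := (norm_nonneg _).trans (hB x)
  push_cast
  rw [Real.coe_toNNReal _ hA0, Real.coe_toNNReal _ hB0, add_mul, Real.norm_eq_abs]
  have h2 : |θ x| * dist (a x) (a y) ≤ A * (L * dist x y) :=
    mul_le_mul (hA x) (ha.dist_le_mul x y) dist_nonneg hA0
  have h3 : dist (θ x) (θ y) * ‖a y‖ ≤ K * dist x y * B :=
    mul_le_mul (hθ.dist_le_mul x y) (hB y) (norm_nonneg _) (by positivity)
  linarith

/-! ### The relative entropy balance -/

lemma integrable_clm_apply {α E F : Type*} [MeasurableSpace α] {ρ : Measure α}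
    [NormedAddCommGroup E] [NormedSpace ℝ E] [NormedAddCommGroup F] [NormedSpace ℝ F]
    {L : α → E →L[ℝ] F} {w : α → E} {M : ℝ} (hL : AEStronglyMeasurable L ρ)
    (hM : ∀ᵐ x ∂ρ, ‖L x‖ ≤ M) (hw : Integrable w ρ) : Integrable (fun x => L x (w x)) ρ := by
  refine Integrable.mono' (hw.norm.const_mul M)
    ((ContinuousLinearMap.id ℝ (E →L[ℝ] F)).aestronglyMeasurable_comp₂ hL hw.1) ?_
  filter_upwards [hM] with x hx
  exact (L x).le_of_opNorm_le hx _

lemma lineDeriv_smul_comp {E F : Type*} [NormedAddCommGroup E] [NormedSpace ℝ E]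
    [NormedAddCommGroup F] [NormedSpace ℝ F] {θ : ℝ → ℝ} {v : ℝ × ℝ → E} {G : E → F}
    {G' : E →L[ℝ] F} {p : ℝ × ℝ} (hθ : Differentiable ℝ θ) (hv : DifferentiableAt ℝ v p)
    (hG : HasFDerivAt G G' (v p)) (e : ℝ × ℝ) :
    lineDeriv ℝ (fun p => θ p.1 • G (v p)) p e =
      (e.1 * deriv θ p.1) • G (v p) + θ p.1 • G' (lineDeriv ℝ v p e) := by
  have h1 : HasDerivAt (fun t : ℝ => v (p + t • e)) (lineDeriv ℝ v p e) 0 :=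
    (hv.lineDifferentiableAt (v := e)).hasLineDerivAt
  have h2 : HasDerivAt (fun t : ℝ => (p + t • e).1) e.1 0 := by
    simpa using ((hasDerivAt_id (0 : ℝ)).mul_const e.1).const_add p.1
  have h3 : HasDerivAt (fun t : ℝ => θ (p + t • e).1) (deriv θ p.1 * e.1) 0 := by
    have : HasDerivAt θ (deriv θ p.1) (p + (0 : ℝ) • e).1 := by simpa using (hθ p.1).hasDerivAt
    exact this.comp (0 : ℝ) h2
  have h4 : HasDerivAt (fun t : ℝ => G (v (p + t • e))) (G' (lineDeriv ℝ v p e)) 0 := by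
    have : HasFDerivAt G G' (v (p + (0 : ℝ) • e)) := by simpa using hG
    exact this.comp_hasDerivAt (0 : ℝ) h1
  have h5 : HasLineDerivAt ℝ (fun p => θ p.1 • G (v p)) _ p e := h3.smul h4
  rw [h5.lineDeriv]
  simp only [zero_smul, add_zero]
  rw [add_comm, mul_comm e.1]

section Balance

variable {m : ℕ} {U C : Set (Vec m)} {f : Vec m → Vec m} {η q : Vec m → ℝ} {T : ℝ}
  {μbar : Measure (L2Fun m)} {μ : ℝ → Measure (L2Fun m)} {κ : Kernel (ℝ × ℝ) C}
  {v : ℝ × ℝ → Vec m} {K : ℝ≥0}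

/-- The mean over `κ` of the linearization of the entropy at `v`. -/
noncomputable def linearizedEntropy (η : Vec m → ℝ) (v : ℝ × ℝ → Vec m) (κ : Kernel (ℝ × ℝ) C)
    (p : ℝ × ℝ) : ℝ := η (v p) + fderiv ℝ η (v p) (barycenter κ p - v p)

/-- The production of relative entropy. -/
noncomputable def entropyProduction (f : Vec m → Vec m) (η : Vec m → ℝ) (v : ℝ × ℝ → Vec m)
    (κ : Kernel (ℝ × ℝ) C) (p : ℝ × ℝ) : ℝ :=
  fderiv ℝ (fderiv ℝ η) (v p) (lineDeriv ℝ v p (1, 0)) (barycenter κ p - v p) +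
    fderiv ℝ (fderiv ℝ η) (v p) (lineDeriv ℝ v p (0, 1)) (fluxMean f κ p - f (v p))

lemma LipschitzOnWith.comp_lipschitzWith {X Y Z : Type*} [PseudoEMetricSpace X]
    [PseudoEMetricSpace Y] [PseudoEMetricSpace Z] {g : Y → Z} {s : Set Y} {v : X → Y} {L K : ℝ≥0}
    (hg : LipschitzOnWith L g s) (hv : LipschitzWith K v) (hs : ∀ x, v x ∈ s) :
    LipschitzWith (L * K) fun x => g (v x) := by
  rw [← lipschitzOnWith_univ]
  exact hg.comp hv.lipschitzOnWith fun x _ => hs x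

lemma ContDiffOn.lipschitzWith_smul_comp {F : Type*} [NormedAddCommGroup F] [NormedSpace ℝ F]
    (hU : IsOpen U) (hC : Convex ℝ C) (hCc : IsCompact C) (hCU : C ⊆ U) {g : Vec m → F}
    (hg : ContDiffOn ℝ 1 g U) (hv : LipschitzWith K v) (hvC : ∀ p, v p ∈ C) {θ : ℝ → ℝ} {Kθ : ℝ≥0}
    (hθ : LipschitzWith Kθ θ) (hθ1 : ∀ t, |θ t| ≤ 1) :
    ∃ L : ℝ≥0, LipschitzWith L fun p : ℝ × ℝ => θ p.1 • g (v p) := by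
  obtain ⟨L, hL⟩ := hg.exists_lipschitzOnWith_of_convex_isCompact hU hC hCc hCU
  obtain ⟨B, hB⟩ := hCc.exists_bound_of_continuousOn (hg.continuousOn.mono hCU)
  exact ⟨_, LipschitzWith.smul_of_bounded (θ := fun p : ℝ × ℝ => θ p.1)
    (hθ.comp LipschitzWith.prod_fst) (hL.comp_lipschitzWith hv hvC) (fun p => hθ1 p.1)
    fun p => hB _ (hvC p)⟩

lemma integrable_fluxMean [IsMarkovKernel κ] (hCc : IsCompact C) (hf : ContinuousOn f C) :
    Integrable (fluxMean f κ) (cylMeasure T) := by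
  obtain ⟨M, -, hM⟩ := exists_norm_integral_kernel_subtype_le (κ := κ) hCc hf
  exact Integrable.of_bound
    (stronglyMeasurable_integral_kernel_subtype hCc hf).aestronglyMeasurable M
    (Eventually.of_forall hM)

/-- Everything in the relative entropy except `η(u)` is affine in `u`, so it is governed by an
identity, not an inequality. The equation tested with `θ Dη(v)` handles the term linear in `u`. The
terms depending on `v` alone come from integrating total derivatives of Lipschitz functions, with
periodicity removing the space boundary terms. -/
lemma IsYoungMeasureOf.entropy_balance (hU : IsOpen U) (hC : Convex ℝ C) (hCc : IsCompact C)
    (hCU : C ⊆ U) (hpair : IsEntropyPair U f η q) (hκ : IsYoungMeasureOf U C f T μbar μ κ)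
    [IsFiniteMeasure μbar] (hμbar : IsValuedIn C μbar) (hv : LipschitzWith K v)
    (hvC : ∀ p, v p ∈ C) (hper : ∀ t x, v (t, x + 1) = v (t, x)) (hT : 0 < T)
    {θ : ℝ → ℝ} {Kθ : ℝ≥0} (hθd : Differentiable ℝ θ) (hθ : LipschitzWith Kθ θ)
    (hθ1 : ∀ t, |θ t| ≤ 1) {T' : ℝ} (hT' : T' < T) (hsupp : ∀ t, T' ≤ t → θ t = 0) :
    (∫ p, (deriv θ p.1 * linearizedEntropy η v κ p + θ p.1 * entropyProduction f η v κ p)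
      ∂cylMeasure T) +
    θ 0 * ∫ x in unitDomain, (η (v (0, x)) +
      fderiv ℝ η (v (0, x)) ((∫ u, u ∂μbar : L2Fun m) x - v (0, x))) = 0 := by
  have := hκ.markov
  have hη := hpair.entropy_contDiffOn
  have hη1 := hη.contDiffOn_one_fderiv hU
  have hf1 : ContDiffOn ℝ 1 f U := hpair.flux_contDiffOn.of_le (by norm_num)
  have hfC : ContinuousOn f C := hf1.continuousOn.mono hCU
  -- The derivative of `g` along `a` is `-D²η(a, v)`, and by compatibility that of `Q` is `D²η(a,
  -- f(v))`: these are the terms that turn the barycenter and the mean flux into differences from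
  -- `v` and `f(v)`.
  let g : Vec m → ℝ := fun u => η u - fderiv ℝ η u u
  let Q : Vec m → ℝ := fun u => fderiv ℝ η u (f u) - q u
  have hg1 : ContDiffOn ℝ 1 g U := (hη.of_le (by norm_num)).sub (hη1.clm_apply contDiffOn_id)
  have hQ1 : ContDiffOn ℝ 1 Q U :=
    (hη1.clm_apply hf1).sub (hpair.entropyFlux_contDiffOn.of_le (by norm_num))
  obtain ⟨L1, hL1⟩ := hη1.lipschitzWith_smul_comp hU hC hCc hCU hv hvC hθ hθ1
  obtain ⟨L2, hL2⟩ := hg1.lipschitzWith_smul_comp hU hC hCc hCU hv hvC hθ hθ1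
  obtain ⟨L3, hL3⟩ := hQ1.lipschitzWith_smul_comp hU hC hCc hCU hv hvC hθ hθ1
  have e1 := hκ.equation_dual hCc hfC hμbar hL1 (fun t x => by simp only [hper]) hT'
    (fun t ht x => by simp [hsupp t ht])
  have e2 := integral_cylMeasure_timeDeriv hL2 hT.le
    (fun x => by simp [hsupp T hT'.le])
  have e3 := integral_cylMeasure_spaceDeriv (T := T) hL3 (fun t x => by simp only [hper])
  have hI1 : ∀ e (W : ℝ × ℝ → Vec m), Integrable W (cylMeasure T) → Integrable (fun p =>
      lineDeriv ℝ (fun p : ℝ × ℝ => θ p.1 • fderiv ℝ η (v p)) p e (W p)) (cylMeasure T) :=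
    fun e W hW => integrable_clm_apply (aestronglyMeasurable_lineDeriv hL1.continuous _)
      (Eventually.of_forall fun p => norm_lineDeriv_le_of_lipschitz ℝ hL1) hW
  have hIA : Integrable (fun p =>
      lineDeriv ℝ (fun p : ℝ × ℝ => θ p.1 • fderiv ℝ η (v p)) p (1, 0) (barycenter κ p) +
      lineDeriv ℝ (fun p : ℝ × ℝ => θ p.1 • fderiv ℝ η (v p)) p (0, 1) (fluxMean f κ p))
      (cylMeasure T) := (hI1 (1, 0) _ (integrable_fluxMean (κ := κ) hCc continuousOn_id)).add
    (hI1 (0, 1) _ (integrable_fluxMean (κ := κ) hCc hfC))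
  have hIB := hL2.integrable_lineDeriv_cylMeasure T (1, 0)
  have hIC := hL3.integrable_lineDeriv_cylMeasure T (0, 1)
  have hsplit : (∫ p, (deriv θ p.1 * linearizedEntropy η v κ p +
      θ p.1 * entropyProduction f η v κ p) ∂cylMeasure T) =
      (∫ p, (lineDeriv ℝ (fun p : ℝ × ℝ => θ p.1 • fderiv ℝ η (v p)) p (1, 0) (barycenter κ p) +
        lineDeriv ℝ (fun p : ℝ × ℝ => θ p.1 • fderiv ℝ η (v p)) p (0, 1) (fluxMean f κ p))
        ∂cylMeasure T) +
      (∫ p, lineDeriv ℝ (fun p : ℝ × ℝ => θ p.1 • g (v p)) p (1, 0) ∂cylMeasure T) -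
      ∫ p, lineDeriv ℝ (fun p : ℝ × ℝ => θ p.1 • Q (v p)) p (0, 1) ∂cylMeasure T := by
    rw [← integral_add hIA hIB, ← integral_sub]
    rotate_left
    · exact hIA.add hIB
    · exact hIC
    refine integral_congr_ae ?_
    filter_upwards [(cylMeasure_absolutelyContinuous T).ae_le
      (hv.ae_differentiableAt (μ := volume))] with p hp
    have hvU := hCU (hvC p)
    have d1 := hη.hasFDerivAt_of_mem hU hvU
    have d2 := hη.hasFDerivAt_fderiv_of_mem hU hvU
    have d3 := hpair.flux_contDiffOn.hasFDerivAt_of_mem hU hvU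
    have d4 := hpair.entropyFlux_contDiffOn.hasFDerivAt_of_mem hU hvU
    have dg : HasFDerivAt g _ (v p) := d1.sub (d2.clm_apply (hasFDerivAt_id (v p)))
    have dQ : HasFDerivAt Q _ (v p) := (d2.clm_apply d3).sub d4
    rw [lineDeriv_smul_comp hθd hp d2, lineDeriv_smul_comp hθd hp d2,
      lineDeriv_smul_comp hθd hp dg, lineDeriv_smul_comp hθd hp dQ, linearizedEntropy,
      entropyProduction, hpair.compatible _ hvU]
    simp only [g, Q, add_apply, sub_apply, smul_apply, ContinuousLinearMap.comp_apply,
      ContinuousLinearMap.flip_apply, smul_eq_mul, map_sub, one_mul, zero_mul, zero_add,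
      ContinuousLinearMap.id_apply, zero_smul]
    ring
  have hinit : θ 0 * ∫ x in unitDomain, (η (v (0, x)) +
      fderiv ℝ η (v (0, x)) ((∫ u, u ∂μbar : L2Fun m) x - v (0, x))) =
      (∫ x in unitDomain, (θ 0 • fderiv ℝ η (v (0, x))) ((∫ u, u ∂μbar : L2Fun m) x)) +
      ∫ x in unitDomain, θ 0 • g (v (0, x)) := by
    have hsl : Continuous fun x : ℝ => ((0 : ℝ), x) := by fun_prop
    have c1 : Continuous fun x => θ 0 • fderiv ℝ η (v (0, x)) := hL1.continuous.comp hsl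
    have c2 : Continuous fun x => θ 0 • g (v (0, x)) := hL2.continuous.comp hsl
    obtain ⟨B1, hB1⟩ := (isCompact_Icc (a := (0 : ℝ)) (b := 1)).exists_bound_of_continuousOn
      c1.continuousOn
    have hUint : Integrable (fun x => (∫ u, u ∂μbar : L2Fun m) x)
        (volume.restrict unitDomain) := (Lp.memLp _).integrable (by norm_num)
    rw [← integral_const_mul, ← integral_add]
    · refine integral_congr_ae (Eventually.of_forall fun x => ?_)
      simp only [g, smul_apply, smul_eq_mul, map_sub]
      ring
    · refine integrable_clm_apply (M := B1) c1.aestronglyMeasurable ?_ hUint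
      filter_upwards [ae_restrict_mem measurableSet_Ioo] with x hx
      exact hB1 x (Ioo_subset_Icc_self hx)
    · exact (c2.continuousOn.integrableOn_compact isCompact_Icc).mono_set Ioo_subset_Icc_self
  rw [hsplit, hinit, e3]
  linarith

/-- The mean square distance to `v`. -/
noncomputable def meanSqDist (v : ℝ × ℝ → Vec m) (κ : Kernel (ℝ × ℝ) C) (p : ℝ × ℝ) : ℝ :=
  ∫ ξ : C, ‖(ξ : Vec m) - v p‖ ^ 2 ∂κ p

/-- The production is linear in `ξ - v` and `f ξ - f v`, so it is the `κ`-mean of the pointwise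
production, and the pointwise quadratic bound can be averaged. -/
lemma HessianBounds.abs_entropyProduction_le {cf cl cu : ℝ} [IsMarkovKernel κ] (hU : IsOpen U)
    (hC : Convex ℝ C) (hCc : IsCompact C) (hCU : C ⊆ U) (hpair : IsEntropyPair U f η q)
    (hb : HessianBounds C f η cf cl cu)
    (hpos : ∀ v ∈ C, ∀ w, w ≠ 0 → 0 < fderiv ℝ (fderiv ℝ η) v w w) (hvC : ∀ p, v p ∈ C)
    (p : ℝ × ℝ) : |entropyProduction f η v κ p| ≤
      1 / 2 * ‖lineDeriv ℝ v p (1, 0) + fderiv ℝ f (v p) (lineDeriv ℝ v p (0, 1))‖ ^ 2 +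
      1 / 2 * (cu ^ 2 + cu * cf * ‖lineDeriv ℝ v p (0, 1)‖) * meanSqDist v κ p := by
  have hfC : ContinuousOn f C := hpair.flux_contDiffOn.continuousOn.mono hCU
  have i1 : Integrable (fun ξ : C => (ξ : Vec m) - v p) (κ p) :=
    hCc.integrable_subtype (h := fun ξ => ξ - v p) (by fun_prop) _
  have i2 : Integrable (fun ξ : C => f ξ - f (v p)) (κ p) :=
    hCc.integrable_subtype (h := fun ξ => f ξ - f (v p)) (hfC.sub continuousOn_const) _
  have i3 : Integrable (fun ξ : C => ‖(ξ : Vec m) - v p‖ ^ 2) (κ p) :=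
    hCc.integrable_subtype (h := fun ξ => ‖ξ - v p‖ ^ 2) (by fun_prop) _
  have h1 : barycenter κ p - v p = ∫ ξ : C, ((ξ : Vec m) - v p) ∂κ p := by
    rw [integral_sub (hCc.integrable_subtype (h := fun ξ => ξ) continuousOn_id _)
      (integrable_const _)]
    simp [barycenter]
  have h2 : fluxMean f κ p - f (v p) = ∫ ξ : C, (f ξ - f (v p)) ∂κ p := by
    rw [integral_sub (hCc.integrable_subtype hfC _) (integrable_const _)]
    simp [fluxMean]
  rw [entropyProduction, h1, h2, ← ContinuousLinearMap.integral_comp_comm _ i1,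
    ← ContinuousLinearMap.integral_comp_comm _ i2,
    ← integral_add (ContinuousLinearMap.integrable_comp _ i1)
      (ContinuousLinearMap.integrable_comp _ i2), ← Real.norm_eq_abs]
  refine (norm_integral_le_of_norm_le (g := fun ξ : C =>
    1 / 2 * ‖lineDeriv ℝ v p (1, 0) + fderiv ℝ f (v p) (lineDeriv ℝ v p (0, 1))‖ ^ 2 +
    1 / 2 * (cu ^ 2 + cu * cf * ‖lineDeriv ℝ v p (0, 1)‖) * ‖(ξ : Vec m) - v p‖ ^ 2)
    ((integrable_const _).add (i3.const_mul _)) (Eventually.of_forall fun ξ =>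
      hb.abs_production_le hU hC hCU hpair hpos ξ.2 (hvC p) _ _)).trans (le_of_eq ?_)
  rw [integral_add (integrable_const _) (i3.const_mul _), integral_const, probReal_univ,
    one_smul, integral_const_mul, meanSqDist]

end Balance

/-! ### Localization in time and Gronwall's inequality -/

/-- A smooth version of the indicator of `(-∞, s]`. -/
noncomputable def smoothCutoff (s : ℝ) (ρ : ContDiffBump (0 : ℝ)) (t : ℝ) : ℝ :=
  ∫ σ in (t - s)..(ρ.rOut + 1), ρ.normed volume σ

section Cutoff

variable {s : ℝ} {ρ : ContDiffBump (0 : ℝ)}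

lemma normed_eq_zero {σ : ℝ} (h : ρ.rOut ≤ |σ|) : ρ.normed volume σ = 0 := by
  rw [← Function.notMem_support, ρ.support_normed_eq, Metric.mem_ball, dist_zero_right]
  exact not_lt.2 h

lemma smoothCutoff_eq_zero {t : ℝ} (h : s + ρ.rOut ≤ t) : smoothCutoff s ρ t = 0 := by
  rw [smoothCutoff, intervalIntegral.integral_congr (g := fun _ => 0)]
  · simp
  · intro σ hσ
    have h1 : ρ.rOut ≤ σ := (le_inf (by linarith) (by linarith) :
      ρ.rOut ≤ min (t - s) (ρ.rOut + 1)).trans hσ.1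
    exact normed_eq_zero (h1.trans (le_abs_self _))

lemma smoothCutoff_nonneg (t : ℝ) : 0 ≤ smoothCutoff s ρ t := by
  rcases le_total (s + ρ.rOut) t with h | h
  · rw [smoothCutoff_eq_zero h]
  · exact intervalIntegral.integral_nonneg (by linarith) fun σ _ => ρ.nonneg_normed σ

lemma smoothCutoff_le_one (t : ℝ) : smoothCutoff s ρ t ≤ 1 := by
  rcases le_total (s + ρ.rOut) t with h | h
  · rw [smoothCutoff_eq_zero h]; exact zero_le_one
  · rw [smoothCutoff, intervalIntegral.integral_of_le (by linarith),
      ← ρ.integral_normed (μ := volume)]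
    exact setIntegral_le_integral ρ.integrable_normed (Eventually.of_forall ρ.nonneg_normed)

lemma smoothCutoff_eq_one {t : ℝ} (h : t ≤ s - ρ.rOut) : smoothCutoff s ρ t = 1 := by
  rw [smoothCutoff, intervalIntegral.integral_of_le (by linarith [ρ.rOut_pos])]
  refine Eq.trans ?_ (ρ.integral_normed (μ := volume))
  refine setIntegral_eq_integral_of_forall_compl_eq_zero fun σ hσ => normed_eq_zero ?_
  rw [mem_Ioc, not_and_or, not_lt, not_le] at hσ
  rcases hσ with hσ | hσ
  · rw [abs_of_nonpos (by linarith [ρ.rOut_pos])]; linarith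
  · exact (by linarith : ρ.rOut ≤ σ).trans (le_abs_self _)

lemma hasDerivAt_smoothCutoff (t : ℝ) :
    HasDerivAt (smoothCutoff s ρ) (-ρ.normed volume (t - s)) t := by
  have hc := ρ.continuous_normed (μ := (volume : Measure ℝ))
  have h1 : HasDerivAt (fun u => ∫ σ in u..(ρ.rOut + 1), ρ.normed volume σ)
      (-ρ.normed volume (t - s)) (t - s) :=
    intervalIntegral.integral_hasDerivAt_left (hc.intervalIntegrable _ _)
      (hc.stronglyMeasurableAtFilter _ _) hc.continuousAt
  exact h1.comp_sub_const t s

lemma deriv_smoothCutoff :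
    deriv (smoothCutoff s ρ) = fun t => -ρ.normed volume (t - s) :=
  funext fun t => (hasDerivAt_smoothCutoff t).deriv

lemma contDiff_smoothCutoff : ContDiff ℝ ((⊤ : ℕ∞) : WithTop ℕ∞) (smoothCutoff s ρ) := by
  rw [contDiff_infty_iff_deriv, deriv_smoothCutoff]
  refine ⟨fun t => (hasDerivAt_smoothCutoff t).differentiableAt, ?_⟩
  exact (ρ.contDiff_normed.comp (contDiff_id.sub contDiff_const)).neg

lemma exists_lipschitzWith_smoothCutoff : ∃ L : ℝ≥0, LipschitzWith L (smoothCutoff s ρ) := by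
  obtain ⟨B, hB⟩ := (ρ.continuous_normed (μ := (volume : Measure ℝ))).bounded_above_of_compact_support
    ρ.hasCompactSupport_normed
  refine ⟨B.toNNReal, lipschitzWith_of_nnnorm_deriv_le
    (fun t => (hasDerivAt_smoothCutoff t).differentiableAt) fun t => ?_⟩
  rw [deriv_smoothCutoff, ← NNReal.coe_le_coe, coe_nnnorm, norm_neg]
  exact (hB _).trans (Real.le_coe_toNNReal _)

end Cutoff

/-- The derivative of a smooth cutoff at `s` is minus a bump centred at `s`, so testing with it
yields a mollification of `E` at `s`. This converges to `E s` for almost every `s`, which is why the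
conclusion holds only almost everywhere. -/
lemma ae_le_of_forall_smooth_cutoff {E r : ℝ → ℝ} {E₀ T T' : ℝ} (hT' : T' < T)
    (hE : IntegrableOn E (Ioo 0 T)) (hr : IntegrableOn r (Ioo 0 T))
    (h : ∀ θ : ℝ → ℝ, ContDiff ℝ ((⊤ : ℕ∞) : WithTop ℕ∞) θ → (∃ L : ℝ≥0, LipschitzWith L θ) →
      (∀ t, 0 ≤ θ t) → (∀ t, θ t ≤ 1) → (∀ t, T' ≤ t → θ t = 0) →
      0 ≤ (∫ t in Ioo 0 T, deriv θ t * E t) + θ 0 * E₀ + ∫ t in Ioo 0 T, θ t * r t) :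
    ∀ᵐ s ∂(volume.restrict (Ioo 0 T')), E s ≤ E₀ + ∫ t in Ioo 0 s, r t := by
  have hEi : Integrable ((Ioo 0 T).indicator E) := hE.integrable_indicator measurableSet_Ioo
  filter_upwards [ae_restrict_of_ae (ae_tendsto_mollify 1 one_pos hEi.locallyIntegrable),
    ae_restrict_mem measurableSet_Ioo] with s hs hsm
  have hsT : s < T := hsm.2.trans hT'
  rw [indicator_of_mem (show s ∈ Ioo 0 T from ⟨hsm.1, hsT⟩)] at hs
  let ρ : ℕ → ContDiffBump (0 : ℝ) := shrinkingBump 1 one_pos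
  have hρ : Tendsto (fun n => (ρ n).rOut) atTop (𝓝 0) := tendsto_shrinkingBump_rOut 1 one_pos
  have hmol : ∀ n, mollify volume (ρ n) ((Ioo 0 T).indicator E) s =
      -∫ t in Ioo 0 T, deriv (smoothCutoff s (ρ n)) t * E t := fun n => by
    -- Reflect the variable about `s`; evenness of the bump then identifies the two kernels.
    rw [mollify_apply, ← integral_sub_left_eq_self _ volume s, ← integral_neg,
      ← integral_indicator measurableSet_Ioo]
    refine integral_congr_ae (Eventually.of_forall fun t => ?_)
    simp only [sub_sub_cancel, deriv_smoothCutoff]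
    rw [← (ρ n).normed_neg, neg_sub]
    by_cases ht : t ∈ Ioo 0 T
    · simp [indicator_of_mem ht]
    · simp [indicator_of_notMem ht]
  have hlim : Tendsto (fun n => ∫ t in Ioo 0 T, smoothCutoff s (ρ n) t * r t) atTop
      (𝓝 (∫ t in Ioo 0 s, r t)) := by
    have h1 : ∫ t in Ioo 0 s, r t = ∫ t in Ioo 0 T, (Iio s).indicator r t := by
      rw [setIntegral_indicator measurableSet_Iio, Ioo_inter_Iio, min_eq_right hsT.le]
    rw [h1]
    refine tendsto_integral_of_dominated_convergence (fun t => ‖r t‖) (fun n => ?_) hr.norm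
      (fun n => Eventually.of_forall fun t => ?_) ?_
    · exact (contDiff_smoothCutoff.continuous.aestronglyMeasurable).mul hr.1
    · rw [norm_mul, Real.norm_of_nonneg (smoothCutoff_nonneg t)]
      exact mul_le_of_le_one_left (norm_nonneg _) (smoothCutoff_le_one t)
    · have hne : ∀ᵐ t ∂(volume.restrict (Ioo 0 T)), t ≠ s :=
        ae_restrict_of_ae (Measure.ae_ne volume s)
      filter_upwards [hne] with t ht
      refine tendsto_const_nhds.congr' ?_
      rcases lt_or_gt_of_ne ht with hlt | hgt
      · rw [indicator_of_mem (mem_Iio.2 hlt)]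
        filter_upwards [hρ.eventually_lt_const (sub_pos.2 hlt)] with n hn
        rw [smoothCutoff_eq_one (by linarith), one_mul]
      · rw [indicator_of_notMem (by simpa using hgt.le)]
        filter_upwards [hρ.eventually_lt_const (sub_pos.2 hgt)] with n hn
        rw [smoothCutoff_eq_zero (by linarith), zero_mul]
  refine le_of_tendsto_of_tendsto hs (tendsto_const_nhds.add hlim) ?_
  -- Once the width is below both `s` and `T' - s`, the cutoff equals `1` at time `0` and vanishes
  -- from `T'` on.
  filter_upwards [hρ.eventually_lt_const hsm.1, hρ.eventually_lt_const (sub_pos.2 hsm.2)]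
    with n hn1 hn2
  have h1 := h (smoothCutoff s (ρ n)) contDiff_smoothCutoff exists_lipschitzWith_smoothCutoff
    smoothCutoff_nonneg smoothCutoff_le_one (fun t ht => smoothCutoff_eq_zero (by linarith))
  rw [smoothCutoff_eq_one (by linarith), one_mul] at h1
  change mollify volume (ρ n) ((Ioo 0 T).indicator E) s ≤ _
  rw [hmol n]
  linarith

/-- `G` is only integrable and the hypothesis only holds almost everywhere, so the argument runs on
the continuous majorant `H = a + b ∫ G`. With `J` the primitive of `H`, one has `H ≤ a + b J`, and
`(a + b J) exp(-b t)` is antitone. No sign of `a` is needed. -/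
lemma gronwall_of_ae_le {G : ℝ → ℝ} {a b s : ℝ} (hs : 0 < s) (hb : 0 ≤ b)
    (hG : IntegrableOn G (Ioo 0 s))
    (h : ∀ᵐ t ∂(volume.restrict (Ioo 0 s)), G t ≤ a + b * ∫ τ in Ioo 0 t, G τ)
    (hend : G s ≤ a + b * ∫ τ in Ioo 0 s, G τ) : G s ≤ a * Real.exp (b * s) := by
  have hGi : Integrable ((Ioo 0 s).indicator G) := hG.integrable_indicator measurableSet_Ioo
  let H : ℝ → ℝ := fun t => a + b * ∫ τ in (0 : ℝ)..t, (Ioo 0 s).indicator G τ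
  have hHc : Continuous H := by
    have := intervalIntegral.continuous_primitive (fun a b => hGi.intervalIntegrable) 0
    fun_prop
  have hHeq : ∀ t ∈ Icc 0 s, H t = a + b * ∫ τ in Ioo 0 t, G τ := fun t ht => by
    simp only [H]
    rw [intervalIntegral.integral_of_le ht.1, integral_Ioc_eq_integral_Ioo,
      setIntegral_indicator measurableSet_Ioo, inter_eq_left.2 (Ioo_subset_Ioo_right ht.2)]
  let J : ℝ → ℝ := fun t => ∫ τ in (0 : ℝ)..t, H τ
  have hJ : ∀ t, HasDerivAt J (H t) t := fun t =>
    intervalIntegral.integral_hasDerivAt_right (hHc.intervalIntegrable _ _)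
      (hHc.stronglyMeasurableAtFilter _ _) hHc.continuousAt
  have hHJ : ∀ t ∈ Icc 0 s, H t ≤ a + b * J t := fun t ht => by
    rw [hHeq t ht]
    gcongr
    simp only [J]
    rw [intervalIntegral.integral_of_le ht.1, integral_Ioc_eq_integral_Ioo]
    refine integral_mono_ae (hG.mono_set (Ioo_subset_Ioo_right ht.2))
      ((hHc.integrableOn_Icc).mono_set Ioo_subset_Icc_self) ?_
    filter_upwards [ae_restrict_of_ae_restrict_of_subset (Ioo_subset_Ioo_right ht.2) h,
      ae_restrict_mem measurableSet_Ioo] with τ hτ hτm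
    rwa [hHeq τ ⟨hτm.1.le, hτm.2.le.trans ht.2⟩]
  have hW : AntitoneOn (fun t => (a + b * J t) * Real.exp (-b * t)) (Icc 0 s) := by
    have hd : ∀ t, HasDerivAt (fun t => (a + b * J t) * Real.exp (-b * t))
        (b * (H t - (a + b * J t)) * Real.exp (-b * t)) t := fun t => by
      have h1 : HasDerivAt (fun t => Real.exp (-b * t)) (Real.exp (-b * t) * (-b * 1)) t :=
        ((hasDerivAt_id t).const_mul (-b)).exp
      exact ((((hJ t).const_mul b).const_add a).mul h1).congr_deriv (by ring)
    refine antitoneOn_of_hasDerivWithinAt_nonpos (convex_Icc 0 s)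
      (fun t _ => (hd t).continuousAt.continuousWithinAt)
      (fun t _ => (hd t).hasDerivWithinAt) fun t ht => ?_
    have := hHJ t (interior_subset ht)
    exact mul_nonpos_of_nonpos_of_nonneg
      (mul_nonpos_of_nonneg_of_nonpos hb (by linarith)) (Real.exp_pos _).le
  have h1 := hW (left_mem_Icc.2 hs.le) (right_mem_Icc.2 hs.le) hs.le
  have hJ0 : J 0 = 0 := intervalIntegral.integral_same
  simp only [hJ0, mul_zero, add_zero, Real.exp_zero, mul_one] at h1
  have h2 := hHJ s (right_mem_Icc.2 hs.le)
  rw [hHeq s (right_mem_Icc.2 hs.le)] at h2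
  refine hend.trans (h2.trans ?_)
  have h3 : a + b * J s = (a + b * J s) * Real.exp (-b * s) * Real.exp (b * s) := by
    rw [mul_assoc, ← Real.exp_add]; simp
  rw [h3]
  gcongr

/-! ### Integral functionals on `L²(D; C)` -/

/-- Composition with `H - H 0` is Lipschitz on `L²`, and integrating over `D` is the pairing with
the constant `1`. -/
lemma LipschitzWith.continuous_integral_comp_l2Fun {m : ℕ} {H : Vec m → ℝ} {K : ℝ≥0}
    (hH : LipschitzWith K H) : Continuous fun u : L2Fun m => ∫ x in unitDomain, H (u x) := by
  have hH0 : LipschitzWith K fun ξ => H ξ - H 0 := fun a b => by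
    simpa [edist_dist, Real.dist_eq] using hH a b
  have h0 : (fun ξ => H ξ - H 0) 0 = 0 := sub_self _
  have hone : MemLp (fun _ : ℝ => (1 : ℝ)) 2 (volume.restrict unitDomain) := memLp_const _
  have key : (fun u : L2Fun m => ∫ x in unitDomain, H (u x)) =
      fun u => inner ℝ hone.toLp (hH0.compLp h0 u) + H 0 := by
    ext u
    have h1 := Lp.memLp (hH0.compLp h0 u)
    have h2 : ∫ x in unitDomain, H (u x) =
        ∫ x in unitDomain, ((hH0.compLp h0 u : Lp ℝ 2 _) x + H 0) := by
      refine integral_congr_ae ?_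
      filter_upwards [hH0.coeFn_compLp h0 u] with x hx
      rw [hx]; simp
    rw [h2, integral_add (h1.integrable (by norm_num)) (integrable_const _), L2.inner_def]
    congr 1
    · refine integral_congr_ae ?_
      filter_upwards [hone.coeFn_toLp] with x hx
      rw [hx]; simp
    · simp
  rw [key]
  exact (continuous_const.inner (hH0.continuous_compLp h0)).add continuous_const

section Functionals

variable {m : ℕ} {U C : Set (Vec m)} {μ : Measure (L2Fun m)} [IsFiniteMeasure μ]

/-- The entropy is controlled only near `C`; a Lipschitz extension from `C` to the whole space gives
a continuous functional on `L²` that agrees with the given one `μ`-almost everywhere, hence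
measurability. -/
lemma IsValuedIn.integrable_integral_comp (hC : IsCompact C) (h : IsValuedIn C μ)
    {g : Vec m → ℝ} {K : ℝ≥0} (hg : LipschitzOnWith K g C) :
    Integrable (fun u : L2Fun m => ∫ x in unitDomain, g (u x)) μ := by
  obtain ⟨H, hH, hHg⟩ := hg.extend_real
  obtain ⟨M, hM⟩ := hC.exists_bound_of_continuousOn hg.continuousOn
  refine Integrable.of_bound (C := M) ?_ ?_
  · refine (hH.continuous_integral_comp_l2Fun.aestronglyMeasurable (μ := μ)).congr ?_
    filter_upwards [h] with u hu
    refine integral_congr_ae ?_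
    filter_upwards [hu] with x hx
    exact (hHg hx).symm
  · filter_upwards [h] with u hu
    refine (norm_integral_le_of_norm_le_const (C := M) ?_).trans (le_of_eq ?_)
    · filter_upwards [hu] with x hx using hM _ hx
    · simp

lemma IsValuedIn.integrable_comp {u : L2Fun m} (hC : IsCompact C)
    (hu : ∀ᵐ x ∂((volume : Measure ℝ).restrict unitDomain), u x ∈ C)
    {g : Vec m → ℝ} {K : ℝ≥0} (hg : LipschitzOnWith K g C) :
    Integrable (fun x => g (u x)) (volume.restrict unitDomain) := by
  obtain ⟨H, hH, hHg⟩ := hg.extend_real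
  obtain ⟨M, hM⟩ := hC.exists_bound_of_continuousOn hg.continuousOn
  refine Integrable.of_bound (C := M) ?_ ?_
  · refine (hH.continuous.comp_aestronglyMeasurable (Lp.aestronglyMeasurable u)).congr ?_
    filter_upwards [hu] with x hx using (hHg hx).symm
  · filter_upwards [hu] with x hx using hM _ hx

lemma IsValuedIn.integrable_dual (hC : IsCompact C) (h : IsValuedIn C μ)
    {c : ℝ → (Vec m →L[ℝ] ℝ)} (hc : MemLp c 2 (volume.restrict unitDomain)) :
    Integrable (fun u : L2Fun m => ∫ x in unitDomain, c x (u x)) μ := by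
  let a : ℝ → Vec m := fun x => (InnerProductSpace.toDual ℝ (Vec m)).symm (c x)
  have ha : MemLp a 2 (volume.restrict unitDomain) := by
    refine MemLp.of_le hc ?_ (Eventually.of_forall fun x => ?_)
    · exact (InnerProductSpace.toDual ℝ (Vec m)).symm.continuous.comp_aestronglyMeasurable hc.1
    · simp [a]
  have key : ∀ u : L2Fun m, ∫ x in unitDomain, c x (u x) = inner ℝ ha.toLp u := fun u => by
    rw [L2.inner_def]
    refine integral_congr_ae ?_
    filter_upwards [ha.coeFn_toLp] with x hx
    rw [hx]
    simp [a]
  simp_rw [key]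
  exact (h.integrable_id hC).const_inner _

lemma integral_norm_sub_sq {b : ℝ → Vec m} (hb : MemLp b 2 (volume.restrict unitDomain))
    (u : L2Fun m) : ∫ x in unitDomain, ‖u x - b x‖ ^ 2 = ‖u - hb.toLp‖ ^ 2 := by
  rw [← real_inner_self_eq_norm_sq, L2.inner_def]
  refine integral_congr_ae ?_
  filter_upwards [Lp.coeFn_sub u hb.toLp, hb.coeFn_toLp] with x h1 h2
  rw [h1, Pi.sub_apply, h2, real_inner_self_eq_norm_sq]

lemma IsValuedIn.integrable_norm_sub_sq (hC : IsCompact C) (h : IsValuedIn C μ) (b : L2Fun m) :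
    Integrable (fun u : L2Fun m => ‖u - b‖ ^ 2) μ := by
  obtain ⟨M, hM⟩ := hC.isBounded.exists_norm_le
  refine Integrable.of_bound (C := (max M 0 + ‖b‖) ^ 2) ?_ ?_
  · exact (by fun_prop : Continuous fun u : L2Fun m => ‖u - b‖ ^ 2).aestronglyMeasurable
  · filter_upwards [h] with u hu
    have h1 : ‖u‖ ≤ max M 0 :=
      l2Fun_norm_le (le_max_right _ _) (hu.mono fun x hx => (hM _ hx).trans (le_max_left _ _))
    rw [norm_pow, norm_norm]
    gcongr
    exact (norm_sub_le _ _).trans (by gcongr)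

lemma Continuous.memLp_unitDomain {E : Type*} [NormedAddCommGroup E] {g : ℝ → E}
    (hg : Continuous g) [SecondCountableTopologyEither ℝ E] (p : ℝ≥0∞) :
    MemLp g p (volume.restrict unitDomain) := by
  obtain ⟨B, hB⟩ := (isCompact_Icc (a := (0 : ℝ)) (b := 1)).exists_bound_of_continuousOn
    hg.continuousOn
  refine MemLp.of_bound hg.aestronglyMeasurable B ?_
  filter_upwards [ae_restrict_mem measurableSet_Ioo] with x hx
  exact hB x (Ioo_subset_Icc_self hx)

/-- The relative entropy of `μ` with respect to a continuous `C`-valued function is bounded by the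
mean square distance. -/
lemma HessianBounds.initial_relEntropy_le {f : Vec m → Vec m} {η q : Vec m → ℝ} {cf cl cu : ℝ}
    (hU : IsOpen U) (hC : Convex ℝ C) (hCc : IsCompact C) (hCU : C ⊆ U)
    (hpair : IsEntropyPair U f η q) (hb : HessianBounds C f η cf cl cu)
    (hpos : ∀ v ∈ C, ∀ w, w ≠ 0 → 0 < fderiv ℝ (fderiv ℝ η) v w w)
    (hμ : IsValuedIn C μ) (hμp : IsProbabilityMeasure μ) {b : ℝ → Vec m} (hbc : Continuous b)
    (hbC : ∀ x, b x ∈ C) :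
    ∫ u, (∫ x in unitDomain, η (u x)) ∂μ - ∫ x in unitDomain, (η (b x) +
      fderiv ℝ η (b x) ((∫ u, u ∂μ : L2Fun m) x - b x)) ≤
    cu / 2 * ∫ u, (∫ x in unitDomain, ‖u x - b x‖ ^ 2) ∂μ := by
  have hη := hpair.entropy_contDiffOn
  obtain ⟨Kη, hKη⟩ := (hη.of_le (by norm_num : (1 : WithTop ℕ∞) ≤ 2)).exists_lipschitzOnWith_of_convex_isCompact hU hC hCc hCU
  have c1 : Continuous fun x => fderiv ℝ η (b x) :=
    (hη.contDiffOn_one_fderiv hU).continuousOn.comp_continuous hbc fun x => hCU (hbC x)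
  have c2 : Continuous fun x => η (b x) - fderiv ℝ η (b x) (b x) :=
    (hη.continuousOn.comp_continuous hbc fun x => hCU (hbC x)).sub (c1.clm_apply hbc)
  have m1 := c1.memLp_unitDomain 2
  have m2 := (c2.memLp_unitDomain 1).integrable le_rfl
  have hbL := hbc.memLp_unitDomain 2
  obtain ⟨B1, hB1⟩ := hCc.exists_bound_of_continuousOn
    ((hη.contDiffOn_one_fderiv hU).continuousOn.mono hCU)
  have i1 : ∀ u : L2Fun m, Integrable (fun x => fderiv ℝ η (b x) (u x))
      (volume.restrict unitDomain) := fun u =>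
    integrable_clm_apply c1.aestronglyMeasurable
      (Eventually.of_forall fun x => hB1 _ (hbC x)) ((Lp.memLp u).integrable (by norm_num))
  have key : ∀ u : L2Fun m, ∫ x in unitDomain, (η (b x) + fderiv ℝ η (b x) (u x - b x)) =
      (∫ x in unitDomain, (η (b x) - fderiv ℝ η (b x) (b x))) +
        ∫ x in unitDomain, fderiv ℝ η (b x) (u x) := fun u => by
    rw [← integral_add m2 (i1 u)]
    refine integral_congr_ae (Eventually.of_forall fun x => ?_)
    simp only [map_sub]; ring
  have i2 := hμ.integrable_integral_comp hCc hKη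
  have i3 := hμ.integrable_dual hCc m1
  have i4 : Integrable (fun u : L2Fun m => ∫ x in unitDomain, ‖u x - b x‖ ^ 2) μ := by
    simp_rw [integral_norm_sub_sq hbL]
    exact hμ.integrable_norm_sub_sq hCc _
  -- The linearized part is affine in `u`, so replacing `u` by its mean is the same as averaging
  -- afterwards; the claim then reduces to the pointwise upper bound on the relative entropy.
  have h1 : ∫ x in unitDomain, (η (b x) + fderiv ℝ η (b x) ((∫ u, u ∂μ : L2Fun m) x - b x)) =
      ∫ u, (∫ x in unitDomain, (η (b x) + fderiv ℝ η (b x) (u x - b x))) ∂μ := by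
    simp_rw [key]
    rw [integral_add (integrable_const _) i3, ← hμ.integral_dual hCc m1]
    simp
  have i5 : Integrable (fun u : L2Fun m => ∫ x in unitDomain,
      (η (b x) + fderiv ℝ η (b x) (u x - b x))) μ := by
    simp_rw [key]; exact (integrable_const _).add i3
  rw [h1, ← integral_sub i2 i5, ← integral_const_mul]
  refine integral_mono_ae (i2.sub i5) (i4.const_mul _) ?_
  filter_upwards [hμ] with u hu
  have i6 : Integrable (fun x => η (b x) + fderiv ℝ η (b x) (u x - b x))
      (volume.restrict unitDomain) := (m2.add (i1 u)).congr (Eventually.of_forall fun x => by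
        simp only [Pi.add_apply, map_sub]; ring)
  have i7 := IsValuedIn.integrable_comp hCc hu hKη
  rw [← integral_sub i7 i6, ← integral_const_mul]
  refine integral_mono_ae (i7.sub i6) (Integrable.const_mul ?_ _) ?_
  · exact ((Lp.memLp u).sub hbL).integrable_norm_pow (by norm_num)
  · filter_upwards [hu] with x hx
    have := hb.relEntropy_le hU hC hCU hpair hpos hx (hbC x)
    simp only [relEntropy] at this
    linarith

end Functionals

/-! ### Bounded measurable functions on space-time -/

/-- Bounded and strongly measurable functions on space-time. -/
def IsBddMeasurable {E : Type*} [NormedAddCommGroup E] (g : ℝ × ℝ → E) : Prop :=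
  StronglyMeasurable g ∧ ∃ M, ∀ p, ‖g p‖ ≤ M

namespace IsBddMeasurable

variable {E F : Type*} [NormedAddCommGroup E] [NormedAddCommGroup F] [NormedSpace ℝ E]
  [NormedSpace ℝ F] {g h : ℝ × ℝ → E}

omit [NormedSpace ℝ E] in
lemma integrable (hg : IsBddMeasurable g) (ρ : Measure (ℝ × ℝ)) [IsFiniteMeasure ρ] :
    Integrable g ρ := by
  obtain ⟨hm, M, hM⟩ := hg
  exact Integrable.of_bound hm.aestronglyMeasurable M (Eventually.of_forall hM)

omit [NormedSpace ℝ E] in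
lemma integrable_slice (hg : IsBddMeasurable g) (t : ℝ) :
    Integrable (fun x => g (t, x)) (volume.restrict unitDomain) := by
  obtain ⟨hm, M, hM⟩ := hg
  exact Integrable.of_bound (hm.comp_measurable measurable_prodMk_left).aestronglyMeasurable M
    (Eventually.of_forall fun x => hM _)

lemma integrable_integral_slice (hg : IsBddMeasurable g) (T : ℝ) :
    IntegrableOn (fun t => ∫ x in unitDomain, g (t, x)) (Ioo 0 T) :=
  (hg.integrable (cylMeasure T)).integral_prod_left

lemma setIntegral_cylMeasure (hg : IsBddMeasurable g) (T : ℝ) :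
    ∫ p, g p ∂cylMeasure T = ∫ t in Ioo 0 T, ∫ x in unitDomain, g (t, x) :=
  integral_prod _ (hg.integrable _)

omit [NormedSpace ℝ E] in
lemma add (hg : IsBddMeasurable g) (hh : IsBddMeasurable h) :
    IsBddMeasurable fun p => g p + h p := by
  obtain ⟨hm, M, hM⟩ := hg
  obtain ⟨hn, N, hN⟩ := hh
  exact ⟨hm.add hn, M + N, fun p => (norm_add_le _ _).trans (add_le_add (hM p) (hN p))⟩

omit [NormedSpace ℝ E] in
lemma sub (hg : IsBddMeasurable g) (hh : IsBddMeasurable h) :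
    IsBddMeasurable fun p => g p - h p := by
  obtain ⟨hm, M, hM⟩ := hg
  obtain ⟨hn, N, hN⟩ := hh
  exact ⟨hm.sub hn, M + N, fun p => (norm_sub_le _ _).trans (add_le_add (hM p) (hN p))⟩

lemma clm_apply {L : ℝ × ℝ → E →L[ℝ] F} (hL : IsBddMeasurable L) (hg : IsBddMeasurable g) :
    IsBddMeasurable fun p => L p (g p) := by
  obtain ⟨hm, M, hM⟩ := hL
  obtain ⟨hn, N, hN⟩ := hg
  refine ⟨(by fun_prop : Continuous fun a : (E →L[ℝ] F) × E => a.1 a.2).comp_stronglyMeasurable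
    (hm.prodMk hn), M * N, fun p => (L p).le_of_opNorm_le_of_le (hM p) (hN p)⟩

omit [NormedSpace ℝ E] in
lemma mul {a b : ℝ × ℝ → ℝ} (ha : IsBddMeasurable a) (hb : IsBddMeasurable b) :
    IsBddMeasurable fun p => a p * b p := by
  obtain ⟨hm, M, hM⟩ := ha
  obtain ⟨hn, N, hN⟩ := hb
  refine ⟨hm.mul hn, M * N, fun p => ?_⟩
  rw [norm_mul]
  exact mul_le_mul (hM p) (hN p) (norm_nonneg _) ((norm_nonneg _).trans (hM p))

omit [NormedSpace ℝ E] in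
lemma norm (hg : IsBddMeasurable g) : IsBddMeasurable fun p => ‖g p‖ := by
  obtain ⟨hm, M, hM⟩ := hg
  exact ⟨hm.norm, M, fun p => by rw [norm_norm]; exact hM p⟩

omit [NormedSpace ℝ E] in
lemma sq_norm (hg : IsBddMeasurable g) : IsBddMeasurable fun p => ‖g p‖ ^ 2 := by
  simp_rw [sq]; exact hg.norm.mul hg.norm

lemma inner {m : ℕ} {a b : ℝ × ℝ → Vec m} (ha : IsBddMeasurable a) (hb : IsBddMeasurable b) :
    IsBddMeasurable fun p => Inner.inner ℝ (a p) (b p) := by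
  obtain ⟨hm, M, hM⟩ := ha
  obtain ⟨hn, N, hN⟩ := hb
  refine ⟨hm.inner hn, M * N, fun p => (norm_inner_le_norm _ _).trans ?_⟩
  exact mul_le_mul (hM p) (hN p) (norm_nonneg _) ((norm_nonneg _).trans (hM p))

omit [NormedSpace ℝ E] in
lemma const (c : E) : IsBddMeasurable fun _ => c :=
  ⟨stronglyMeasurable_const, ‖c‖, fun _ => le_rfl⟩

omit [NormedSpace ℝ E] in
lemma comp_of_mem {m : ℕ} {C : Set (Vec m)} (hC : IsCompact C) {G : Vec m → E}
    (hG : ContinuousOn G C) {v : ℝ × ℝ → Vec m} (hv : Continuous v) (hvC : ∀ p, v p ∈ C) :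
    IsBddMeasurable fun p => G (v p) := by
  obtain ⟨M, hM⟩ := hC.exists_bound_of_continuousOn hG
  exact ⟨(hG.comp_continuous hv hvC).stronglyMeasurable, M, fun p => hM _ (hvC p)⟩

lemma integral_kernel {m : ℕ} {C : Set (Vec m)} (hC : IsCompact C) {G : Vec m → E}
    (hG : ContinuousOn G C) (κ : Kernel (ℝ × ℝ) C) [IsMarkovKernel κ] :
    IsBddMeasurable fun p => ∫ ξ : C, G ξ ∂κ p := by
  obtain ⟨M, -, hM⟩ := exists_norm_integral_kernel_subtype_le (κ := κ) hC hG
  exact ⟨stronglyMeasurable_integral_kernel_subtype hC hG, M, hM⟩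

lemma lineDeriv {m : ℕ} {v : ℝ × ℝ → Vec m} {K : ℝ≥0} (hv : LipschitzWith K v) (e : ℝ × ℝ) :
    IsBddMeasurable fun p => lineDeriv ℝ v p e :=
  ⟨(measurable_lineDeriv hv.continuous).stronglyMeasurable, _,
    fun _ => norm_lineDeriv_le_of_lipschitz ℝ hv⟩

end IsBddMeasurable

/-! ### Comparison of a Young measure with a Lipschitz function -/

section Comparison

variable {m : ℕ} {U C : Set (Vec m)} {f : Vec m → Vec m} {η q : Vec m → ℝ} {T : ℝ}
  {κ : Kernel (ℝ × ℝ) C} {v : ℝ × ℝ → Vec m}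

/-- `κ` is the Young measure of `μ`, and `v` is a periodic Lipschitz function with values in `C`. -/
structure IsComparison (U C : Set (Vec m)) (f : Vec m → Vec m) (T : ℝ) (ρ : Measure (L2Fun m))
    (μ : ℝ → Measure (L2Fun m)) (κ : Kernel (ℝ × ℝ) C) (v : ℝ × ℝ → Vec m) : Prop where
  young : IsYoungMeasureOf U C f T ρ μ κ
  initial_prob : IsProbabilityMeasure ρ
  initial_valued : IsValuedIn C ρ
  prob : ∀ t ∈ Ico 0 T, IsProbabilityMeasure (μ t)
  valued : ∀ t ∈ Ico 0 T, IsValuedIn C (μ t)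
  lipschitz : ∃ K : ℝ≥0, LipschitzWith K v
  mem : ∀ p, v p ∈ C
  periodic : ∀ t x, v (t, x + 1) = v (t, x)

/-- The residual of `v`. -/
noncomputable def residualAt (f : Vec m → Vec m) (v : ℝ × ℝ → Vec m) (p : ℝ × ℝ) : Vec m :=
  lineDeriv ℝ v p (1, 0) + fderiv ℝ f (v p) (lineDeriv ℝ v p (0, 1))

/-- The bound on the production of relative entropy. -/
noncomputable def productionBound (cf cu : ℝ) (f : Vec m → Vec m) (v : ℝ × ℝ → Vec m)
    (κ : Kernel (ℝ × ℝ) C) (p : ℝ × ℝ) : ℝ :=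
  1 / 2 * ‖residualAt f v p‖ ^ 2 +
    1 / 2 * (cu ^ 2 + cu * cf * ‖lineDeriv ℝ v p (0, 1)‖) * meanSqDist v κ p

/-- Expanding the square leaves the second moment and the barycenter of `κ`. These are measurable in
space-time, and they are exactly the quantities for which duality with `μ` is known. -/
lemma meanSqDist_eq [IsMarkovKernel κ] (hC : IsCompact C) (p : ℝ × ℝ) :
    meanSqDist v κ p = ∫ ξ : C, ‖(ξ : Vec m)‖ ^ 2 ∂κ p - 2 * inner ℝ (barycenter κ p) (v p) +
      ‖v p‖ ^ 2 := by
  have i1 : Integrable (fun ξ : C => ‖(ξ : Vec m)‖ ^ 2) (κ p) :=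
    hC.integrable_subtype (h := fun ξ => ‖ξ‖ ^ 2) (by fun_prop) _
  have i2 : Integrable (fun ξ : C => (ξ : Vec m)) (κ p) :=
    hC.integrable_subtype (h := fun ξ => ξ) continuousOn_id _
  have h1 : ∀ ξ : C, ‖(ξ : Vec m) - v p‖ ^ 2 =
      ‖(ξ : Vec m)‖ ^ 2 - 2 * inner ℝ (v p) (ξ : Vec m) + ‖v p‖ ^ 2 := fun ξ => by
    rw [norm_sub_sq_real, real_inner_comm]
  simp_rw [meanSqDist, h1]
  have i3 : Integrable (fun ξ : C => ‖(ξ : Vec m)‖ ^ 2 - 2 * inner ℝ (v p) (ξ : Vec m)) (κ p) :=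
    i1.sub ((i2.const_inner _).const_mul 2)
  rw [integral_add i3 (integrable_const _),
    integral_sub i1 ((i2.const_inner _).const_mul 2), integral_const_mul, integral_inner i2,
    real_inner_comm]
  simp [barycenter]

namespace IsComparison

variable {ρ : Measure (L2Fun m)} {μ : ℝ → Measure (L2Fun m)}

lemma continuous (h : IsComparison U C f T ρ μ κ v) : Continuous v :=
  h.lipschitz.choose_spec.continuous

lemma isBddMeasurable (h : IsComparison U C f T ρ μ κ v) (hC : IsCompact C) :
    IsBddMeasurable v :=
  IsBddMeasurable.comp_of_mem hC (G := fun ξ => ξ) continuousOn_id h.continuous h.mem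

lemma isBddMeasurable_barycenter (h : IsComparison U C f T ρ μ κ v) (hC : IsCompact C) :
    IsBddMeasurable (barycenter κ) :=
  have := h.young.markov
  IsBddMeasurable.integral_kernel hC (G := fun ξ => ξ) continuousOn_id κ

lemma isBddMeasurable_lineDeriv (h : IsComparison U C f T ρ μ κ v) (e : ℝ × ℝ) :
    IsBddMeasurable fun p => lineDeriv ℝ v p e :=
  IsBddMeasurable.lineDeriv h.lipschitz.choose_spec e

lemma isBddMeasurable_meanSqDist (h : IsComparison U C f T ρ μ κ v) (hC : IsCompact C) :
    IsBddMeasurable (meanSqDist v κ) := by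
  have := h.young.markov
  have h1 : meanSqDist v κ = fun p => ∫ ξ : C, ‖(ξ : Vec m)‖ ^ 2 ∂κ p -
      2 * inner ℝ (barycenter κ p) (v p) + ‖v p‖ ^ 2 := funext fun p => meanSqDist_eq hC p
  rw [h1]
  have h2 := IsBddMeasurable.integral_kernel hC (G := fun ξ => ‖ξ‖ ^ 2) (by fun_prop) κ
  exact (h2.sub ((IsBddMeasurable.const 2).mul
    ((h.isBddMeasurable_barycenter hC).inner (h.isBddMeasurable hC)))).add
    (h.isBddMeasurable hC).sq_norm

lemma isBddMeasurable_linearizedEntropy (h : IsComparison U C f T ρ μ κ v) (hU : IsOpen U)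
    (hC : IsCompact C) (hCU : C ⊆ U) (hpair : IsEntropyPair U f η q) :
    IsBddMeasurable (linearizedEntropy η v κ) :=
  have hη := hpair.entropy_contDiffOn
  (IsBddMeasurable.comp_of_mem hC (hη.continuousOn.mono hCU) h.continuous h.mem).add
    ((IsBddMeasurable.comp_of_mem hC ((hη.contDiffOn_one_fderiv hU).continuousOn.mono hCU)
      h.continuous h.mem).clm_apply
      ((h.isBddMeasurable_barycenter hC).sub (h.isBddMeasurable hC)))

lemma isBddMeasurable_entropyProduction (h : IsComparison U C f T ρ μ κ v) (hU : IsOpen U)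
    (hC : IsCompact C) (hCU : C ⊆ U) (hpair : IsEntropyPair U f η q) :
    IsBddMeasurable (entropyProduction f η v κ) := by
  have := h.young.markov
  have hη := hpair.entropy_contDiffOn
  have hf := hpair.flux_contDiffOn.continuousOn.mono hCU
  have h1 : IsBddMeasurable fun p => fderiv ℝ (fderiv ℝ η) (v p) :=
    IsBddMeasurable.comp_of_mem (E := Vec m →L[ℝ] Vec m →L[ℝ] ℝ) hC
      ((hη.continuousOn_fderiv_fderiv hU).mono hCU) h.continuous h.mem
  have h2 : IsBddMeasurable (fluxMean f κ) := IsBddMeasurable.integral_kernel hC hf κ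
  have h3 : IsBddMeasurable fun p => f (v p) :=
    IsBddMeasurable.comp_of_mem hC hf h.continuous h.mem
  exact ((h1.clm_apply (h.isBddMeasurable_lineDeriv (1, 0))).clm_apply
    ((h.isBddMeasurable_barycenter hC).sub (h.isBddMeasurable hC))).add
    ((h1.clm_apply (h.isBddMeasurable_lineDeriv (0, 1))).clm_apply (h2.sub h3))

lemma isBddMeasurable_residualAt (h : IsComparison U C f T ρ μ κ v) (hU : IsOpen U)
    (hC : IsCompact C) (hCU : C ⊆ U) (hpair : IsEntropyPair U f η q) :
    IsBddMeasurable (residualAt f v) :=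
  have hf := (hpair.flux_contDiffOn.contDiffOn_one_fderiv hU).continuousOn.mono hCU
  (h.isBddMeasurable_lineDeriv (1, 0)).add
    ((IsBddMeasurable.comp_of_mem hC hf h.continuous h.mem).clm_apply
      (h.isBddMeasurable_lineDeriv (0, 1)))

lemma isBddMeasurable_productionBound (h : IsComparison U C f T ρ μ κ v) (hU : IsOpen U)
    (hC : IsCompact C) (hCU : C ⊆ U) (hpair : IsEntropyPair U f η q) (cf cu : ℝ) :
    IsBddMeasurable (productionBound cf cu f v κ) :=
  ((IsBddMeasurable.const _).mul (h.isBddMeasurable_residualAt hU hC hCU hpair).sq_norm).add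
    (((IsBddMeasurable.const _).mul ((IsBddMeasurable.const _).add
      ((IsBddMeasurable.const _).mul (h.isBddMeasurable_lineDeriv (0, 1)).norm))).mul
      (h.isBddMeasurable_meanSqDist hC))

lemma isBddMeasurable_meanEntropy (h : IsComparison U C f T ρ μ κ v)
    (hC : IsCompact C) (hCU : C ⊆ U) (hpair : IsEntropyPair U f η q) :
    IsBddMeasurable fun p => ∫ ξ : C, η ξ ∂κ p :=
  have := h.young.markov
  IsBddMeasurable.integral_kernel hC (hpair.entropy_contDiffOn.continuousOn.mono hCU) κ

/-- Averaging the pointwise lower bound is legitimate because the linearized entropy is affine in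
the barycenter; this is where strict convexity turns entropy into distance. -/
lemma le_meanEntropy_sub {cf cl cu : ℝ} (h : IsComparison U C f T ρ μ κ v) (hU : IsOpen U)
    (hC : Convex ℝ C) (hCc : IsCompact C) (hCU : C ⊆ U) (hpair : IsEntropyPair U f η q)
    (hb : HessianBounds C f η cf cl cu)
    (hpos : ∀ v ∈ C, ∀ w, w ≠ 0 → 0 < fderiv ℝ (fderiv ℝ η) v w w) (p : ℝ × ℝ) :
    cl / 2 * meanSqDist v κ p ≤ ∫ ξ : C, η ξ ∂κ p - linearizedEntropy η v κ p := by
  have := h.young.markov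
  have i1 : Integrable (fun ξ : C => (ξ : Vec m) - v p) (κ p) :=
    hCc.integrable_subtype (h := fun ξ => ξ - v p) (by fun_prop) _
  have i2 : Integrable (fun ξ : C => η ξ) (κ p) :=
    hCc.integrable_subtype (hpair.entropy_contDiffOn.continuousOn.mono hCU) _
  have i3 : Integrable (fun ξ : C => ‖(ξ : Vec m) - v p‖ ^ 2) (κ p) :=
    hCc.integrable_subtype (h := fun ξ => ‖ξ - v p‖ ^ 2) (by fun_prop) _
  have i4 := (fderiv ℝ η (v p)).integrable_comp i1
  have h1 : barycenter κ p - v p = ∫ ξ : C, ((ξ : Vec m) - v p) ∂κ p := by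
    rw [integral_sub (hCc.integrable_subtype (h := fun ξ => ξ) continuousOn_id _)
      (integrable_const _)]
    simp [barycenter]
  have h2 : linearizedEntropy η v κ p =
      ∫ ξ : C, (η (v p) + fderiv ℝ η (v p) ((ξ : Vec m) - v p)) ∂κ p := by
    rw [linearizedEntropy, h1, ← ContinuousLinearMap.integral_comp_comm _ i1,
      integral_add (integrable_const _) i4]
    simp
  have i5 : Integrable (fun ξ : C => η (v p) + fderiv ℝ η (v p) ((ξ : Vec m) - v p)) (κ p) :=
    (integrable_const _).add i4
  rw [h2, ← integral_sub i2 i5, meanSqDist, ← integral_const_mul]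
  refine integral_mono (i3.const_mul _) (i2.sub i5) fun ξ => ?_
  have := hb.le_relEntropy hU hC hCU hpair hpos ξ.2 (h.mem p)
  simp only [relEntropy] at this
  simp only
  linarith

end IsComparison

end Comparison

/-! ### Stability in terms of Young measures -/

section Stability

variable {m : ℕ} {U C : Set (Vec m)} {f : Vec m → Vec m} {η q : Vec m → ℝ} {T : ℝ}
  {ι : Type*} [Fintype ι] {w : ι → ℝ} {ρ : ι → Measure (L2Fun m)}
  {μs : ι → ℝ → Measure (L2Fun m)} {κ : ι → Kernel (ℝ × ℝ) C} {v : ι → ℝ × ℝ → Vec m}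
  {μbar : Measure (L2Fun m)} {μ : ℝ → Measure (L2Fun m)}

lemma integral_sum_smul_measure {α : Type*} [MeasurableSpace α] {ν : ι → Measure α}
    (hw : ∀ i, 0 ≤ w i) {g : α → ℝ} (hg : ∀ i, Integrable g (ν i)) :
    ∫ a, g a ∂(∑ i, ENNReal.ofReal (w i) • ν i) = ∑ i, w i * ∫ a, g a ∂ν i := by
  rw [integral_finsetSum_measure fun i _ => (hg i).smul_measure ENNReal.ofReal_ne_top]
  refine Finset.sum_congr rfl fun i _ => ?_
  rw [integral_smul_measure, ENNReal.toReal_ofReal (hw i), smul_eq_mul]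

lemma setIntegral_sum_mul_integral {g : ι → ℝ × ℝ → ℝ} (hg : ∀ i, IsBddMeasurable (g i))
    (w : ι → ℝ) (T : ℝ) :
    ∫ t in Ioo 0 T, ∑ i, w i * ∫ x in unitDomain, g i (t, x) =
      ∑ i, w i * ∫ p, g i p ∂cylMeasure T := by
  rw [integral_finsetSum _ fun i _ => ((hg i).integrable_integral_slice T).const_mul (w i)]
  exact Finset.sum_congr rfl fun i _ => by rw [integral_const_mul, (hg i).setIntegral_cylMeasure]

/-- The weighted mean of the relative entropies. -/
noncomputable def totalRelEntropy (η : Vec m → ℝ) (w : ι → ℝ) (v : ι → ℝ × ℝ → Vec m)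
    (κ : ι → Kernel (ℝ × ℝ) C) (t : ℝ) : ℝ :=
  ∑ i, w i * ∫ x in unitDomain, (∫ ξ : C, η ξ ∂κ i (t, x) - linearizedEntropy η (v i) (κ i) (t, x))

/-- The entropy inequality of the mixture bounds the weighted sum of the nonlinear terms, and the
affine terms of every component are known exactly from its balance. Their difference is the relative
entropy, so no entropy inequality for a single component is required. -/
lemma totalRelEntropy_inequality {cf cl cu : ℝ} (hU : IsOpen U) (hC : Convex ℝ C)
    (hCc : IsCompact C) (hCU : C ⊆ U) (hpair : IsEntropyPair U f η q)
    (hb : HessianBounds C f η cf cl cu)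
    (hpos : ∀ v ∈ C, ∀ w, w ≠ 0 → 0 < fderiv ℝ (fderiv ℝ η) v w w) (hT : 0 < T)
    (hw : ∀ i, 0 ≤ w i) (hcomp : ∀ i, IsComparison U C f T (ρ i) (μs i) (κ i) (v i))
    (hμ : ∀ t ∈ Ico 0 T, ∑ i, ENNReal.ofReal (w i) • μs i t = μ t)
    (hμbar : ∑ i, ENNReal.ofReal (w i) • ρ i = μbar)
    (hent : ∀ φ : ℝ × ℝ → ℝ, IsNonnegTestFunction T φ →
      0 ≤ (∫ t in Ioo 0 T, ∫ u, (∫ x in unitDomain,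
        (η (u x) * deriv (fun τ => φ (τ, x)) t + q (u x) * deriv (fun y => φ (t, y)) x)) ∂(μ t)) +
      ∫ u, (∫ x in unitDomain, η (u x) * φ (0, x)) ∂μbar)
    {T' : ℝ} (hT' : T' < T) {θ : ℝ → ℝ} (hθ : ContDiff ℝ ((⊤ : ℕ∞) : WithTop ℕ∞) θ)
    (hθL : ∃ L : ℝ≥0, LipschitzWith L θ) (hθ0 : ∀ t, 0 ≤ θ t) (hθ1 : ∀ t, θ t ≤ 1)
    (hsupp : ∀ t, T' ≤ t → θ t = 0) :
    0 ≤ (∫ t in Ioo 0 T, deriv θ t * totalRelEntropy η w v κ t) +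
      θ 0 * (cu / 2 * ∑ i, w i * ∫ u, (∫ x in unitDomain, ‖u x - v i (0, x)‖ ^ 2) ∂ρ i) +
      ∫ t in Ioo 0 T, θ t *
        ∑ i, w i * ∫ x in unitDomain, productionBound cf cu f (v i) (κ i) (t, x) := by
  obtain ⟨Lθ, hLθ⟩ := hθL
  have hη := hpair.entropy_contDiffOn
  obtain ⟨Kη, hKη⟩ := ContDiffOn.exists_lipschitzOnWith_of_convex_isCompact hU
    (hη.of_le (by norm_num)) hC hCc hCU
  have hθd : Differentiable ℝ θ := hθ.differentiable (by norm_num)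
  have hθ' : Continuous (deriv θ) := hθ.continuous_deriv (by norm_num)
  have bθ : IsBddMeasurable fun p : ℝ × ℝ => θ p.1 :=
    ⟨(hθ.continuous.comp continuous_fst).stronglyMeasurable, 1, fun p => by
      rw [Real.norm_of_nonneg (hθ0 _)]; exact hθ1 _⟩
  have bθ' : IsBddMeasurable fun p : ℝ × ℝ => deriv θ p.1 :=
    ⟨(hθ'.comp continuous_fst).stronglyMeasurable, Lθ, fun p => norm_deriv_le_of_lipschitz hLθ⟩
  have bN := fun i => (hcomp i).isBddMeasurable_meanEntropy hCc hCU hpair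
  have bl := fun i => (hcomp i).isBddMeasurable_linearizedEntropy hU hCc hCU hpair
  have bp := fun i => (hcomp i).isBddMeasurable_entropyProduction hU hCc hCU hpair
  have bb := fun i => (hcomp i).isBddMeasurable_productionBound hU hCc hCU hpair cf cu
  have hS : ∀ᵐ t ∂(volume.restrict (Ioo 0 T)), ∫ u, (∫ x in unitDomain, η (u x)) ∂(μ t) =
      ∑ i, w i * ∫ x in unitDomain, ∫ ξ : C, η ξ ∂κ i (t, x) := by
    have := ae_all_iff.2 fun i => (hcomp i).young.dual η hη.continuousOn
    filter_upwards [this, ae_restrict_mem measurableSet_Ioo] with t ht htm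
    have htm' := Ioo_subset_Ico_self htm
    rw [← hμ t htm', integral_sum_smul_measure hw fun i => ?_]
    · exact Finset.sum_congr rfl fun i _ => by rw [ht i]
    · have := (hcomp i).prob t htm'
      exact ((hcomp i).valued t htm').integrable_integral_comp hCc hKη
  have hS0 : ∫ u, (∫ x in unitDomain, η (u x)) ∂μbar =
      ∑ i, w i * ∫ u, (∫ x in unitDomain, η (u x)) ∂ρ i := by
    rw [← hμbar, integral_sum_smul_measure hw fun i => ?_]
    have := (hcomp i).initial_prob
    exact (hcomp i).initial_valued.integrable_integral_comp hCc hKη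
  -- A test function constant in space makes the entropy flux disappear.
  have e0 := hent (fun p => θ p.1) ⟨hθ.comp contDiff_fst, fun _ _ => rfl,
    ⟨T', hT', fun t ht _ => hsupp t ht⟩, fun t _ _ => hθ0 t⟩
  have e1 : (∫ t in Ioo 0 T, ∫ u, (∫ x in unitDomain,
      (η (u x) * deriv (fun τ => θ τ) t + q (u x) * deriv (fun _ : ℝ => θ t) x)) ∂(μ t)) =
      ∑ i, w i * ∫ p, deriv θ p.1 * ∫ ξ : C, η ξ ∂κ i p ∂cylMeasure T := by
    rw [← setIntegral_sum_mul_integral (fun i => bθ'.mul (bN i))]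
    refine integral_congr_ae ?_
    filter_upwards [hS] with t ht
    simp only [deriv_const, mul_zero, add_zero, integral_mul_const, ht, Finset.sum_mul]
    refine Finset.sum_congr rfl fun i _ => ?_
    rw [integral_const_mul]; ring
  have e2 : ∫ u, (∫ x in unitDomain, η (u x) * θ 0) ∂μbar =
      θ 0 * ∑ i, w i * ∫ u, (∫ x in unitDomain, η (u x)) ∂ρ i := by
    simp_rw [integral_mul_const]
    rw [hS0, mul_comm]
  rw [e1, e2] at e0
  have e3 : (∫ t in Ioo 0 T, deriv θ t * totalRelEntropy η w v κ t) =
      ∑ i, w i * (∫ p, deriv θ p.1 * ∫ ξ : C, η ξ ∂κ i p ∂cylMeasure T -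
        ∫ p, deriv θ p.1 * linearizedEntropy η (v i) (κ i) p ∂cylMeasure T) := by
    simp_rw [← integral_sub ((bθ'.mul (bN _)).integrable _) ((bθ'.mul (bl _)).integrable _),
      ← mul_sub]
    rw [← setIntegral_sum_mul_integral (fun i => bθ'.mul ((bN i).sub (bl i)))]
    refine integral_congr_ae (Eventually.of_forall fun t => ?_)
    simp only [totalRelEntropy, Finset.mul_sum]
    refine Finset.sum_congr rfl fun i _ => ?_
    rw [integral_const_mul]; ring
  have e4 : (∫ t in Ioo 0 T, θ t *
      ∑ i, w i * ∫ x in unitDomain, productionBound cf cu f (v i) (κ i) (t, x)) =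
      ∑ i, w i * ∫ p, θ p.1 * productionBound cf cu f (v i) (κ i) p ∂cylMeasure T := by
    rw [← setIntegral_sum_mul_integral (fun i => bθ.mul (bb i))]
    refine integral_congr_ae (Eventually.of_forall fun t => ?_)
    simp only [Finset.mul_sum]
    refine Finset.sum_congr rfl fun i _ => ?_
    rw [integral_const_mul]; ring
  -- For one component: the balance replaces the linearized entropy by the production and the
  -- initial linearization, and adding the initial entropy leaves an initial relative entropy,
  -- bounded by the square distance.
  have e5 : ∀ i, (∫ p, deriv θ p.1 * linearizedEntropy η (v i) (κ i) p ∂cylMeasure T) +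
      θ 0 * ∫ u, (∫ x in unitDomain, η (u x)) ∂ρ i ≤
      θ 0 * (cu / 2 * ∫ u, (∫ x in unitDomain, ‖u x - v i (0, x)‖ ^ 2) ∂ρ i) +
      ∫ p, θ p.1 * productionBound cf cu f (v i) (κ i) p ∂cylMeasure T := fun i => by
    have hi := hcomp i
    have := hi.young.markov
    have := hi.initial_prob
    obtain ⟨K, hK⟩ := hi.lipschitz
    have h1 := hi.young.entropy_balance hU hC hCc hCU hpair hi.initial_valued hK hi.mem
      hi.periodic hT hθd hLθ (fun t => by rw [abs_of_nonneg (hθ0 t)]; exact hθ1 t) hT' hsupp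
    rw [integral_add ((bθ'.mul (bl i)).integrable _) ((bθ.mul (bp i)).integrable _)] at h1
    have h2 := hb.initial_relEntropy_le hU hC hCc hCU hpair hpos hi.initial_valued
      hi.initial_prob (hi.continuous.comp (by fun_prop : Continuous fun x : ℝ => ((0 : ℝ), x)))
      fun x => hi.mem _
    have h3 : -∫ p, θ p.1 * entropyProduction f η (v i) (κ i) p ∂cylMeasure T ≤
        ∫ p, θ p.1 * productionBound cf cu f (v i) (κ i) p ∂cylMeasure T := by
      rw [← integral_neg]
      refine integral_mono ((bθ.mul (bp i)).integrable _).neg ((bθ.mul (bb i)).integrable _)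
        fun p => ?_
      have := hb.abs_entropyProduction_le (κ := κ i) hU hC hCc hCU hpair hpos hi.mem p
      simp only [← mul_neg]
      exact mul_le_mul_of_nonneg_left ((neg_le_abs _).trans this) (hθ0 _)
    have h4 := mul_le_mul_of_nonneg_left h2 (hθ0 0)
    simp only [Function.comp_apply] at h4
    linarith
  rw [e3, e4]
  have e6 := Finset.sum_le_sum fun i (_ : i ∈ Finset.univ) =>
    mul_le_mul_of_nonneg_left (e5 i) (hw i)
  simp only [mul_add, Finset.sum_add_distrib] at e6
  simp only [mul_sub, Finset.sum_sub_distrib]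
  have e7 : ∑ i, w i * (θ 0 * ∫ u, (∫ x in unitDomain, η (u x)) ∂ρ i) =
      θ 0 * ∑ i, w i * ∫ u, (∫ x in unitDomain, η (u x)) ∂ρ i := by
    rw [Finset.mul_sum]; exact Finset.sum_congr rfl fun i _ => by ring
  have e8 : ∑ i, w i * (θ 0 * (cu / 2 * ∫ u, (∫ x in unitDomain, ‖u x - v i (0, x)‖ ^ 2) ∂ρ i)) =
      θ 0 * (cu / 2 * ∑ i, w i * ∫ u, (∫ x in unitDomain, ‖u x - v i (0, x)‖ ^ 2) ∂ρ i) := by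
    rw [Finset.mul_sum, Finset.mul_sum]; exact Finset.sum_congr rfl fun i _ => by ring
  rw [e7, e8] at e6
  linarith

/-- The weighted mean square distance at time `t`. -/
noncomputable def totalSqDist (w : ι → ℝ) (v : ι → ℝ × ℝ → Vec m)
    (κ : ι → Kernel (ℝ × ℝ) C) (t : ℝ) : ℝ :=
  ∑ i, w i * ∫ x in unitDomain, meanSqDist (v i) (κ i) (t, x)

/-- The weighted residual on `(0,s)`. -/
noncomputable def totalResidual (f : Vec m → Vec m) (w : ι → ℝ) (v : ι → ℝ × ℝ → Vec m)
    (s : ℝ) : ℝ :=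
  ∑ i, w i * ∫ p, ‖residualAt f (v i) p‖ ^ 2 ∂cylMeasure s

/-- The slope bound `L` is allowed to depend on `s`, so it is quantified after the exceptional null
set of times has been fixed. -/
theorem ae_totalSqDist_le {cf cl cu : ℝ} (hU : IsOpen U) (hC : Convex ℝ C)
    (hCc : IsCompact C) (hCU : C ⊆ U) (hpair : IsEntropyPair U f η q)
    (hb : HessianBounds C f η cf cl cu)
    (hpos : ∀ v ∈ C, ∀ w, w ≠ 0 → 0 < fderiv ℝ (fderiv ℝ η) v w w) (hT : 0 < T)
    (hw : ∀ i, 0 ≤ w i) (hcomp : ∀ i, IsComparison U C f T (ρ i) (μs i) (κ i) (v i))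
    (hμ : ∀ t ∈ Ico 0 T, ∑ i, ENNReal.ofReal (w i) • μs i t = μ t)
    (hμbar : ∑ i, ENNReal.ofReal (w i) • ρ i = μbar)
    (hent : ∀ φ : ℝ × ℝ → ℝ, IsNonnegTestFunction T φ →
      0 ≤ (∫ t in Ioo 0 T, ∫ u, (∫ x in unitDomain,
        (η (u x) * deriv (fun τ => φ (τ, x)) t + q (u x) * deriv (fun y => φ (t, y)) x)) ∂(μ t)) +
      ∫ u, (∫ x in unitDomain, η (u x) * φ (0, x)) ∂μbar)
    {T' : ℝ} (hT' : T' < T) :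
    ∀ᵐ s ∂(volume.restrict (Ioo 0 T')), ∀ L : ℝ, 0 ≤ L →
      (∀ i, ∀ᵐ p ∂cylMeasure s, ‖lineDeriv ℝ (v i) p (0, 1)‖ ≤ L) →
      totalSqDist w v κ s ≤ (totalResidual f w v s +
        cu * ∑ i, w i * ∫ u, (∫ x in unitDomain, ‖u x - v i (0, x)‖ ^ 2) ∂ρ i) / cl *
        Real.exp ((cu ^ 2 + cu * cf * L) / cl * s) := by
  have hcu : 0 ≤ cu := hb.cl_pos.le.trans hb.cl_le_cu
  have hcl := hb.cl_pos
  have hcf := hb.cf_nonneg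
  set G₀ := ∑ i, w i * ∫ u, (∫ x in unitDomain, ‖u x - v i (0, x)‖ ^ 2) ∂ρ i with hG₀
  have bN := fun i => (hcomp i).isBddMeasurable_meanEntropy hCc hCU hpair
  have bl := fun i => (hcomp i).isBddMeasurable_linearizedEntropy hU hCc hCU hpair
  have bb := fun i => (hcomp i).isBddMeasurable_productionBound hU hCc hCU hpair cf cu
  have bm := fun i => (hcomp i).isBddMeasurable_meanSqDist hCc
  have bR := fun i => ((hcomp i).isBddMeasurable_residualAt hU hCc hCU hpair).sq_norm
  have hmnn : ∀ i p, 0 ≤ meanSqDist (v i) (κ i) p := fun i p =>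
    integral_nonneg fun ξ => sq_nonneg _
  have hGle : ∀ t, cl / 2 * totalSqDist w v κ t ≤ totalRelEntropy η w v κ t := fun t => by
    rw [totalSqDist, totalRelEntropy, Finset.mul_sum]
    refine Finset.sum_le_sum fun i _ => ?_
    rw [mul_left_comm, ← integral_const_mul]
    refine mul_le_mul_of_nonneg_left ?_ (hw i)
    exact integral_mono ((bm i).integrable_slice t |>.const_mul _)
      (((bN i).sub (bl i)).integrable_slice t)
      fun x => (hcomp i).le_meanEntropy_sub hU hC hCc hCU hpair hb hpos _
  have hGint : ∀ s, IntegrableOn (totalSqDist w v κ) (Ioo 0 s) := fun s =>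
    integrable_finsetSum _ fun i _ => ((bm i).integrable_integral_slice s).const_mul (w i)
  have hloc := ae_le_of_forall_smooth_cutoff (E := totalRelEntropy η w v κ)
    (r := fun t => ∑ i, w i * ∫ x in unitDomain, productionBound cf cu f (v i) (κ i) (t, x))
    (E₀ := cu / 2 * G₀) hT'
    (integrable_finsetSum _ fun i _ =>
      (((bN i).sub (bl i)).integrable_integral_slice T).const_mul (w i))
    (integrable_finsetSum _ fun i _ => ((bb i).integrable_integral_slice T).const_mul (w i))
    (fun θ h1 h2 h3 h4 h5 => totalRelEntropy_inequality hU hC hCc hCU hpair hb hpos hT hw hcomp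
      hμ hμbar hent hT' h1 h2 h3 h4 h5)
  have hloc' := (ae_restrict_iff' measurableSet_Ioo).1 hloc
  filter_upwards [hloc, ae_restrict_mem measurableSet_Ioo] with s hs hsm L hL0 hL
  -- The final time `s` is frozen: the residual on `(0,t)` is at most that on `(0,s)`, and `L`
  -- bounds the slope on all of `(0,s)`, so the coefficients in Gronwall's inequality are constants.
  have hprod : ∀ t ∈ Ioc 0 s, ∫ τ in Ioo 0 t, ∑ i, w i * ∫ x in unitDomain,
      productionBound cf cu f (v i) (κ i) (τ, x) ≤ 1 / 2 * totalResidual f w v s +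
      1 / 2 * (cu ^ 2 + cu * cf * L) * ∫ τ in Ioo 0 t, totalSqDist w v κ τ := fun t ht => by
    rw [integral_finsetSum _ fun i _ => ((bb i).integrable_integral_slice t).const_mul (w i)]
    simp only [totalSqDist, totalResidual]
    rw [integral_finsetSum _ fun i _ => ((bm i).integrable_integral_slice t).const_mul (w i),
      Finset.mul_sum, Finset.mul_sum, ← Finset.sum_add_distrib]
    refine Finset.sum_le_sum fun i _ => ?_
    rw [integral_const_mul, integral_const_mul, ← (bb i).setIntegral_cylMeasure,
      ← (bm i).setIntegral_cylMeasure, mul_left_comm, mul_left_comm _ (w i), ← mul_add]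
    refine mul_le_mul_of_nonneg_left ?_ (hw i)
    have hle : cylMeasure t ≤ cylMeasure s := by
      rw [cylMeasure, cylMeasure, Measure.prod_restrict, Measure.prod_restrict]
      exact Measure.restrict_mono (prod_mono (Ioo_subset_Ioo_right ht.2) le_rfl) le_rfl
    have h1 : ∫ p, ‖residualAt f (v i) p‖ ^ 2 ∂cylMeasure t ≤
        ∫ p, ‖residualAt f (v i) p‖ ^ 2 ∂cylMeasure s :=
      integral_mono_measure hle (Eventually.of_forall fun p => sq_nonneg _) ((bR i).integrable _)
    calc ∫ p, productionBound cf cu f (v i) (κ i) p ∂cylMeasure t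
        ≤ ∫ p, (1 / 2 * ‖residualAt f (v i) p‖ ^ 2 +
          1 / 2 * (cu ^ 2 + cu * cf * L) * meanSqDist (v i) (κ i) p) ∂cylMeasure t := by
          refine integral_mono_ae ((bb i).integrable _)
            (((bR i).integrable _).const_mul _ |>.add (((bm i).integrable _).const_mul _)) ?_
          filter_upwards [hle.absolutelyContinuous.ae_le (hL i)] with p hp
          simp only [productionBound]
          gcongr
          exact hmnn i p
      _ = 1 / 2 * ∫ p, ‖residualAt f (v i) p‖ ^ 2 ∂cylMeasure t +
          1 / 2 * (cu ^ 2 + cu * cf * L) * ∫ p, meanSqDist (v i) (κ i) p ∂cylMeasure t := by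
          rw [integral_add (((bR i).integrable _).const_mul _)
            (((bm i).integrable _).const_mul _), integral_const_mul, integral_const_mul]
      _ ≤ _ := by linarith
  have hkey : ∀ t ∈ Ioc 0 s, totalRelEntropy η w v κ t ≤ cu / 2 * G₀ + ∫ τ in Ioo 0 t,
      ∑ i, w i * ∫ x in unitDomain, productionBound cf cu f (v i) (κ i) (τ, x) →
      totalSqDist w v κ t ≤ (totalResidual f w v s + cu * G₀) / cl +
        (cu ^ 2 + cu * cf * L) / cl * ∫ τ in Ioo 0 t, totalSqDist w v κ τ := fun t ht h => by
    -- Multiplying by `2 / cl` cancels the halves from the lower bound, the initial term and the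
    -- production.
    have h1 := (hGle t).trans (h.trans (add_le_add_right (hprod t ht) _))
    have h2 : (totalResidual f w v s + cu * G₀) / cl +
        (cu ^ 2 + cu * cf * L) / cl * ∫ τ in Ioo 0 t, totalSqDist w v κ τ =
        (totalResidual f w v s + cu * G₀ +
        (cu ^ 2 + cu * cf * L) * ∫ τ in Ioo 0 t, totalSqDist w v κ τ) / cl := by ring
    rw [h2, le_div_iff₀ hcl]
    linarith
  refine gronwall_of_ae_le hsm.1 (by positivity) (hGint s) ?_ (hkey s ⟨hsm.1, le_rfl⟩ hs)
  rw [ae_restrict_iff' measurableSet_Ioo]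
  filter_upwards [hloc'] with t ht htm
  exact hkey t ⟨htm.1, htm.2.le⟩ (ht ⟨htm.1, htm.2.trans hsm.2⟩)

end Stability

/-! ### Reconstructions -/

section Reconstructions

variable {m : ℕ} {U C : Set (Vec m)} {f : Vec m → Vec m} {η q : Vec m → ℝ} {T T' : ℝ}

lemma toL2_of_continuous {g : ℝ → Vec m} (hg : Continuous g) :
    toL2 g = (hg.memLp_unitDomain 2).toLp g :=
  dif_pos _

/-- The mean square distance of `μ` to `v` in terms of the Young measure of `μ`. -/
lemma IsComparison.ae_integral_norm_sub_toL2 {ρ : Measure (L2Fun m)} {μ : ℝ → Measure (L2Fun m)}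
    {κ : Kernel (ℝ × ℝ) C} {v : ℝ × ℝ → Vec m} (hC : IsCompact C)
    (h : IsComparison U C f T ρ μ κ v) :
    ∀ᵐ s ∂(volume.restrict (Ioo 0 T)), ∫ u, ‖u - toL2 fun x => v (s, x)‖ ^ 2 ∂μ s =
      ∫ x in unitDomain, meanSqDist v κ (s, x) := by
  have := h.young.markov
  filter_upwards [h.young.dual (fun ξ => ‖ξ‖ ^ 2) (by fun_prop), h.young.dual_inner,
    ae_restrict_mem measurableSet_Ioo] with s hs hs' hsm
  have hsm' := Ioo_subset_Ico_self hsm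
  have := h.prob s hsm'
  have hval := h.valued s hsm'
  have hc : Continuous fun x => v (s, x) := h.continuous.comp (by fun_prop)
  rw [toL2_of_continuous hc]
  set a : L2Fun m := (hc.memLp_unitDomain 2).toLp with ha
  have e0 : ∀ u : L2Fun m, ∫ x in unitDomain, ‖u x‖ ^ 2 = ‖u‖ ^ 2 := fun u => by
    have := integral_norm_sub_sq (MemLp.zero' (p := 2)) u
    rw [show (MemLp.zero' (p := 2) (μ := volume.restrict unitDomain)).toLp
      (fun _ : ℝ => (0 : Vec m)) = 0 from MemLp.toLp_zero _] at this
    simpa using this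
  simp_rw [e0] at hs
  have i1 : Integrable (fun u : L2Fun m => ‖u‖ ^ 2) (μ s) := by
    simpa using hval.integrable_norm_sub_sq hC 0
  have i2 : Integrable (fun u : L2Fun m => inner ℝ u a) (μ s) :=
    (hval.integrable_id hC).inner_const a
  have e1 : ∫ u, ‖u - a‖ ^ 2 ∂μ s =
      ∫ u, ‖u‖ ^ 2 ∂μ s - 2 * ∫ u, inner ℝ u a ∂μ s + ‖a‖ ^ 2 := by
    simp_rw [norm_sub_sq_real]
    have i3 : Integrable (fun u : L2Fun m => ‖u‖ ^ 2 - 2 * inner ℝ u a) (μ s) :=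
      i1.sub (i2.const_mul 2)
    rw [integral_add i3 (integrable_const _),
      integral_sub i1 (i2.const_mul 2), integral_const_mul]
    simp
  have j0 := h.isBddMeasurable hC
  have j1 := IsBddMeasurable.integral_kernel hC (G := fun ξ => ‖ξ‖ ^ 2) (by fun_prop) κ
  have j2 := (h.isBddMeasurable_barycenter hC).inner j0
  have j3 := j0.sq_norm
  have j4 := (j1.sub ((IsBddMeasurable.const (2 : ℝ)).mul j2)).integrable_slice s
  -- Here `a` is the reconstruction at the same time `s`, which is admissible because the null set
  -- in `dual_inner` is uniform in `a`.
  rw [e1, hs, hs' a]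
  simp_rw [meanSqDist_eq hC]
  rw [integral_add j4 (j3.integrable_slice s), integral_sub (j1.integrable_slice s)
    ((j2.integrable_slice s).const_mul 2), integral_const_mul]
  congr 1
  · congr 2
    refine integral_congr_ae ?_
    filter_upwards [(hc.memLp_unitDomain 2).coeFn_toLp] with x hx
    rw [ha, hx]
  · rw [← e0 a]
    refine integral_congr_ae ?_
    filter_upwards [(hc.memLp_unitDomain 2).coeFn_toLp] with x hx
    simp only [ha, hx]

/-- A continuous periodic function with values in a closed set almost everywhere on `D` has values
in this set everywhere. -/
lemma mem_of_ae_mem_unitDomain {g : ℝ → Vec m} (hg : Continuous g) (hp : Function.Periodic g 1)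
    (hC : IsClosed C) (h : ∀ᵐ x ∂((volume : Measure ℝ).restrict unitDomain), g x ∈ C) (x : ℝ) :
    g x ∈ C := by
  have h1 : ∀ y ∈ unitDomain, g y ∈ C := fun y hy => by
    by_contra hyC
    -- The bad points form an open null set, which must be empty.
    have ho : IsOpen (g ⁻¹' Cᶜ ∩ unitDomain) := (hC.isOpen_compl.preimage hg).inter isOpen_Ioo
    have h0 : volume (g ⁻¹' Cᶜ ∩ unitDomain) = 0 := by
      rw [← Measure.restrict_apply' measurableSet_Ioo]
      exact ae_iff.1 h
    exact ((ho.measure_eq_zero_iff volume).1 h0).subset ⟨hyC, hy⟩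
  obtain ⟨y, hy, hxy⟩ := hp.exists_mem_Ico₀ one_pos x
  rw [hxy, ← hC.closure_eq]
  refine map_mem_closure hg (s := unitDomain) ?_ h1
  rw [closure_Ioo zero_ne_one]
  exact Ico_subset_Icc_self hy

/-- The extension of a reconstruction from `[0,T']` to all times, constant in time outside
`[0,T']`. -/
noncomputable def clampExtension (T' : ℝ) (v : ℝ → ℝ → Vec m) (p : ℝ × ℝ) : Vec m :=
  v (max 0 (min p.1 T')) p.2

lemma clampExtension_of_mem {v : ℝ → ℝ → Vec m} {t : ℝ} (ht : t ∈ Icc 0 T') (x : ℝ) :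
    clampExtension T' v (t, x) = v t x := by
  simp [clampExtension, ht.1, ht.2]

lemma clamp_mem (hT' : T' ∈ Ioo 0 T) (t : ℝ) : max 0 (min t T') ∈ Ico 0 T :=
  ⟨le_max_left _ _, max_lt (hT'.1.trans hT'.2) ((min_le_right _ _).trans_lt hT'.2)⟩

/-- Test functions live on the whole plane, so the reconstruction is composed with the projection of
time onto `[0,T']`. This projection is `1`-Lipschitz, and `T' < T` keeps its values in the time
interval where the reconstruction is controlled. -/
lemma IsReconstruction.exists_lipschitzWith_clampExtension {v : ℝ → ℝ → Vec m}
    (hv : IsReconstruction T v) (hT' : T' ∈ Ioo 0 T) :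
    ∃ K : ℝ≥0, LipschitzWith K (clampExtension T' v) := by
  obtain ⟨c, hc⟩ := hv.lipschitz
  have h1 : LipschitzWith 1 fun p : ℝ × ℝ => (max 0 (min p.1 T'), p.2) := by
    have h2 := (((LipschitzWith.prod_fst (α := ℝ) (β := ℝ)).min_const T').const_max 0).prodMk
      LipschitzWith.prod_snd
    rwa [max_self] at h2
  have h2 : LipschitzOnWith (c * 1) ((fun p : ℝ × ℝ => v p.1 p.2) ∘
      fun p : ℝ × ℝ => (max 0 (min p.1 T'), p.2)) univ :=
    hc.comp h1.lipschitzOnWith fun p _ => ⟨clamp_mem hT' p.1, mem_univ _⟩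
  exact ⟨c * 1, lipschitzOnWith_univ.1 h2⟩

lemma IsReconstruction.clampExtension_periodic {v : ℝ → ℝ → Vec m} (hv : IsReconstruction T v)
    (hT' : T' ∈ Ioo 0 T) (t x : ℝ) :
    clampExtension T' v (t, x + 1) = clampExtension T' v (t, x) :=
  hv.periodic _ (clamp_mem hT' t) x

lemma IsReconstruction.continuous_slice {v : ℝ → ℝ → Vec m} (hv : IsReconstruction T v) {t : ℝ}
    (ht : t ∈ Ico 0 T) : Continuous (v t) := by
  obtain ⟨c, hc⟩ := hv.lipschitz
  exact hc.continuousOn.comp_continuous (f := fun x => (t, x)) (by fun_prop)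
    fun x => ⟨ht, mem_univ _⟩

lemma lineDeriv_clampExtension_time {v : ℝ → ℝ → Vec m} {t : ℝ} (ht : t ∈ Ioo 0 T') (x : ℝ) :
    lineDeriv ℝ (clampExtension T' v) (t, x) (1, 0) = deriv (fun τ => v τ x) t := by
  rw [lineDeriv_time]
  refine EventuallyEq.deriv_eq ?_
  filter_upwards [Ioo_mem_nhds ht.1 ht.2] with τ hτ
  exact clampExtension_of_mem (Ioo_subset_Icc_self hτ) x

lemma lineDeriv_clampExtension_space {v : ℝ → ℝ → Vec m} {t : ℝ} (ht : t ∈ Ioo 0 T') (x : ℝ) :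
    lineDeriv ℝ (clampExtension T' v) (t, x) (0, 1) = deriv (v t) x := by
  rw [lineDeriv_space]
  congr 1
  ext1 y
  exact clampExtension_of_mem (Ioo_subset_Icc_self ht) y

lemma ae_mem_cylMeasure (s : ℝ) : ∀ᵐ p ∂cylMeasure s, p.1 ∈ Ioo 0 s := by
  rw [cylMeasure, Measure.prod_restrict]
  filter_upwards [ae_restrict_mem (measurableSet_Ioo.prod measurableSet_Ioo)] with p hp
  exact hp.1

/-- Rademacher's theorem gives differentiability in space at almost every point, where the chain
rule identifies `Df(v) ∂ₓv` with `∂ₓ f(v)`. For times in `(0,s)` with `s ≤ T'`, the extension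
coincides with the reconstruction near the given time. -/
lemma IsReconstruction.ae_residualAt_clampExtension (hU : IsOpen U) (hCU : C ⊆ U)
    (hf : ContDiffOn ℝ 2 f U) {v : ℝ → ℝ → Vec m} (hv : IsReconstruction T v)
    (hT' : T' ∈ Ioo 0 T) (hvC : ∀ p, clampExtension T' v p ∈ C) {s : ℝ} (hs : s ≤ T') :
    ∀ᵐ p ∂cylMeasure s, residualAt f (clampExtension T' v) p = spaceTimeResidual f v p.1 p.2 := by
  obtain ⟨K, hK⟩ := hv.exists_lipschitzWith_clampExtension hT'
  filter_upwards [(cylMeasure_absolutelyContinuous s).ae_le (hK.ae_differentiableAt (μ := volume)),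
    ae_mem_cylMeasure s] with p hp hps
  obtain ⟨t, x⟩ := p
  have ht : t ∈ Ioo 0 T' := ⟨hps.1, hps.2.trans_le hs⟩
  have hvx : clampExtension T' v (t, x) = v t x :=
    clampExtension_of_mem (Ioo_subset_Icc_self ht) x
  have hd : DifferentiableAt ℝ (v t) x := by
    have h1 : v t = clampExtension T' v ∘ fun y => (t, y) := funext fun y =>
      (clampExtension_of_mem (Ioo_subset_Icc_self ht) y).symm
    rw [h1]
    exact DifferentiableAt.comp x hp (by fun_prop)
  have hfd : DifferentiableAt ℝ f (v t x) := by
    have := hvC (t, x)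
    rw [hvx] at this
    exact (hf.differentiableOn (by norm_num)).differentiableAt (hU.mem_nhds (hCU this))
  rw [residualAt, lineDeriv_clampExtension_time ht, lineDeriv_clampExtension_space ht, hvx,
    spaceTimeResidual]
  congr 1
  exact (fderiv_comp_deriv x hfd hd).symm

lemma IsReconstruction.integral_residualAt_clampExtension (hU : IsOpen U) (hCU : C ⊆ U)
    (hf : ContDiffOn ℝ 2 f U) {v : ℝ → ℝ → Vec m} (hv : IsReconstruction T v)
    (hT' : T' ∈ Ioo 0 T) (hvC : ∀ p, clampExtension T' v p ∈ C) {s : ℝ} (hs : s ≤ T')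
    (hb : IsBddMeasurable (residualAt f (clampExtension T' v))) :
    ∫ p, ‖residualAt f (clampExtension T' v) p‖ ^ 2 ∂cylMeasure s =
      ∫ t in Ioo 0 s, ∫ x in unitDomain, ‖spaceTimeResidual f v t x‖ ^ 2 := by
  rw [hb.sq_norm.setIntegral_cylMeasure]
  have := Measure.ae_ae_of_ae_prod
    (hv.ae_residualAt_clampExtension hU hCU hf hT' hvC hs)
  refine integral_congr_ae ?_
  filter_upwards [this] with t ht
  refine integral_congr_ae ?_
  filter_upwards [ht] with x hx
  simp only [hx]

lemma maxSpatialSlope_nonneg {K : ℕ} (v : Fin K → ℝ → ℝ → Vec m) (s : ℝ) :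
    0 ≤ maxSpatialSlope v s :=
  Real.iSup_nonneg fun _ => ENNReal.toReal_nonneg

lemma ae_norm_lineDeriv_le_maxSpatialSlope {K : ℕ} {v : Fin K → ℝ → ℝ → Vec m}
    (hv : ∀ k, IsReconstruction T (v k)) (hT' : T' ∈ Ioo 0 T) {s : ℝ} (hs : s ≤ T') (k : Fin K) :
    ∀ᵐ p ∂cylMeasure s, ‖lineDeriv ℝ (clampExtension T' (v k)) p (0, 1)‖ ≤
      maxSpatialSlope v s := by
  obtain ⟨c, hc⟩ := (hv k).exists_lipschitzWith_clampExtension hT'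
  have hcyl : volume.restrict (Ioo 0 s ×ˢ unitDomain) = cylMeasure s := by
    rw [cylMeasure, Measure.prod_restrict]; rfl
  have heq : ∀ᵐ p ∂cylMeasure s, lineDeriv ℝ (clampExtension T' (v k)) p (0, 1) =
      deriv (v k p.1) p.2 := by
    filter_upwards [ae_mem_cylMeasure s] with p hp
    exact lineDeriv_clampExtension_space ⟨hp.1, hp.2.trans_le hs⟩ p.2
  -- Finiteness matters because `toReal` sends an infinite norm to `0`, which would bound nothing.
  have hfin : eLpNorm (fun p : ℝ × ℝ => deriv (v k p.1) p.2) ∞ (cylMeasure s) < ∞ := by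
    rw [eLpNorm_exponent_top]
    refine eLpNormEssSup_lt_top_of_ae_bound (C := c * ‖((0 : ℝ), (1 : ℝ))‖) ?_
    filter_upwards [heq] with p hp
    rw [← hp]
    exact norm_lineDeriv_le_of_lipschitz ℝ hc
  have hle : (eLpNorm (fun p : ℝ × ℝ => deriv (v k p.1) p.2) ∞ (cylMeasure s)).toReal ≤
      maxSpatialSlope v s := by
    rw [← hcyl]
    exact le_ciSup (f := fun k => (eLpNorm (fun p : ℝ × ℝ => deriv (v k p.1) p.2) ∞
      (volume.restrict (Ioo 0 s ×ˢ unitDomain))).toReal) (Set.finite_range _).bddAbove k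
  have hess := ae_le_eLpNormEssSup (f := fun p : ℝ × ℝ => deriv (v k p.1) p.2)
    (μ := cylMeasure s)
  filter_upwards [heq, hess] with p hp hp'
  rw [hp]
  refine le_trans ?_ hle
  rw [← toReal_enorm]
  rw [eLpNorm_exponent_top] at hfin ⊢
  exact ENNReal.toReal_mono hfin.ne hp'

end Reconstructions

/-! ### Transport plans to finitely supported measures -/

section Transport

variable {X : Type*} {ι : Type*} [Fintype ι]

lemma wassersteinDist_two_sq [NormedAddCommGroup X] [MeasurableSpace X] (μ ρ : Measure X) :
    wassersteinDist 2 μ ρ ^ 2 = ⨅ π ∈ transportPlans μ ρ, ∫⁻ p, ‖p.1 - p.2‖ₑ ^ (2 : ℝ) ∂π := by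
  rw [wassersteinDist, ← ENNReal.rpow_natCast, ← ENNReal.rpow_mul]
  norm_num

lemma lintegral_sum_smul_dirac [MeasurableSpace X] (a : ι → ℝ≥0∞) (p : ι → X) {g : X → ℝ≥0∞}
    (hg : Measurable g) :
    ∫⁻ x, g x ∂(∑ i, a i • Measure.dirac (p i)) = ∑ i, a i * g (p i) := by
  rw [lintegral_finsetSum_measure]
  simp [lintegral_dirac' _ hg]

/-- A transport plan to a finitely supported measure is a finite decomposition of its first
marginal. -/
lemma exists_decomposition_of_mem_transportPlans [MeasurableSpace X] [StandardBorelSpace X]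
    {μ : Measure X} [IsProbabilityMeasure μ] {a : ι → ℝ≥0∞} {p : ι → X} {π : Measure (X × X)}
    (hπ : π ∈ transportPlans μ (∑ i, a i • Measure.dirac (p i))) :
    ∃ ρ : ι → Measure X, (∀ i, IsProbabilityMeasure (ρ i)) ∧ ∑ i, a i • ρ i = μ ∧
      ∀ g : X × X → ℝ≥0∞, Measurable g → ∫⁻ z, g z ∂π = ∑ i, a i * ∫⁻ u, g (u, p i) ∂ρ i := by
  have hne : Nonempty X := by
    by_contra h
    rw [not_nonempty_iff] at h
    have h1 := measure_univ (μ := μ)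
    rw [Set.univ_eq_empty_iff.2 h, measure_empty] at h1
    exact zero_ne_one h1
  have hfin : IsFiniteMeasure π := by
    refine ⟨?_⟩
    have h1 := measure_univ (μ := μ)
    rw [← hπ.1, Measure.map_apply measurable_fst MeasurableSet.univ, preimage_univ] at h1
    rw [h1]; exact ENNReal.one_lt_top
  have hfin' : IsFiniteMeasure (π.map Prod.swap) := inferInstance
  -- The coordinates are swapped so that disintegration is over the finitely supported marginal.
  set σ := π.map Prod.swap with hσ
  have hfst : σ.fst = ∑ i, a i • Measure.dirac (p i) := by
    rw [Measure.fst, hσ, Measure.map_map measurable_fst measurable_swap]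
    exact hπ.2
  have key : ∀ g : X × X → ℝ≥0∞, Measurable g →
      ∫⁻ z, g z ∂π = ∑ i, a i * ∫⁻ u, g (u, p i) ∂σ.condKernel (p i) := fun g hg => by
    have h1 : ∫⁻ z, g z ∂π = ∫⁻ z, g z.swap ∂σ := by
      rw [hσ, lintegral_map (f := fun z : X × X => g z.swap) (hg.comp measurable_swap)
        measurable_swap]
      simp
    have h2 : Measurable fun z : X × X => g z.swap := hg.comp measurable_swap
    have h3 : ∫⁻ z, g z.swap ∂σ = ∫⁻ z, g z.swap ∂(σ.fst ⊗ₘ σ.condKernel) := by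
      rw [σ.disintegrate σ.condKernel]
    rw [h1, h3, Measure.lintegral_compProd h2, hfst]
    exact lintegral_sum_smul_dirac a p (h2.lintegral_kernel_prod_right' (κ := σ.condKernel))
  -- The atoms need not be distinct: coinciding atoms share one conditional law, and the sum of
  -- their weights is still correct. The marginal identity is the cost formula for an indicator of
  -- the first coordinate.
  refine ⟨fun i => σ.condKernel (p i), fun i => inferInstance, ?_, key⟩
  ext s hs
  have h1 := key (fun z => s.indicator 1 z.1)
    ((measurable_one.indicator hs).comp measurable_fst)
  have h2 : ∫⁻ z, s.indicator 1 z.1 ∂π = μ s := by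
    rw [← hπ.1, Measure.map_apply measurable_fst hs]
    exact lintegral_indicator_one (measurable_fst hs)
  rw [h2] at h1
  rw [h1]
  simp [Measure.finsetSum_apply, lintegral_indicator_one hs]

/-- The Wasserstein distance to a finitely supported measure is bounded by the cost of the plan
given by a decomposition. -/
lemma wassersteinDist_two_sq_le [NormedAddCommGroup X] [MeasurableSpace X] [BorelSpace X]
    [SecondCountableTopology X] {ρ : ι → Measure X} [∀ i, IsProbabilityMeasure (ρ i)]
    (a : ι → ℝ≥0∞) (p : ι → X) :
    wassersteinDist 2 (∑ i, a i • ρ i) (∑ i, a i • Measure.dirac (p i)) ^ 2 ≤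
      ∑ i, a i * ∫⁻ u, ‖u - p i‖ₑ ^ (2 : ℝ) ∂ρ i := by
  have hm : ∀ i, Measurable fun u : X => (u, p i) := fun i => measurable_prodMk_right
  rw [wassersteinDist_two_sq]
  refine (iInf₂_le (∑ i, a i • (ρ i).map fun u => (u, p i)) ⟨?_, ?_⟩).trans (le_of_eq ?_)
  · rw [lintegral_finsetSum_measure]
    refine Finset.sum_congr rfl fun i _ => ?_
    rw [lintegral_smul_measure, lintegral_map (by fun_prop) (hm i), smul_eq_mul]
  · rw [Measure.map_finset_sum' measurable_fst.aemeasurable]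
    refine Finset.sum_congr rfl fun i _ => ?_
    rw [Measure.map_smul, Measure.map_map measurable_fst (hm i)]
    simp [Function.comp_def]
  · rw [Measure.map_finset_sum' measurable_snd.aemeasurable]
    refine Finset.sum_congr rfl fun i _ => ?_
    rw [Measure.map_smul, Measure.map_map measurable_snd (hm i)]
    simp [Function.comp_def, Measure.map_const]

lemma sum_subtype_pos {M : Type*} [AddCommMonoid M] {w : ι → ℝ} {g : ι → M}
    (h : ∀ i, ¬0 < w i → g i = 0) : ∑ i : {i // 0 < w i}, g i = ∑ i, g i := by
  classical
  rw [← Finset.sum_subtype (Finset.univ.filter fun i => 0 < w i) (by simp) g]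
  exact Finset.sum_filter_of_ne fun i _ hi => by_contra fun h' => hi (h i h')

lemma IsValuedIn.lintegral_enorm_sub_sq {m : ℕ} {C : Set (Vec m)} {μ : Measure (L2Fun m)}
    [IsFiniteMeasure μ] (hC : IsCompact C) (h : IsValuedIn C μ) (b : L2Fun m) :
    ∫⁻ u, ‖u - b‖ₑ ^ (2 : ℝ) ∂μ = ENNReal.ofReal (∫ u, ‖u - b‖ ^ 2 ∂μ) := by
  rw [ofReal_integral_eq_lintegral_ofReal (h.integrable_norm_sub_sq hC b)
    (Eventually.of_forall fun u => sq_nonneg _)]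
  refine lintegral_congr fun u => ?_
  rw [ENNReal.ofReal_pow (norm_nonneg _), ofReal_norm, ← ENNReal.rpow_natCast]
  norm_num

end Transport

/-! ### Stability in the Wasserstein distance -/

/-- The constant `A` dominates `cl⁻¹`, `cf cl⁻¹` and `cu`, and `A ≥ 1` because `1 = cl cl⁻¹ ≤ A²`.
With one factor `cu = B` taken out, the rate is `cu/cl + (cf/cl) L`, whose coefficients are at most
`A²` and `A`, hence at most `A³`. -/
lemma stability_constants_le {cf cl cu A R G L s : ℝ} (hcf : 0 ≤ cf) (hcl : 0 < cl)
    (hclu : cl ≤ cu) (hA : A = max ((1 + cf) * cl⁻¹) cu) (hR : 0 ≤ R) (hG : 0 ≤ G) (hL : 0 ≤ L)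
    (hs : 0 ≤ s) :
    (R + cu * G) / cl * Real.exp ((cu ^ 2 + cu * cf * L) / cl * s) ≤
      A * (R + A * G) * Real.exp (s * A ^ 3 * cu * (L + 1)) := by
  have hcl' : 0 < cl⁻¹ := inv_pos.2 hcl
  have hcu : 0 < cu := hcl.trans_le hclu
  have h1 : (1 + cf) * cl⁻¹ ≤ A := hA ▸ le_max_left _ _
  have h2 : cu ≤ A := hA ▸ le_max_right _ _
  have h3 : cl⁻¹ ≤ A := by nlinarith
  have h4 : cf * cl⁻¹ ≤ A := by nlinarith
  have hA0 : 0 < A := hcu.trans_le h2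
  have hA1 : 1 ≤ A := by
    have : cl * cl⁻¹ ≤ A * A := mul_le_mul (hclu.trans h2) h3 hcl'.le hA0.le
    rw [mul_inv_cancel₀ hcl.ne'] at this
    nlinarith
  have h5 : cu * cl⁻¹ ≤ A ^ 3 := by
    have : cu * cl⁻¹ ≤ A ^ 2 := by rw [sq]; exact mul_le_mul h2 h3 hcl'.le hA0.le
    exact this.trans (pow_le_pow_right₀ hA1 (by norm_num))
  have h6 : cf * cl⁻¹ ≤ A ^ 3 := h4.trans (le_self_pow₀ hA1 (by norm_num))
  have h7 : (cu ^ 2 + cu * cf * L) / cl * s ≤ s * A ^ 3 * cu * (L + 1) := by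
    have e : (cu ^ 2 + cu * cf * L) / cl * s = s * cu * (cu * cl⁻¹ + cf * cl⁻¹ * L) := by
      rw [div_eq_mul_inv]; ring
    rw [e, show s * A ^ 3 * cu * (L + 1) = s * cu * (A ^ 3 + A ^ 3 * L) by ring]
    gcongr
  have h8 : (R + cu * G) / cl ≤ A * (R + A * G) := by
    rw [div_eq_inv_mul]
    gcongr
  gcongr

/-- Countably many `T'` exhaust the interval, so the restriction to times before `T'` costs only a
countable union of null sets. -/
lemma ae_Ioo_of_forall_ae_Ioo {T : ℝ} (hT : 0 < T) {P : ℝ → Prop}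
    (h : ∀ T' ∈ Ioo 0 T, ∀ᵐ s ∂((volume : Measure ℝ).restrict (Ioo 0 T')), P s) :
    ∀ᵐ s ∂((volume : Measure ℝ).restrict (Ioo 0 T)), P s := by
  obtain ⟨u, -, hu, hlim⟩ := exists_seq_strictMono_tendsto' hT
  have h1 : ∀ᵐ s, ∀ n, s ∈ Ioo 0 (u n) → P s :=
    ae_all_iff.2 fun n => (ae_restrict_iff' measurableSet_Ioo).1 (h _ (hu n))
  rw [ae_restrict_iff' measurableSet_Ioo]
  filter_upwards [h1] with s hs hsm
  obtain ⟨n, hn⟩ := (hlim.eventually (lt_mem_nhds hsm.2)).exists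
  exact hs n ⟨hsm.1, hn⟩

/-! ### The bound for a fixed decomposition of the initial data -/

section Decomposition

variable {m : ℕ} {U C : Set (Vec m)} {f : Vec m → Vec m} {η q : Vec m → ℝ} {T : ℝ}
  {μbar : Measure (L2Fun m)} {μ : ℝ → Measure (L2Fun m)} {cf cl cu : ℝ}

/-- The propagated decomposition is itself a competitor in the Wasserstein infimum at time `s`; its
cost is the weighted mean square distance, to which the Young measure estimate applies. -/
lemma ae_wassersteinDist_sq_le_of_decomposition {ι : Type*} [Fintype ι] {w : ι → ℝ}
    {ρ : ι → Measure (L2Fun m)} {μs : ι → ℝ → Measure (L2Fun m)} {v : ι → ℝ → ℝ → Vec m}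
    (hU : IsOpen U) (hC : Convex ℝ C) (hCc : IsCompact C) (hCU : C ⊆ U) (hne : C.Nonempty)
    (hpair : IsEntropyPair U f η q) (hb : HessianBounds C f η cf cl cu)
    (hpos : ∀ v ∈ C, ∀ w, w ≠ 0 → 0 < fderiv ℝ (fderiv ℝ η) v w w)
    (hw : ∀ i, 0 ≤ w i) (hsol : ∀ i, IsCStatSol U C f T (ρ i) (μs i))
    (hμ : ∀ t ∈ Ico 0 T, ∑ i, ENNReal.ofReal (w i) • μs i t = μ t)
    (hμbar : ∑ i, ENNReal.ofReal (w i) • ρ i = μbar)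
    (hent : ∀ φ : ℝ × ℝ → ℝ, IsNonnegTestFunction T φ →
      0 ≤ (∫ t in Ioo 0 T, ∫ u, (∫ x in unitDomain,
        (η (u x) * deriv (fun τ => φ (τ, x)) t + q (u x) * deriv (fun y => φ (t, y)) x)) ∂(μ t)) +
      ∫ u, (∫ x in unitDomain, η (u x) * φ (0, x)) ∂μbar)
    (hv : ∀ i, IsReconstruction T (v i)) (hvC : ∀ i, ∀ t ∈ Ico 0 T, ∀ x, v i t x ∈ C)
    {T' : ℝ} (hT' : T' ∈ Ioo 0 T) :
    ∀ᵐ s ∂(volume.restrict (Ioo 0 T')), ∀ L : ℝ, 0 ≤ L →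
      (∀ i, ∀ᵐ p ∂cylMeasure s, ‖lineDeriv ℝ (clampExtension T' (v i)) p (0, 1)‖ ≤ L) →
      wassersteinDist 2 (μ s) (∑ i, ENNReal.ofReal (w i) • Measure.dirac (toL2 (v i s))) ^ 2 ≤
        ENNReal.ofReal ((∑ i, w i * (∫ t in Ioo 0 s, ∫ x in unitDomain,
            ‖spaceTimeResidual f (v i) t x‖ ^ 2) +
          cu * ∑ i, w i * ∫ u, ‖u - toL2 (v i 0)‖ ^ 2 ∂ρ i) / cl *
        Real.exp ((cu ^ 2 + cu * cf * L) / cl * s)) := by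
  choose κ hκ using fun i => (hsol i).exists_youngMeasure hU hCc hCU hne
  have hT0 : (0 : ℝ) ∈ Ico 0 T := ⟨le_rfl, hT'.1.trans hT'.2⟩
  have hmem : ∀ i p, clampExtension T' (v i) p ∈ C := fun i p => hvC i _ (clamp_mem hT' _) _
  have hcomp : ∀ i, IsComparison U C f T (ρ i) (μs i) (κ i) (clampExtension T' (v i)) := fun i =>
    ⟨hκ i, (hsol i).initial_prob, (hsol i).initial_valued, (hsol i).prob, (hsol i).valued,
      (hv i).exists_lipschitzWith_clampExtension hT', hmem i,
      (hv i).clampExtension_periodic hT'⟩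
  have h1 := ae_totalSqDist_le hU hC hCc hCU hpair hb hpos (hT'.1.trans hT'.2) hw hcomp hμ hμbar
    hent hT'.2
  have h2 := ae_all_iff.2 fun i => ae_restrict_of_ae_restrict_of_subset
    (Ioo_subset_Ioo_right hT'.2.le) ((hcomp i).ae_integral_norm_sub_toL2 hCc)
  filter_upwards [h1, h2, ae_restrict_mem measurableSet_Ioo] with s hs hs' hsm L hL0 hL
  have hsT : s ∈ Ico 0 T := ⟨hsm.1.le, hsm.2.trans hT'.2⟩
  have hprob : ∀ i, IsProbabilityMeasure (μs i s) := fun i => (hsol i).prob s hsT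
  have hslice : ∀ i, (fun x => clampExtension T' (v i) (s, x)) = v i s := fun i =>
    funext (clampExtension_of_mem (Ioo_subset_Icc_self hsm))
  rw [← hμ s hsT]
  refine (wassersteinDist_two_sq_le _ _).trans ?_
  have e1 : ∑ i, ENNReal.ofReal (w i) * ∫⁻ u, ‖u - toL2 (v i s)‖ₑ ^ (2 : ℝ) ∂μs i s =
      ENNReal.ofReal (totalSqDist w (fun i => clampExtension T' (v i)) κ s) := by
    have hnn : ∀ i ∈ Finset.univ, 0 ≤ w i * ∫ x in unitDomain,
        meanSqDist (clampExtension T' (v i)) (κ i) (s, x) := fun i _ =>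
      mul_nonneg (hw i) (integral_nonneg fun x => integral_nonneg fun ξ => sq_nonneg _)
    rw [totalSqDist, ENNReal.ofReal_sum_of_nonneg hnn]
    refine Finset.sum_congr rfl fun i _ => ?_
    rw [((hsol i).valued s hsT).lintegral_enorm_sub_sq hCc, ENNReal.ofReal_mul (hw i), ← hs' i,
      hslice i]
  rw [e1]
  refine ENNReal.ofReal_le_ofReal ((hs L hL0 hL).trans (le_of_eq ?_))
  congr 3
  · refine Finset.sum_congr rfl fun i _ => ?_
    rw [(hv i).integral_residualAt_clampExtension hU hCU hpair.flux_contDiffOn hT' (hmem i)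
      hsm.2.le ((hcomp i).isBddMeasurable_residualAt hU hCc hCU hpair)]
  · congr 1
    refine Finset.sum_congr rfl fun i _ => ?_
    have hc := (hv i).continuous_slice hT0
    simp_rw [clampExtension_of_mem (v := v i) ⟨le_rfl, hT'.1.le⟩, toL2_of_continuous hc,
      integral_norm_sub_sq (hc.memLp_unitDomain 2)]

end Decomposition

/-! ### From decompositions to transport plans, and the infimum over plans -/

section Main

variable {m K : ℕ} {U C : Set (Vec m)} {f : Vec m → Vec m} {η q : Vec m → ℝ} {T : ℝ}
  {μbar : Measure (L2Fun m)} {μ : ℝ → Measure (L2Fun m)} {cf cl cu : ℝ}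
  {w : Fin K → ℝ} {v : Fin K → ℝ → ℝ → Vec m}

lemma IsCStatSol.nonempty (h : IsCStatSol U C f T μbar μ) : C.Nonempty := by
  have := h.initial_prob
  obtain ⟨u, hu⟩ := h.initial_valued.exists
  exact hu.exists.imp' _ fun _ hx => hx

/-- An atom of positive weight inherits the almost sure property, and continuity with periodicity
upgrades it to every point. Nothing is known about reconstructions of weight zero, so they are
dropped from the comparison. -/
lemma mem_of_isValuedIn_regularizedEmpiricalMeasure (hC : IsClosed C)
    (hv : ∀ k, IsReconstruction T (v k)) {t : ℝ} (ht : t ∈ Ico 0 T)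
    (h : IsValuedIn C (regularizedEmpiricalMeasure w v t)) {k : Fin K} (hk : 0 < w k) (x : ℝ) :
    v k t x ∈ C := by
  have hc := (hv k).continuous_slice ht
  have h1 : IsValuedIn C (Measure.dirac (toL2 (v k t))) := by
    have hle : ENNReal.ofReal (w k) • Measure.dirac (toL2 (v k t)) ≤
        regularizedEmpiricalMeasure w v t :=
      Finset.single_le_sum (f := fun k => ENNReal.ofReal (w k) • Measure.dirac (toL2 (v k t)))
        (fun _ _ => Measure.zero_le _) (Finset.mem_univ k)
    have h2 := (Measure.absolutelyContinuous_of_le hle).ae_le h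
    exact (Measure.ae_ennreal_smul_measure_iff (ENNReal.ofReal_pos.2 hk).ne').1 h2
  rw [IsValuedIn, ae_dirac_eq, eventually_pure, toL2_of_continuous hc] at h1
  refine mem_of_ae_mem_unitDomain hc ((hv k).periodic t ht) hC ?_ x
  filter_upwards [h1, (hc.memLp_unitDomain 2).coeFn_toLp] with y hy hy'
  rwa [← hy']

lemma regularizedEmpiricalMeasure_eq_sum_subtype (w : Fin K → ℝ) (v : Fin K → ℝ → ℝ → Vec m)
    (t : ℝ) : regularizedEmpiricalMeasure w v t =
      ∑ i : {k // 0 < w k}, ENNReal.ofReal (w i) • Measure.dirac (toL2 (v i t)) :=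
  (sum_subtype_pos (w := w) fun k hk => by
    rw [ENNReal.ofReal_of_nonpos (not_lt.1 hk), zero_smul]).symm

/-- The stability property of dissipative solutions for decompositions with non-negative
weights. -/
lemma IsDissipativeCStatSol.exists_decomposition (hμ : IsDissipativeCStatSol U C f η q T μbar μ)
    (hw : ∀ k, 0 ≤ w k) (hwsum : ∑ k, w k = 1) {ρ : Fin K → Measure (L2Fun m)}
    (hρ : ∀ k, IsProbabilityMeasure (ρ k)) (hρs : ∑ k, ENNReal.ofReal (w k) • ρ k = μbar) :
    ∃ μs : {k // 0 < w k} → ℝ → Measure (L2Fun m),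
      (∀ t ∈ Ico 0 T, ∑ i : {k // 0 < w k}, ENNReal.ofReal (w i) • μs i t = μ t) ∧
      ∀ i : {k // 0 < w k}, IsCStatSol U C f T (ρ i) (μs i) := by
  -- The stability clause asks for strictly positive weights indexed by some `Fin n`, so the indices
  -- of positive weight are renumbered.
  let e := Fintype.equivFin {k // 0 < w k}
  have hsub : ∑ i : {k // 0 < w k}, w i = 1 :=
    (sum_subtype_pos fun k hk => le_antisymm (not_lt.1 hk) (hw k)).trans hwsum
  have hsubρ : ∑ i : {k // 0 < w k}, ENNReal.ofReal (w i) • ρ i = μbar :=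
    (sum_subtype_pos (g := fun k => ENNReal.ofReal (w k) • ρ k) fun k hk => by
      rw [ENNReal.ofReal_of_nonpos (not_lt.1 hk), zero_smul]).trans hρs
  obtain ⟨μs, h1, h2⟩ := hμ.stable (Fintype.card {k // 0 < w k}) (fun j => w (e.symm j))
    (fun j => (e.symm j).2) ((Equiv.sum_comp e.symm fun i => w i).trans hsub)
    (fun j => ρ (e.symm j)) ⟨fun j => hρ _, (Equiv.sum_comp e.symm
      fun i => ENNReal.ofReal (w i) • ρ i).trans hsubρ⟩
  refine ⟨fun i => μs (e i), fun t ht => ?_, fun i => ?_⟩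
  · rw [← (h1 t ht).2, ← Equiv.sum_comp e]
    simp
  · simpa using h2 (e i)

/-- The cost of the plan is the initial mean square distance of the decomposition it induces. The
decomposition, and with it the exceptional set of times, depends on `π`. -/
lemma IsDissipativeCStatSol.ae_wassersteinDist_sq_le_of_plan (hU : IsOpen U)
    (hC : Convex ℝ C) (hCc : IsCompact C) (hCU : C ⊆ U) (hpair : IsEntropyPair U f η q)
    (hb : HessianBounds C f η cf cl cu)
    (hpos : ∀ v ∈ C, ∀ w, w ≠ 0 → 0 < fderiv ℝ (fderiv ℝ η) v w w) (hT : 0 < T)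
    (hμ : IsDissipativeCStatSol U C f η q T μbar μ) (hw : ∀ k, 0 ≤ w k) (hwsum : ∑ k, w k = 1)
    (hv : ∀ k, IsReconstruction T (v k))
    (hvC : ∀ t ∈ Ico 0 T, IsValuedIn C (regularizedEmpiricalMeasure w v t))
    {A : ℝ} (hA : A = max ((1 + cf) * cl⁻¹) cu) {π : Measure (L2Fun m × L2Fun m)}
    (hπ : π ∈ transportPlans μbar (regularizedEmpiricalMeasure w v 0)) :
    ∀ᵐ s ∂(volume.restrict (Ioo 0 T)),
      wassersteinDist 2 (μ s) (regularizedEmpiricalMeasure w v s) ^ 2 ≤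
        ENNReal.ofReal A * (ENNReal.ofReal (weightedResidual f w v s) +
          ENNReal.ofReal A * ∫⁻ p, ‖p.1 - p.2‖ₑ ^ (2 : ℝ) ∂π) *
        ENNReal.ofReal (Real.exp (s * A ^ 3 * cu * (maxSpatialSlope v s + 1))) := by
  have := hμ.statSol.initial_prob
  have hA0 : 0 ≤ A := hA ▸ (hb.cl_pos.le.trans hb.cl_le_cu).trans (le_max_right _ _)
  obtain ⟨ρ, hρ, hρs, hcost⟩ := exists_decomposition_of_mem_transportPlans hπ
  obtain ⟨μs, hμs, hsol⟩ := hμ.exists_decomposition hw hwsum hρ hρs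
  set G : ℝ := ∑ i : {k // 0 < w k}, w i * ∫ u, ‖u - toL2 (v i 0)‖ ^ 2 ∂ρ i with hG
  have hnn : ∀ i ∈ (Finset.univ : Finset {k // 0 < w k}),
      0 ≤ w i * ∫ u, ‖u - toL2 (v i 0)‖ ^ 2 ∂ρ i := fun i _ =>
    mul_nonneg (hw i) (integral_nonneg fun u => sq_nonneg _)
  have hG0 : 0 ≤ G := Finset.sum_nonneg hnn
  have hcostG : ∫⁻ p, ‖p.1 - p.2‖ₑ ^ (2 : ℝ) ∂π = ENNReal.ofReal G := by
    rw [hcost _ (by fun_prop), ← sum_subtype_pos (w := w) fun k hk => by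
      rw [ENNReal.ofReal_of_nonpos (not_lt.1 hk), zero_mul], hG,
      ENNReal.ofReal_sum_of_nonneg hnn]
    refine Finset.sum_congr rfl fun i _ => ?_
    rw [(hsol i).initial_valued.lintegral_enorm_sub_sq hCc, ENNReal.ofReal_mul (hw i)]
  have hρs' : ∑ i : {k // 0 < w k}, ENNReal.ofReal (w i) • ρ i = μbar :=
    (sum_subtype_pos (g := fun k => ENNReal.ofReal (w k) • ρ k) fun k hk => by
      rw [ENNReal.ofReal_of_nonpos (not_lt.1 hk), zero_smul]).trans hρs
  refine ae_Ioo_of_forall_ae_Ioo hT fun T' hT' => ?_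
  have key := ae_wassersteinDist_sq_le_of_decomposition hU hC hCc hCU hμ.statSol.nonempty hpair hb
    hpos (fun i : {k // 0 < w k} => hw i) hsol hμs hρs' hμ.entropy (fun i => hv i)
    (fun i t ht x => mem_of_isValuedIn_regularizedEmpiricalMeasure hCc.isClosed hv ht
      (hvC t ht) i.2 x) hT'
  filter_upwards [key, ae_restrict_mem measurableSet_Ioo] with s hs hsm
  have hR0 : 0 ≤ weightedResidual f w v s := Finset.sum_nonneg fun k _ =>
    mul_nonneg (hw k) (integral_nonneg fun t => integral_nonneg fun x => sq_nonneg _)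
  have hRes : ∑ i : {k // 0 < w k}, w i * (∫ t in Ioo 0 s, ∫ x in unitDomain,
      ‖spaceTimeResidual f (v i) t x‖ ^ 2) = weightedResidual f w v s :=
    sum_subtype_pos (g := fun k => w k * ∫ t in Ioo 0 s, ∫ x in unitDomain,
      ‖spaceTimeResidual f (v k) t x‖ ^ 2) fun k hk => by
        rw [le_antisymm (not_lt.1 hk) (hw k), zero_mul]
  have h1 := hs (maxSpatialSlope v s) (maxSpatialSlope_nonneg v s)
    fun i => ae_norm_lineDeriv_le_maxSpatialSlope hv hT' hsm.2.le i
  rw [hRes, ← hG, ← regularizedEmpiricalMeasure_eq_sum_subtype] at h1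
  refine h1.trans ((ENNReal.ofReal_le_ofReal (stability_constants_le hb.cf_nonneg hb.cl_pos
    hb.cl_le_cu hA hR0 hG0 (maxSpatialSlope_nonneg v s) hsm.1.le)).trans (le_of_eq ?_))
  rw [hcostG, ENNReal.ofReal_mul (by positivity), ENNReal.ofReal_mul hA0,
    ENNReal.ofReal_add hR0 (by positivity), ENNReal.ofReal_mul hA0]

end Main

theorem mainTheorem2 {m : ℕ} (U C : Set (Vec m)) (hUopen : IsOpen U) (hUconv : Convex ℝ U)
    (hCcomp : IsCompact C) (hCconv : Convex ℝ C) (hCU : C ⊆ U)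
    (f : Vec m → Vec m) (η q : Vec m → ℝ) (hpair : IsEntropyPair U f η q)
    (hpos : ∀ v ∈ C, ∀ w, w ≠ 0 → 0 < fderiv ℝ (fderiv ℝ η) v w w)
    (T : ℝ) (hT : 0 < T)
    (μbar : Measure (L2Fun m)) (μ : ℝ → Measure (L2Fun m))
    (hμ : IsDissipativeCStatSol U C f η q T μbar μ)
    {K : ℕ} (w : Fin K → ℝ) (hw : ∀ k, 0 ≤ w k) (hwsum : ∑ k, w k = 1)
    (v : Fin K → ℝ → ℝ → Vec m) (hv : ∀ k, IsReconstruction T (v k))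
    (hvC : ∀ t ∈ Ico 0 T, IsValuedIn C (regularizedEmpiricalMeasure w v t)) :
    (∃ cf cl cu : ℝ, HessianBounds C f η cf cl cu) ∧
    ∀ cf cl cu : ℝ, HessianBounds C f η cf cl cu →
      ∀ A B : ℝ, A = max ((1 + cf) * cl⁻¹) cu → B = cu →
        ∀ᵐ s ∂(volume.restrict (Ioo 0 T)),
          wassersteinDist 2 (μ s) (regularizedEmpiricalMeasure w v s) ^ 2 ≤
            ENNReal.ofReal A *
              (ENNReal.ofReal (weightedResidual f w v s) +
                ENNReal.ofReal A *
                  wassersteinDist 2 μbar (regularizedEmpiricalMeasure w v 0) ^ 2) *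
              ENNReal.ofReal (Real.exp (s * A ^ 3 * B * (maxSpatialSlope v s + 1))) := by
  refine ⟨exists_hessianBounds hUopen hCcomp hCU hpair hpos, ?_⟩
  rintro cf cl cu hb A B hA rfl
  have := hμ.statSol.initial_prob
  have hνprob : IsProbabilityMeasure (regularizedEmpiricalMeasure w v 0) := by
    refine ⟨?_⟩
    simp [regularizedEmpiricalMeasure, Measure.finsetSum_apply,
      ← ENNReal.ofReal_sum_of_nonneg fun k _ => hw k, hwsum]
  -- The product plan shows that the set of costs is nonempty, so a minimizing sequence exists.
  have hplan : μbar.prod (regularizedEmpiricalMeasure w v 0) ∈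
      transportPlans μbar (regularizedEmpiricalMeasure w v 0) := by
    constructor
    · rw [Measure.map_fst_prod]; simp
    · rw [Measure.map_snd_prod]; simp
  let S : Set ℝ≥0∞ := (fun π : Measure (L2Fun m × L2Fun m) => ∫⁻ p, ‖p.1 - p.2‖ₑ ^ (2 : ℝ) ∂π) ''
    transportPlans μbar (regularizedEmpiricalMeasure w v 0)
  obtain ⟨c, -, hlim, hcS⟩ := exists_seq_tendsto_sInf (S := S) ⟨_, _, hplan, rfl⟩ (OrderBot.bddBelow S)
  choose π hπ hπc using hcS
  have hW : wassersteinDist 2 μbar (regularizedEmpiricalMeasure w v 0) ^ 2 = sInf S := by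
    rw [wassersteinDist_two_sq, sInf_image]
  -- A sequence of plans costs only countably many null sets; the full family of plans could not be
  -- treated at once.
  have key := ae_all_iff.2 fun n => hμ.ae_wassersteinDist_sq_le_of_plan hUopen hCconv hCcomp hCU
    hpair hb hpos hT hw hwsum hv hvC hA (hπ n)
  filter_upwards [key] with s hs
  rw [hW]
  simp only [hπc] at hs
  -- The right side is continuous in the cost, also at an infinite value, since the other factors
  -- are finite.
  refine ge_of_tendsto' (x := atTop) ?_ hs
  refine ENNReal.Tendsto.mul_const (ENNReal.Tendsto.const_mul ?_ (Or.inr ENNReal.ofReal_ne_top))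
    (Or.inr ENNReal.ofReal_ne_top)
  exact tendsto_const_nhds.add (ENNReal.Tendsto.const_mul hlim (Or.inr ENNReal.ofReal_ne_top))
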